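/- **Setting and notation.** Write $\langle y\rangle=\sqrt{1+|y|^2}$, $\hat v=v/\langle v\rangle$ for $v\in\mathbb R^3$, and let $\lambda_\pm(k)=\pm i\langle k\rangle$, $a_\pm(k)=\mp\frac i2\langle k\rangle^{-1}$ for $k\in\mathbb R^3$. For a symbol $m$, $m(i\partial_x)$ (equivalently, convolution in $x$ with the kernel whose Fourier transform is $m$) is the Fourier multiplier $f\mapsto\int e^{ik\cdot x}m(k)\hat f(k)\,dk$, where $f(x)=\int e^{ik\cdot x}\hat f(k)\,dk$. Let $G^{osc}_\pm(t)$ be the kernel with symbol $e^{\lambda_\pm(k)t}a_\pm(k)$, and for $j\ge1$ let $\phi_{\pm,j}(\cdot,v)$ be the kernel with symbol $(\lambda_\pm(k)+ik\cdot\hat v)^{-j}$. Let $\alpha_0\ge 8$ be an integer, $\epsilon,T>0$, and $\delta_n=\frac{n}{\alpha_0-1}$. Let $S_{0,\pm}\in H^{\alpha_0+1}(\mathbb R^3;\mathbb C)$, let $S(t,x)\in\mathbb R$ be a (measurable) source density on $[0,T)\times\mathbb R^3$, let $E^r(t,x)\in\mathbb R^3$, and put $F=\nabla_xS$, $$E^{osc}_\pm(t,x)=G^{osc}_\pm(t)\star_x\nabla_xS_{0,\pm}+\int_0^tG^{osc}_\pm(t-s)\star_xF(s)\,ds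 .$$ Suppose that $E=\sum_\pm E^{osc}_\pm+E^r$ is a real vector field on $[0,T)\times\mathbb R^3$ (functions of $x$ being given by their continuous, respectively $C^1$, representatives), and that the following *bootstrap assumptions of size $\epsilon$* hold for all $t\in[0,T)$: * $\|S(t)\|_{L^p}+\|\partial_xS(t)\|_{L^p}\le\epsilon\langle t\rangle^{-3(1-1/p)}$ and $\|E^r(t)\|_{L^p}\le\epsilon\langle t\rangle^{-3(1-1/p)}$ for $p\in[1,\infty]$; $\|E^{osc}_\pm(t)\|_{L^p}\le\epsilon\langle t\rangle^{-3(1/2-1/p)}$ for $p\in[2,\infty]$; * $\|\partial_x^\alpha S(t)\|_{L^p}+\|\partial_x^\alpha E^r(t)\|_{L^p}\le\epsilon\langle t\rangle^{-3(1-1/p)+\delta_{|\alpha|}}$ for $p\in[1,\infty]$ and $\|\partial_x^{\alpha+1}E^r(t)\|_{L^2}\le\epsilon\langle t\rangle^{-3/2+\delta_{|\alpha|}}$, for $1\le|\alpha|\le\alpha_0-1$ (where $\partial_x^{\alpha+1}$ stands for all derivatives of order $|\alpha|+1$); * $\|E^{osc}_\pm(t)\|_{H^{\alpha_0}}\le\epsilon$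 and $\|E^{osc}_\pm(t)\|_{H^{\alpha_0+1}}+\|E^r(t)\|_{H^{\alpha_0+1}}+\|S(t)\|_{H^{\alpha_0}}\le\epsilon\langle t\rangle^{\delta_1}$. Let $X_{s,t}(x,v),V_{s,t}(x,v)$, $0\le s\le t<T$, be the backward characteristics: $\frac{d}{ds}X_{s,t}=\widehat V_{s,t}$, $\frac{d}{ds}V_{s,t}=E(s,X_{s,t})$, $X_{t,t}=x$, $V_{t,t}=v$. Put $E^{osc,j}_\pm(t,x,v)=[E^{osc}_\pm(t)\star_x\phi_{\pm,j}(\cdot,v)](x)$ and $$V^{osc}_{s,t}(x,v)=\sum_\pm E^{osc,1}_\pm(s,X_{s,t}(x,v),V_{s,t}(x,v)),\qquad V^{tr}_{s,t}(x,v)=-\int_s^tQ^{tr}(\tau,X_{\tau,t}(x,v),V_{\tau,t}(x,v))\,d\tau,$$ $$Q^{tr}=-\sum_\pm a_\pm(i\partial_x)\phi_{\pm,1}\star_xF+\sum_\pm(\nabla_v\hat v\,E)\cdot\nabla_xE^{osc,2}_\pm+E^r .$$ **Proposition 3.3.** For every integer $\alpha_0\ge8$ there is $\epsilon_0>0$ such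 that for every compact $K\subset\mathbb R^3$ there is a constant $C$ depending only on $\alpha_0$ and $K$ with the following property. In the setting above with $0<\epsilon\le\epsilon_0$ and any $T>0$, for all $0\le s\le t<T$: for all $x,v\in\mathbb R^3$ the integral defining $V^{tr}_{s,t}(x,v)$ converges absolutely and $$V_{s,t}(x,v)=v-V^{osc}_{t,t}(x,v)+V^{osc}_{s,t}(x,v)+V^{tr}_{s,t}(x,v);$$ and for all $x\in\mathbb R^3$, $v\in K$, $$|V^{osc}_{s,t}(x,v)|\le C\epsilon\langle s\rangle^{-3/2},\qquad|V^{tr}_{s,t}(x,v)|\le C\epsilon\langle s\rangle^{-2},\qquad|V_{s,t}(x,v)-v+V^{osc}_{t,t}(x,v)|\le C\epsilon\langle s\rangle^{-3/2}.$$ -/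

import Mathlib

open MeasureTheory
open scoped FourierTransform ContDiff ENNReal

namespace VKG

noncomputable section

/-- Physical space, momentum space and frequency space. -/
abbrev R3 := EuclideanSpace ℝ (Fin 3)

/-- Complex vectors with the Hermitian norm; the half fields `E^osc_±` take values here. -/
abbrev C3 := EuclideanSpace ℂ (Fin 3)

/-- The inclusion of real vectors into complex vectors. -/
def toC3 (w : R3) : C3 := WithLp.toLp 2 fun j => ((w j : ℝ) : ℂ)

/-- The Japanese bracket `⟨y⟩ = √(1 + |y|²)`, for times, velocities and frequencies. -/
def bracket {G : Type*} [NormedAddCommGroup G] (y : G) : ℝ := Real.sqrt (1 + ‖y‖ ^ 2)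

/-- The relativistic velocity `v̂ = v / ⟨v⟩`. -/
def relVel (v : R3) : R3 := (bracket v)⁻¹ • v

/-! ### Fourier transform, Fourier multipliers, Sobolev norms -/

/-- The Fourier transform (Plancherel) of a square integrable function, in Mathlib's normalization,
in which the physical frequency is `k = 2πξ`. It is set to `0` off `L²`. -/
def fourierL2 {G : Type*} [NormedAddCommGroup G] [InnerProductSpace ℂ G] [CompleteSpace G]
    (f : R3 → G) : R3 → G :=
  open scoped Classical in
  if hf : MemLp f 2 (volume : Measure R3) then
    ⇑(𝓕 (hf.toLp f : Lp (α := R3) G 2) : Lp (α := R3) G 2)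
  else 0

/-- The Fourier multiplier with symbol `m(k)`, i.e. the convolution in `x` with the kernel whose
Fourier transform is `m`:
`(K ⋆ f)(x) = ∫ e^{2πi x·ξ} m(2πξ) f̂(ξ) dξ`, the continuous representative when `m f̂ ∈ L¹`. -/
def multiplier {G : Type*} [NormedAddCommGroup G] [InnerProductSpace ℂ G] [CompleteSpace G]
    (m : R3 → ℂ) (f : R3 → G) (x : R3) : G :=
  𝓕⁻ (fun ξ : R3 => m ((2 * Real.pi) • ξ) • fourierL2 f ξ) x

/-- The norm of the Sobolev space `H^s`, `‖⟨k⟩^s f̂‖_{L²}` (infinite off `L²`), for `s ≥ 0`. -/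
def sobolevNorm {G : Type*} [NormedAddCommGroup G] [InnerProductSpace ℂ G] [CompleteSpace G]
    (s : ℕ) (f : R3 → G) : ℝ≥0∞ :=
  open scoped Classical in
  if MemLp f 2 (volume : Measure R3) then
    eLpNorm (fun ξ : R3 => ((bracket ((2 * Real.pi) • ξ) ^ s : ℝ) : ℂ) • fourierL2 f ξ) 2 volume
  else ⊤

/-! ### Derivatives in `x` -/

/-- The gradient `∇_x f` of a scalar function. -/
def grad (f : R3 → ℂ) (x : R3) : C3 :=
  WithLp.toLp 2 fun j => fderiv ℝ f x (EuclideanSpace.single j 1)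

/-- `g` is the weak derivative `∂_{J 0} ⋯ ∂_{J (n-1)} f`. -/
def IsWeakDeriv {G : Type*} [NormedAddCommGroup G] [NormedSpace ℝ G] {n : ℕ} (J : Fin n → Fin 3)
    (f g : R3 → G) : Prop :=
  LocallyIntegrable f (volume : Measure R3) ∧ LocallyIntegrable g (volume : Measure R3) ∧
    ∀ φ : R3 → ℝ, ContDiff ℝ ∞ φ → HasCompactSupport φ →
      ∫ x, (iteratedFDeriv ℝ n φ x fun i => EuclideanSpace.single (J i) 1) • f x
        = (-1 : ℝ) ^ n • ∫ x, φ x • g x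

/-! ### Klein-Gordon symbols and the oscillatory fields; the sign `±` is an element of `ℤˣ` -/

/-- `λ_±(k) = ± i ⟨k⟩`. -/
def lam (σ : ℤˣ) (k : R3) : ℂ := ((σ : ℤ) : ℂ) * Complex.I * (bracket k : ℂ)

/-- `a_±(k) = ∓ (i/2) ⟨k⟩⁻¹`. -/
def aSym (σ : ℤˣ) (k : R3) : ℂ := -((σ : ℤ) : ℂ) * (Complex.I / 2) * (bracket k : ℂ)⁻¹

/-- The Fourier transform of the oscillatory kernel `G^osc_±(t, ·)`: `e^{λ_±(k) t} a_±(k)`. -/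
def GoscHat (σ : ℤˣ) (t : ℝ) (k : R3) : ℂ := Complex.exp (lam σ k * (t : ℂ)) * aSym σ k

/-- The Fourier transform of `φ_{±,j}(·, v)`: `(λ_±(k) + i k · v̂)^{-j}`. -/
def phiHat (σ : ℤˣ) (j : ℕ) (v k : R3) : ℂ :=
  ((lam σ k + Complex.I * ((inner ℝ k (relVel v) : ℝ) : ℂ)) ^ j)⁻¹

/-- `F(t, ·) = ∇_x S(t, ·)`. -/
def sourceF (S : ℝ → R3 → ℝ) (t : ℝ) : R3 → C3 := grad fun y => (S t y : ℂ)

/-- `E^osc_±(t) = G^osc_±(t) ⋆_x ∇S₀ + ∫₀ᵗ G^osc_±(t - s) ⋆_x ∇S(s) ds`. -/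
def Eosc (S₀ : ℤˣ → R3 → ℂ) (S : ℝ → R3 → ℝ) (σ : ℤˣ) (t : ℝ) (x : R3) : C3 :=
  multiplier (GoscHat σ t) (grad (S₀ σ)) x
    + ∫ s in (0 : ℝ)..t, multiplier (GoscHat σ (t - s)) (sourceF S s) x

/-- `E^{osc,j}_±(t, x, v) = [E^osc_±(t) ⋆_x φ_{±,j}(·, v)](x)`. -/
def EoscJ (S₀ : ℤˣ → R3 → ℂ) (S : ℝ → R3 → ℝ) (σ : ℤˣ) (j : ℕ) (t : ℝ) (x v : R3) : C3 :=
  multiplier (phiHat σ j v) (Eosc S₀ S σ t) x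

/-! ### The assumptions on the field and the characteristics -/

/-- The bootstrap assumptions of size `ε` on the time interval `[0, T)`, for the oscillatory fields
generated by the initial densities `S₀` and the source density `S`, and for the remainder `Er`. -/
structure Bootstrap (α₀ : ℕ) (ε T : ℝ) (S₀ : ℤˣ → R3 → ℂ) (S : ℝ → R3 → ℝ)
    (Er : ℝ → R3 → R3) : Prop where
  /-- Qualitative regularity: the initial densities are in `H^{α₀+1}`, the source density is
  measurable, and all functions of `x` are given by their continuous (`C¹`) representatives. -/
  S₀_smooth : ∀ σ, ContDiff ℝ 1 (S₀ σ)
  S₀_sobolev : ∀ σ, sobolevNorm (α₀ + 1) (S₀ σ) < ⊤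
  S_measurable : Measurable fun p : Set.Ico 0 T × R3 => S p.1 p.2
  S_smooth : ∀ t ∈ Set.Ico 0 T, ContDiff ℝ 1 (S t)
  Er_continuous : ∀ t ∈ Set.Ico 0 T, Continuous (Er t)
  /-- Decay assumptions. -/
  decay_S : ∀ t ∈ Set.Ico 0 T, ∀ p : ℝ≥0∞, 1 ≤ p →
    eLpNorm (S t) p volume + eLpNorm (sourceF S t) p volume
      ≤ ENNReal.ofReal (ε * bracket t ^ (-3 * (1 - p⁻¹.toReal)))
  decay_Er : ∀ t ∈ Set.Ico 0 T, ∀ p : ℝ≥0∞, 1 ≤ p →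
    eLpNorm (Er t) p volume ≤ ENNReal.ofReal (ε * bracket t ^ (-3 * (1 - p⁻¹.toReal)))
  decay_Eosc : ∀ σ, ∀ t ∈ Set.Ico 0 T, ∀ p : ℝ≥0∞, 2 ≤ p →
    eLpNorm (Eosc S₀ S σ t) p volume
      ≤ ENNReal.ofReal (ε * bracket t ^ (-3 * (1 / 2 - p⁻¹.toReal)))
  /-- Decay assumptions for higher derivatives, with `δ_n = n / (α₀ - 1)`. -/
  decay_deriv : ∀ t ∈ Set.Ico 0 T, ∀ n : ℕ, 1 ≤ n → n + 1 ≤ α₀ → ∀ J : Fin n → Fin 3,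
    ∃ (g : R3 → ℝ) (h : R3 → R3), IsWeakDeriv J (S t) g ∧ IsWeakDeriv J (Er t) h ∧
      ∀ p : ℝ≥0∞, 1 ≤ p → eLpNorm g p volume + eLpNorm h p volume
        ≤ ENNReal.ofReal
          (ε * bracket t ^ (-3 * (1 - p⁻¹.toReal) + (n : ℝ) / ((α₀ : ℝ) - 1)))
  decay_deriv_succ : ∀ t ∈ Set.Ico 0 T, ∀ n : ℕ, 1 ≤ n → n + 1 ≤ α₀ → ∀ J : Fin (n + 1) → Fin 3,
    ∃ h : R3 → R3, IsWeakDeriv J (Er t) h ∧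
      eLpNorm h 2 volume
        ≤ ENNReal.ofReal (ε * bracket t ^ (-(3 / 2 : ℝ) + (n : ℝ) / ((α₀ : ℝ) - 1)))
  /-- Boundedness assumptions. -/
  bound_Eosc : ∀ σ, ∀ t ∈ Set.Ico 0 T,
    sobolevNorm α₀ (Eosc S₀ S σ t) ≤ ENNReal.ofReal ε
  bound_top : ∀ σ, ∀ t ∈ Set.Ico 0 T,
    sobolevNorm (α₀ + 1) (Eosc S₀ S σ t) + sobolevNorm (α₀ + 1) (fun y => toC3 (Er t y))
        + sobolevNorm α₀ (fun y => (S t y : ℂ))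
      ≤ ENNReal.ofReal (ε * bracket t ^ (1 / ((α₀ : ℝ) - 1)))

/-- `E = ∑_± E^osc_± + E^r` on `[0, T)`. -/
def IsField (T : ℝ) (S₀ : ℤˣ → R3 → ℂ) (S : ℝ → R3 → ℝ) (Er E : ℝ → R3 → R3) : Prop :=
  ∀ t ∈ Set.Ico 0 T, ∀ x, toC3 (E t x) = (∑ σ : ℤˣ, Eosc S₀ S σ t x) + toC3 (Er t x)

/-- `X s t x v`, `V s t x v` are the backward characteristics `X_{s,t}(x,v)`, `V_{s,t}(x,v)`,
`0 ≤ s ≤ t < T`, of the field `E`. -/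
structure IsCharacteristic (T : ℝ) (E : ℝ → R3 → R3) (X V : ℝ → ℝ → R3 → R3 → R3) : Prop where
  X_self : ∀ t ∈ Set.Ico 0 T, ∀ x v, X t t x v = x
  V_self : ∀ t ∈ Set.Ico 0 T, ∀ x v, V t t x v = v
  hasDeriv_X : ∀ t ∈ Set.Ico 0 T, ∀ x v, ∀ s ∈ Set.Icc 0 t,
    HasDerivWithinAt (fun s' => X s' t x v) (relVel (V s t x v)) (Set.Icc 0 t) s
  hasDeriv_V : ∀ t ∈ Set.Ico 0 T, ∀ x v, ∀ s ∈ Set.Icc 0 t,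
    HasDerivWithinAt (fun s' => V s' t x v) (E s (X s t x v)) (Set.Icc 0 t) s

/-! ### The pieces of the velocity -/

/-- `V^osc_{s,t}(x,v) = ∑_± E^{osc,1}_±(s, X_{s,t}(x,v), V_{s,t}(x,v))`. -/
def Vosc (S₀ : ℤˣ → R3 → ℂ) (S : ℝ → R3 → ℝ) (X V : ℝ → ℝ → R3 → R3 → R3)
    (s t : ℝ) (x v : R3) : C3 :=
  ∑ σ : ℤˣ, EoscJ S₀ S σ 1 s (X s t x v) (V s t x v)

/-- The source
`Q^tr = - ∑_± a_±(i∂_x) φ_{±,1} ⋆_x F + ∑_± (∇_v v̂ E) · ∇_x E^{osc,2}_± + E^r`, where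
`(∇_v v̂ E) · ∇_x` is the derivative in `x` in the direction of the differential of `v ↦ v̂`
applied to `E(t, x)`. -/
def Qtr (S₀ : ℤˣ → R3 → ℂ) (S : ℝ → R3 → ℝ) (Er E : ℝ → R3 → R3) (t : ℝ) (x v : R3) : C3 :=
  -(∑ σ : ℤˣ, multiplier (fun k => aSym σ k * phiHat σ 1 v k) (sourceF S t) x)
    + (∑ σ : ℤˣ, fderiv ℝ (fun y => EoscJ S₀ S σ 2 t y v) x (fderiv ℝ relVel v (E t x)))
    + toC3 (Er t x)

/-- `V^tr_{s,t}(x,v) = - ∫_s^t Q^tr(τ, X_{τ,t}(x,v), V_{τ,t}(x,v)) dτ`. -/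
def Vtr (S₀ : ℤˣ → R3 → ℂ) (S : ℝ → R3 → ℝ) (Er E : ℝ → R3 → R3) (X V : ℝ → ℝ → R3 → R3 → R3)
    (s t : ℝ) (x v : R3) : C3 :=
  -∫ τ in s..t, Qtr S₀ S Er E τ (X τ t x v) (V τ t x v)

end

end VKG

/-!
The statement is a normal form (integration by parts in time) for the oscillatory part of the force.
On the Fourier side `E^osc_±(τ)` is `e^{λ_± τ}` times a profile whose time derivative is the forcing
`e^{-λ_± τ} a_± ∇S`. Along a characteristic the plane wave `e^{ik·X_τ + λ_± τ}` oscillates with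
frequency `λ_± + ik·v̂`, which is of size `⟨k⟩` because `|v̂| < 1`, so it is the derivative of
`(λ_± + ik·v̂)⁻¹ e^{ik·X_τ + λ_± τ}` up to the change of `v̂`. Hence `E^{osc,1}_±` has along the
characteristic the derivative `E^osc_± - (∇_v v̂ E)·∇_x E^{osc,2}_± + a_±(i∂_x) φ_{±,1} ⋆ F`; summing
over the signs and adding `E^r` this is `E - Q^tr`, and `E` is the derivative of the velocity
(`Bootstrap.EoscJ_sub_eq_integral`, `Bootstrap.velocity_eq`). The source is only measurable in time,
so at each frequency the profile is merely Lipschitz and the product rule is used for absolutely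
continuous functions; the frequency integral is interchanged with the time integral by Fubini, for
which the Sobolev bounds give more than enough decay in `k`.

For the estimates, `φ_{±,1}`, `a_± φ_{±,1}` and `ik·d φ_{±,2}` are symbols of order `-1`, uniformly
for `|v| ≤ R` and `|d| ≤ 1`. Such multipliers are bounded on bounded functions
(`exists_sup_bound`): their kernels are integrable, since by Plancherel two derivatives of the symbol
control `|x| K` and `|x|² K` in `L²`, and `(|x| + |x|²)⁻¹` is square integrable in three dimensions.
The pointwise decay `⟨t⟩^{-3/2}` of `E^osc_±` thus passes to `E^{osc,1}_±`, and `Q^tr` decays like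
`⟨t⟩⁻³` (`exists_norm_Qtr_le`): two of its terms are linear in `F` and `E^r`, the third is quadratic in
the field. Finally `⟨t⟩^{-3/2}` is integrable, so velocities starting in a compact set stay bounded
when `ε ≤ 1`, and `∫_s^∞ ⟨τ⟩⁻³ dτ ≤ ⟨s⟩⁻²`.
-/

set_option linter.unusedSectionVars false

namespace VKG

/-! ### The Plancherel transform and the Fourier integral -/

section Plancherel

variable {G : Type*} [NormedAddCommGroup G] [InnerProductSpace ℂ G] [CompleteSpace G]

/-- The multiplication formula for the Fourier transform. -/
lemma integral_fourier_smul_eq {f : R3 → ℂ} {g : R3 → G} (hf : Integrable f) (hg : Integrable g) :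
    ∫ ξ, 𝓕 f ξ • g ξ = ∫ x, f x • 𝓕 g x := by
  simpa using! VectorFourier.integral_fourierIntegral_smul_eq_flip (L := innerₗ R3)
      Real.continuous_fourierChar continuous_inner hf hg

lemma continuous_fourier {f : R3 → G} (hf : Integrable f) : Continuous (𝓕 f) :=
  VectorFourier.fourierIntegral_continuous Real.continuous_fourierChar
    (by exact continuous_inner) hf

lemma continuous_fourierInv {f : R3 → G} (hf : Integrable f) : Continuous (𝓕⁻ f) := by
  have : 𝓕⁻ f = fun x => 𝓕 f (-x) := by
    ext x; exact Real.fourierInv_eq_fourier_neg f x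
  rw [this]
  exact (continuous_fourier hf).comp continuous_neg

lemma fourierL2_of_memLp {f : R3 → G} (h2 : MemLp f 2) :
    fourierL2 f = ⇑(𝓕 (h2.toLp f (μ := volume)) : Lp (α := R3) G 2) := by
  unfold fourierL2
  rw [dif_pos h2]

/-- The Plancherel transform of `f`, tested against Schwartz functions. -/
lemma integral_smul_fourierL2 {f : R3 → G} (h2 : MemLp f 2) (φ : SchwartzMap R3 ℂ) :
    ∫ ξ, φ ξ • fourierL2 f ξ = ∫ x, (𝓕 (φ : R3 → ℂ)) x • f x := by
  have h := congrArg (fun T => T φ) (Lp.fourier_toTemperedDistribution_eq (h2.toLp f))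
  simp only [TemperedDistribution.fourier_apply, Lp.toTemperedDistribution_apply] at h
  rw [fourierL2_of_memLp h2, ← h]
  apply integral_congr_ae
  filter_upwards [h2.coeFn_toLp] with x hx
  rw [hx, SchwartzMap.fourier_coe]

lemma memLp_fourierL2 (f : R3 → G) : MemLp (fourierL2 f) 2 := by
  unfold fourierL2
  split_ifs with h
  · exact Lp.memLp _
  · exact MemLp.zero

/-- Schwartz functions separate locally integrable functions. -/
lemma ae_eq_of_integral_schwartz_smul_eq {f g : R3 → G} (hf : LocallyIntegrable f)
    (hg : LocallyIntegrable g)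
    (h : ∀ φ : SchwartzMap R3 ℂ, ∫ ξ, φ ξ • f ξ = ∫ x, φ x • g x) :
    f =ᵐ[volume] g := by
  have h2 : ∀ φ : R3 → ℝ, ContDiff ℝ ∞ φ → HasCompactSupport φ →
      ∫ x, φ x • f x = ∫ x, φ x • g x := by
    intro φ hφ hc
    have hc' : HasCompactSupport fun x => (φ x : ℂ) := hc.comp_left Complex.ofReal_zero
    have hφ' : ContDiff ℝ ∞ fun x => (φ x : ℂ) := Complex.ofRealCLM.contDiff.comp hφ
    have key : ∫ ξ, (φ ξ : ℂ) • f ξ = ∫ x, (φ x : ℂ) • g x := h (hc'.toSchwartzMap hφ')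
    simp_rw [← Complex.coe_smul]
    exact key
  exact ae_eq_of_integral_contDiff_smul_eq hf hg h2

/-- The Plancherel transform of `f` is the only locally integrable function with the right integrals
against Schwartz functions. -/
lemma fourierL2_ae_eq {f g : R3 → G} (h2 : MemLp f 2) (hg : LocallyIntegrable g)
    (h : ∀ φ : SchwartzMap R3 ℂ, ∫ ξ, φ ξ • g ξ = ∫ x, (𝓕 (φ : R3 → ℂ)) x • f x) :
    fourierL2 f =ᵐ[volume] g :=
  ae_eq_of_integral_schwartz_smul_eq ((memLp_fourierL2 f).locallyIntegrable one_le_two) hg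
    fun φ => (integral_smul_fourierL2 h2 φ).trans (h φ).symm

lemma fourierL2_eq_fourier {f : R3 → G} (h1 : Integrable f) (h2 : MemLp f 2) :
    fourierL2 f =ᵐ[volume] 𝓕 f := by
  apply fourierL2_ae_eq h2 (continuous_fourier h1).locallyIntegrable
  intro φ
  exact (integral_fourier_smul_eq φ.integrable h1).symm

/-- An integrable `u` with square integrable inverse Fourier transform is the Plancherel transform of
`𝓕⁻ u`. -/
lemma fourierL2_fourierInv {u : R3 → G} (hu : Integrable u) (h2 : MemLp (𝓕⁻ u) 2) :
    fourierL2 (𝓕⁻ u) =ᵐ[volume] u := by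
  apply fourierL2_ae_eq h2 hu.locallyIntegrable
  intro φ
  have h : 𝓕⁻ u = 𝓕 (fun x => u (-x)) := Real.fourierInv_eq_fourier_comp_neg u
  rw [h, ← integral_fourier_smul_eq (by exact (𝓕 φ).integrable) hu.comp_neg,
    ← integral_neg_eq_self]
  congr 1 with x
  congr 1
  have := φ.continuous.fourierInv_fourier_eq φ.integrable (𝓕 φ).integrable
  rw [← congrFun this (-x), Real.fourierInv_eq_fourier_neg, neg_neg]

lemma memLp_fourier {f : R3 → G} (h1 : Integrable f) (h2 : MemLp f 2) : MemLp (𝓕 f) 2 :=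
  (memLp_congr_ae (fourierL2_eq_fourier h1 h2)).1 (memLp_fourierL2 f)

lemma eLpNorm_fourierL2 {f : R3 → G} (h2 : MemLp f 2) :
    eLpNorm (fourierL2 f) 2 = eLpNorm f 2 := by
  have h := Lp.norm_fourier_eq (h2.toLp f)
  rw [Lp.norm_toLp, Lp.norm_def] at h
  have h3 := (ENNReal.toReal_eq_toReal_iff' (Lp.eLpNorm_ne_top _) h2.eLpNorm_ne_top).1 h
  rw [fourierL2_of_memLp h2, h3]

lemma eLpNorm_fourier {f : R3 → G} (h1 : Integrable f) (h2 : MemLp f 2) :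
    eLpNorm (𝓕 f) 2 = eLpNorm f 2 := by
  rw [← eLpNorm_fourierL2 h2, eLpNorm_congr_ae (fourierL2_eq_fourier h1 h2)]

lemma memLp_fourierInv {f : R3 → G} (h1 : Integrable f) (h2 : MemLp f 2) : MemLp (𝓕⁻ f) 2 := by
  rw [Real.fourierInv_eq_fourier_comp_neg]
  exact memLp_fourier h1.comp_neg
    (h2.comp_measurePreserving (Measure.measurePreserving_neg volume))

/-- Fourier inversion for a function in `L²` whose Plancherel transform is integrable. -/
lemma fourierInv_fourierL2 {f : R3 → G} (h2 : MemLp f 2) (h1 : Integrable (fourierL2 f)) :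
    𝓕⁻ (fourierL2 f) =ᵐ[volume] f := by
  have hm := memLp_fourierInv h1 (memLp_fourierL2 f)
  have h := fourierL2_fourierInv h1 hm
  rw [fourierL2_of_memLp hm] at h
  have h4 := (Lp.fourierTransformₗᵢ R3 G).injective
    (Lp.ext (h.trans (fourierL2_of_memLp h2).eventuallyEq))
  exact (MemLp.toLp_eq_toLp_iff hm h2).1 h4

end Plancherel

/-! ### Sobolev functions on the Fourier side -/

/-- The weight `⟨k⟩` at the physical frequency `k = 2πξ`. -/
noncomputable def wt (ξ : R3) : ℝ := bracket ((2 * Real.pi) • ξ)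

lemma one_le_bracket {G : Type*} [NormedAddCommGroup G] (y : G) : 1 ≤ bracket y := by
  unfold bracket
  rw [Real.one_le_sqrt]
  nlinarith [sq_nonneg ‖y‖]

lemma bracket_pos {G : Type*} [NormedAddCommGroup G] (y : G) : 0 < bracket y :=
  one_pos.trans_le (one_le_bracket y)

lemma bracket_sq {G : Type*} [NormedAddCommGroup G] (y : G) : bracket y ^ 2 = 1 + ‖y‖ ^ 2 :=
  Real.sq_sqrt (by positivity)

lemma norm_lt_bracket {G : Type*} [NormedAddCommGroup G] (y : G) : ‖y‖ < bracket y := by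
  nlinarith [bracket_sq y, bracket_pos y, norm_nonneg y]

lemma continuous_bracket {G : Type*} [NormedAddCommGroup G] :
    Continuous (bracket : G → ℝ) := by
  unfold bracket; fun_prop

lemma one_le_wt (ξ : R3) : 1 ≤ wt ξ := one_le_bracket _

lemma wt_pos (ξ : R3) : 0 < wt ξ := bracket_pos _

lemma continuous_wt : Continuous wt := by
  unfold wt; exact continuous_bracket.comp (continuous_const_smul _)

lemma norm_smul_le_wt (ξ : R3) : ‖(2 * Real.pi) • ξ‖ ≤ wt ξ := (norm_lt_bracket _).le

lemma norm_le_norm_two_pi_smul (ξ : R3) : ‖ξ‖ ≤ ‖(2 * Real.pi) • ξ‖ := by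
  rw [norm_smul, Real.norm_of_nonneg (by positivity)]
  nlinarith [Real.pi_gt_three, norm_nonneg ξ]

lemma norm_le_wt (ξ : R3) : ‖ξ‖ ≤ wt ξ := (norm_le_norm_two_pi_smul ξ).trans (norm_smul_le_wt ξ)

lemma integrable_wt_inv_pow_four : Integrable fun ξ => (wt ξ ^ 4)⁻¹ := by
  have h := integrable_rpow_neg_one_add_norm_sq (E := R3) (μ := volume) (r := 4)
    (by simp; norm_num)
  refine h.mono' ?_ (Filter.Eventually.of_forall fun ξ => ?_)
  · exact (continuous_wt.pow 4).inv₀ (fun ξ => (pow_pos (wt_pos ξ) 4).ne')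
      |>.aestronglyMeasurable
  · have h1 : 1 + ‖ξ‖ ^ 2 ≤ wt ξ ^ 2 := by
      rw [wt, bracket_sq]
      have := norm_le_norm_two_pi_smul ξ
      gcongr
    have h2 : (0 : ℝ) < 1 + ‖ξ‖ ^ 2 := by positivity
    rw [Real.norm_of_nonneg (by have := wt_pos ξ; positivity)]
    have : (1 + ‖ξ‖ ^ 2) ^ (-4 / 2 : ℝ) = ((1 + ‖ξ‖ ^ 2) ^ 2)⁻¹ := by
      rw [show (-4 / 2 : ℝ) = -(2 : ℕ) by norm_num, Real.rpow_neg h2.le, Real.rpow_natCast]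
    rw [this, show wt ξ ^ 4 = (wt ξ ^ 2) ^ 2 by ring]
    gcongr

lemma memLp_wt_inv_sq : MemLp (fun ξ => (((wt ξ ^ 2)⁻¹ : ℝ) : ℂ)) 2 := by
  have hc : Continuous fun ξ => (((wt ξ ^ 2)⁻¹ : ℝ) : ℂ) :=
    Complex.continuous_ofReal.comp
      ((continuous_wt.pow 2).inv₀ (fun ξ => (pow_pos (wt_pos ξ) 2).ne'))
  rw [memLp_two_iff_integrable_sq_norm hc.aestronglyMeasurable]
  refine integrable_wt_inv_pow_four.congr (Filter.Eventually.of_forall fun ξ => ?_)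
  have := wt_pos ξ
  simp only [Complex.norm_real, Real.norm_eq_abs, sq_abs]
  rw [← inv_pow, ← inv_pow]; ring

section

variable {G : Type*} [NormedAddCommGroup G] [InnerProductSpace ℂ G] [CompleteSpace G]

lemma memLp_of_sobolevNorm_lt_top {s : ℕ} {f : R3 → G} (h : sobolevNorm s f < ⊤) :
    MemLp f 2 := by
  by_contra hf
  simp [sobolevNorm, hf] at h

lemma sobolevNorm_eq {s : ℕ} {f : R3 → G} (h : MemLp f 2) :
    sobolevNorm s f = eLpNorm (fun ξ => ((wt ξ ^ s : ℝ) : ℂ) • fourierL2 f ξ) 2 volume := by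
  simp [sobolevNorm, h, wt]

lemma aestronglyMeasurable_wt_pow_smul (n : ℕ) {u : R3 → G} (hu : AEStronglyMeasurable u) :
    AEStronglyMeasurable fun ξ => ((wt ξ ^ n : ℝ) : ℂ) • u ξ :=
  (Complex.continuous_ofReal.comp (continuous_wt.pow n)).aestronglyMeasurable.smul hu

/-- Two powers of the weight turn `L²` into `L¹` in three dimensions, by Cauchy-Schwarz. -/
lemma eLpNorm_one_le_sobolevNorm (N : ℕ) {f : R3 → G} (h : MemLp f 2) :
    eLpNorm (fun ξ => ((wt ξ ^ N : ℝ) : ℂ) • fourierL2 f ξ) 1 volume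
      ≤ eLpNorm (fun ξ => (((wt ξ ^ 2)⁻¹ : ℝ) : ℂ)) 2 volume * sobolevNorm (N + 2) f := by
  rw [sobolevNorm_eq h]
  have := eLpNorm_smul_le_mul_eLpNorm (p := 2) (q := 2) (r := 1)
    (aestronglyMeasurable_wt_pow_smul (N + 2) (memLp_fourierL2 f).aestronglyMeasurable)
    memLp_wt_inv_sq.aestronglyMeasurable
  refine le_trans (le_of_eq ?_) this
  congr 1
  ext1 ξ
  have := (wt_pos ξ).ne'
  simp only [Pi.smul_apply', smul_smul, ← Complex.ofReal_mul]
  congr 2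
  field_simp
  ring

lemma integrable_wt_pow_fourierL2 {s m : ℕ} (hm : m + 2 ≤ s) {f : R3 → G}
    (h : sobolevNorm s f < ⊤) : Integrable fun ξ => wt ξ ^ m * ‖fourierL2 f ξ‖ := by
  obtain ⟨N, rfl⟩ : ∃ N, s = N + 2 := ⟨s - 2, by omega⟩
  have h2 := memLp_of_sobolevNorm_lt_top h
  have h1 : MemLp (fun ξ => ((wt ξ ^ N : ℝ) : ℂ) • fourierL2 f ξ) 1 volume :=
    ⟨aestronglyMeasurable_wt_pow_smul _ (memLp_fourierL2 f).aestronglyMeasurable,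
      (eLpNorm_one_le_sobolevNorm N h2).trans_lt
        (ENNReal.mul_lt_top memLp_wt_inv_sq.eLpNorm_lt_top h)⟩
  refine (memLp_one_iff_integrable.1 h1).norm.mono'
    ((continuous_wt.pow m).aestronglyMeasurable.mul
      (memLp_fourierL2 f).aestronglyMeasurable.norm) (Filter.Eventually.of_forall fun ξ => ?_)
  have := wt_pos ξ
  rw [norm_smul, Complex.norm_real, Real.norm_of_nonneg (by positivity),
    Real.norm_of_nonneg (by positivity)]
  gcongr
  · exact one_le_wt ξ
  · omega

lemma memLp_wt_pow_fourierL2 {s m : ℕ} (hm : m ≤ s) {f : R3 → G}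
    (h : sobolevNorm s f < ⊤) : MemLp (fun ξ => wt ξ ^ m * ‖fourierL2 f ξ‖) 2 := by
  have h2 := memLp_of_sobolevNorm_lt_top h
  rw [sobolevNorm_eq h2] at h
  have h1 : MemLp (fun ξ => ((wt ξ ^ s : ℝ) : ℂ) • fourierL2 f ξ) 2 volume :=
    ⟨aestronglyMeasurable_wt_pow_smul _ (memLp_fourierL2 f).aestronglyMeasurable, h⟩
  refine h1.mono ((continuous_wt.pow m).aestronglyMeasurable.mul
      (memLp_fourierL2 f).aestronglyMeasurable.norm) (Filter.Eventually.of_forall fun ξ => ?_)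
  have := wt_pos ξ
  rw [norm_smul, Complex.norm_real, Real.norm_of_nonneg (by positivity),
    Real.norm_of_nonneg (by positivity)]
  gcongr
  exact one_le_wt ξ

/-- Differentiation under the inverse Fourier integral: the derivative in the direction `d` has the
symbol `ik·d`. -/
lemma hasFDerivAt_fourierInv {u : R3 → G} (h0 : Integrable u)
    (h1 : Integrable fun ξ => ‖ξ‖ * ‖u ξ‖) (x : R3) :
    ∃ L : R3 →L[ℝ] G, HasFDerivAt (𝓕⁻ u) L x ∧
      ∀ d, L d = 𝓕⁻ (fun ξ => (Complex.I * ((inner ℝ ((2 * Real.pi) • ξ) d : ℝ) : ℂ)) • u ξ) x := by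
  have h1' : Integrable fun ξ : R3 => ‖ξ‖ * ‖u (-ξ)‖ := by
    have := h1.comp_neg
    simpa using this
  have key := Real.hasFDerivAt_fourier h0.comp_neg h1' x
  rw [← Real.fourierInv_eq_fourier_comp_neg] at key
  refine ⟨_, key, fun d => ?_⟩
  rw [Real.fourier_continuousLinearMap_apply, Real.fourierInv_eq_fourier_comp_neg]
  · refine congrFun (congrArg 𝓕 (funext fun ξ => ?_)) x
    simp only [VectorFourier.fourierSMulRight_apply, smul_neg, inner_neg_left, inner_smul_left]
    rw [← Complex.coe_smul, smul_smul]
    congr 1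
    have e : (innerSL ℝ) ξ d = inner ℝ ξ d := rfl
    simp only [e, Complex.ofReal_neg, Complex.ofReal_mul, Complex.ofReal_ofNat,
      conj_trivial]
    ring
  · refine (h1'.const_mul (2 * Real.pi * ‖innerSL ℝ (E := R3)‖)).mono'
      h0.comp_neg.aestronglyMeasurable.fourierSMulRight
      (Filter.Eventually.of_forall fun ξ => ?_)
    refine (VectorFourier.norm_fourierSMulRight_le _ _ _).trans (le_of_eq (by ring))

end

/-- The symbol `i k` of the gradient, at the physical frequency `k = 2πξ`. -/
noncomputable def kC (ξ : R3) : C3 :=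
  WithLp.toLp 2 fun j => Complex.I * ((((2 * Real.pi) • ξ) j : ℝ) : ℂ)

lemma norm_kC (ξ : R3) : ‖kC ξ‖ = ‖(2 * Real.pi) • ξ‖ := by
  simp only [EuclideanSpace.norm_eq, kC, norm_mul, Complex.norm_I, one_mul, Complex.norm_real]

lemma norm_kC_le (ξ : R3) : ‖kC ξ‖ ≤ wt ξ := by
  rw [norm_kC]; exact norm_smul_le_wt ξ

lemma continuous_kC : Continuous kC := by
  unfold kC
  refine (PiLp.continuous_toLp 2 _).comp ?_
  fun_prop

lemma fourierInv_apply_coord {u : R3 → C3} (hu : Integrable u) (x : R3) (j : Fin 3) :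
    (𝓕⁻ u x) j = 𝓕⁻ (fun ξ => u ξ j) x := by
  rw [Real.fourierInv_eq, Real.fourierInv_eq]
  have hi : Integrable fun ξ : R3 => Real.fourierChar (inner ℝ ξ x) • u ξ := by
    have := (Real.fourierIntegral_convergent_iff (f := u) (-x)).2 hu
    simpa using this
  have := (EuclideanSpace.proj (𝕜 := ℂ) j : C3 →L[ℂ] ℂ).integral_comp_comm hi
  exact this.symm

/-- The classical gradient of a continuous Sobolev function is given by a convergent Fourier
integral. -/
lemma grad_eq_fourierInv {f : R3 → ℂ} {s : ℕ} (hs : 3 ≤ s) (hf : Continuous f)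
    (h : sobolevNorm s f < ⊤) :
    grad f = 𝓕⁻ (fun ξ => fourierL2 f ξ • kC ξ) := by
  have hm : AEStronglyMeasurable (fourierL2 f) volume := (memLp_fourierL2 f).aestronglyMeasurable
  have h0 : Integrable (fourierL2 f) := by
    have := integrable_wt_pow_fourierL2 (m := 0) (by omega) h
    rw [← integrable_norm_iff hm]
    simpa using this
  have hw : Integrable fun ξ => wt ξ * ‖fourierL2 f ξ‖ := by
    simpa using integrable_wt_pow_fourierL2 (m := 1) (by omega) h
  have h1 : Integrable fun ξ => ‖ξ‖ * ‖fourierL2 f ξ‖ := by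
    refine hw.mono' (continuous_norm.aestronglyMeasurable.mul hm.norm)
      (Filter.Eventually.of_forall fun ξ => ?_)
    rw [Real.norm_of_nonneg (by positivity)]
    gcongr
    exact norm_le_wt ξ
  have h3 : Integrable (fun ξ => fourierL2 f ξ • kC ξ) := by
    refine hw.mono' (hm.smul continuous_kC.aestronglyMeasurable)
      (Filter.Eventually.of_forall fun ξ => ?_)
    rw [norm_smul, mul_comm]
    gcongr
    exact norm_kC_le ξ
  have e : 𝓕⁻ (fourierL2 f) = f := (Continuous.ae_eq_iff_eq volume (continuous_fourierInv h0) hf).1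
    (fourierInv_fourierL2 (memLp_of_sobolevNorm_lt_top h) h0)
  ext x j
  obtain ⟨L, hL, hLd⟩ := hasFDerivAt_fourierInv h0 h1 x
  rw [fourierInv_apply_coord h3]
  simp only [grad]
  rw [e] at hL
  rw [hL.fderiv, hLd]
  refine congrFun (congrArg 𝓕⁻ (funext fun ξ => ?_)) x
  simp [kC, EuclideanSpace.inner_single_right, mul_comm]

lemma integrable_fourierL2_smul_kC {f : R3 → ℂ} {s : ℕ} (hs : 3 ≤ s)
    (h : sobolevNorm s f < ⊤) : Integrable (fun ξ => fourierL2 f ξ • kC ξ) := by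
  have hm : AEStronglyMeasurable (fourierL2 f) volume := (memLp_fourierL2 f).aestronglyMeasurable
  have hw : Integrable fun ξ => wt ξ * ‖fourierL2 f ξ‖ := by
    simpa using integrable_wt_pow_fourierL2 (m := 1) (by omega) h
  refine hw.mono' (hm.smul continuous_kC.aestronglyMeasurable)
      (Filter.Eventually.of_forall fun ξ => ?_)
  rw [norm_smul, mul_comm]
  gcongr
  exact norm_kC_le ξ

lemma fourierL2_grad {f : R3 → ℂ} {s : ℕ} (hs : 3 ≤ s) (hf : Continuous f)
    (h : sobolevNorm s f < ⊤) :
    fourierL2 (grad f) =ᵐ[volume] fun ξ => fourierL2 f ξ • kC ξ := by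
  have hi := integrable_fourierL2_smul_kC hs h
  have h2 : MemLp (fun ξ => fourierL2 f ξ • kC ξ) 2 := by
    have := memLp_wt_pow_fourierL2 (m := 1) (by omega) h
    refine this.mono hi.aestronglyMeasurable (Filter.Eventually.of_forall fun ξ => ?_)
    have := wt_pos ξ
    rw [norm_smul, mul_comm, Real.norm_of_nonneg (by positivity), pow_one]
    gcongr
    exact norm_kC_le ξ
  rw [grad_eq_fourierInv hs hf h]
  exact fourierL2_fourierInv hi (memLp_fourierInv hi h2)

/-! ### Symbol classes -/

section Symbols

variable {P Q : Type*} {F : Type*} [NormedAddCommGroup F] [NormedSpace ℝ F] {n : ℕ} {r s : ℤ}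

/-- A family `m p` of symbols of order `r`, with bounds on its derivatives up to order `n` that are
uniform in the parameter `p`: `|D^j m| ≤ C ⟨k⟩^{r-j}`, `k = 2πξ`. -/
def IsSym (n : ℕ) (r : ℤ) (m : P → R3 → F) : Prop :=
  (∀ p, ContDiff ℝ n (m p)) ∧
    ∃ C : ℝ, ∀ p ξ, ∀ j ≤ n, ‖iteratedFDeriv ℝ j (m p) ξ‖ ≤ C * wt ξ ^ (r - j)

lemma IsSym.exists_bound {m : P → R3 → F} (h : IsSym n r m) :
    ∃ C : ℝ, ∀ p ξ, ‖m p ξ‖ ≤ C * wt ξ ^ r := by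
  obtain ⟨-, C, hC⟩ := h
  exact ⟨C, fun p ξ => by simpa using hC p ξ 0 n.zero_le⟩

/-- The constant in the definition of a symbol class may be taken nonnegative. -/
lemma IsSym.exists_nonneg {m : P → R3 → F} (h : IsSym n r m) :
    ∃ C : ℝ, 0 ≤ C ∧ ∀ p ξ, ∀ j ≤ n, ‖iteratedFDeriv ℝ j (m p) ξ‖ ≤ C * wt ξ ^ (r - j) := by
  obtain ⟨-, C, hC⟩ := h
  refine ⟨max C 0, le_max_right _ _, fun p ξ j hj => (hC p ξ j hj).trans ?_⟩
  have := wt_pos ξ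
  gcongr
  exact le_max_left _ _

lemma IsSym.comp {m : P → R3 → F} (h : IsSym n r m) (f : Q → P) : IsSym n r fun q => m (f q) :=
  ⟨fun _ => h.1 _, h.2.imp fun _ hC _ => hC _⟩

lemma IsSym.mono_order {m : P → R3 → F} (h : IsSym n r m) (hrs : r ≤ s) : IsSym n s m := by
  obtain ⟨C, hC0, hC⟩ := h.exists_nonneg
  refine ⟨h.1, C, fun p ξ j hj => (hC p ξ j hj).trans ?_⟩
  have := one_le_wt ξ
  gcongr

lemma isSym_of_bound {m : P → R3 → F} (hc : ∀ p, Continuous (m p)) {C : ℝ}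
    (h : ∀ p ξ, ‖m p ξ‖ ≤ C * wt ξ ^ r) : IsSym 0 r m := by
  refine ⟨fun p => contDiff_zero.2 (hc p), C, fun p ξ j hj => ?_⟩
  obtain rfl : j = 0 := by omega
  simpa using h p ξ

/-- A bounded function is a symbol if its differential is a symbol of one order less; this is how
symbol classes are entered by induction on the number of derivatives. -/
lemma isSym_succ {m : P → R3 → F} (hd : ∀ p, Differentiable ℝ (m p)) {C : ℝ}
    (h : ∀ p ξ, ‖m p ξ‖ ≤ C * wt ξ ^ r) (h' : IsSym n (r - 1) fun p => fderiv ℝ (m p)) :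
    IsSym (n + 1) r m := by
  obtain ⟨C', -, hC'⟩ := h'.exists_nonneg
  refine ⟨fun p => ?_, max C C', fun p ξ j hj => ?_⟩
  · have := contDiff_succ_iff_fderiv (𝕜 := ℝ) (n := (n : ℕ∞ω)) (f := m p)
    push_cast
    exact this.2 ⟨hd p, by simp, h'.1 p⟩
  · have := wt_pos ξ
    cases j with
    | zero =>
      rw [norm_iteratedFDeriv_zero]
      refine (h p ξ).trans ?_
      simp only [Nat.cast_zero, sub_zero]
      gcongr
      exact le_max_left _ _
    | succ j =>
      rw [← norm_iteratedFDeriv_fderiv]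
      refine (hC' p ξ j (by omega)).trans ?_
      rw [show r - 1 - (j : ℤ) = r - ((j + 1 : ℕ) : ℤ) by push_cast; ring]
      gcongr
      exact le_max_right _ _

lemma IsSym.differential {m : P → R3 → F} (h : IsSym (n + 1) r m) :
    IsSym n (r - 1) fun p => fderiv ℝ (m p) := by
  obtain ⟨h1, C, hC⟩ := h
  refine ⟨fun p => (h1 p).fderiv_right (by norm_cast), C, fun p ξ j hj => ?_⟩
  rw [norm_iteratedFDeriv_fderiv]
  refine (hC p ξ (j + 1) (by omega)).trans (le_of_eq ?_)
  rw [show r - 1 - (j : ℤ) = r - ((j + 1 : ℕ) : ℤ) by push_cast; ring]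

lemma IsSym.of_succ {m : P → R3 → F} (h : IsSym (n + 1) r m) : IsSym n r m :=
  ⟨fun p => (h.1 p).of_le (by norm_cast; omega), h.2.imp fun _ hC p ξ j hj => hC p ξ j (by omega)⟩

lemma IsSym.add {f g : P → R3 → F} (hf : IsSym n r f) (hg : IsSym n r g) :
    IsSym n r fun p ξ => f p ξ + g p ξ := by
  obtain ⟨C, hC0, hC⟩ := hf.exists_nonneg
  obtain ⟨D, hD0, hD⟩ := hg.exists_nonneg
  refine ⟨fun p => (hf.1 p).add (hg.1 p), C + D, fun p ξ j hj => ?_⟩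
  have e : iteratedFDeriv ℝ j (fun ξ => f p ξ + g p ξ) ξ
      = iteratedFDeriv ℝ j (f p) ξ + iteratedFDeriv ℝ j (g p) ξ :=
    iteratedFDeriv_add_apply ((hf.1 p).contDiffAt.of_le (by exact_mod_cast hj))
      ((hg.1 p).contDiffAt.of_le (by exact_mod_cast hj))
  rw [e, add_mul]
  exact (norm_add_le _ _).trans (add_le_add (hC p ξ j hj) (hD p ξ j hj))

lemma IsSym.smul [NormedSpace ℂ F] [IsScalarTower ℝ ℂ F] {f : P → R3 → ℂ} {g : P → R3 → F}
    (hf : IsSym n r f) (hg : IsSym n s g) : IsSym n (r + s) fun p ξ => f p ξ • g p ξ := by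
  obtain ⟨C, hC0, hC⟩ := hf.exists_nonneg
  obtain ⟨D, hD0, hD⟩ := hg.exists_nonneg
  refine ⟨fun p => (hf.1 p).smul (hg.1 p), 2 ^ n * (C * D), fun p ξ j hj => ?_⟩
  have hw := wt_pos ξ
  refine (norm_iteratedFDeriv_smul_le (hf.1 p) (hg.1 p) ξ (by exact_mod_cast hj)).trans ?_
  calc ∑ i ∈ Finset.range (j + 1), (j.choose i : ℝ) * ‖iteratedFDeriv ℝ i (f p) ξ‖ *
          ‖iteratedFDeriv ℝ (j - i) (g p) ξ‖
      ≤ ∑ i ∈ Finset.range (j + 1), (j.choose i : ℝ) * (C * D * wt ξ ^ (r + s - j)) := by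
        refine Finset.sum_le_sum fun i hi => ?_
        have hi' : i ≤ j := by simpa [Nat.lt_succ_iff] using hi
        have e : wt ξ ^ (r + s - j) = wt ξ ^ (r - i) * wt ξ ^ (s - ((j - i : ℕ) : ℤ)) := by
          rw [← zpow_add₀ hw.ne']
          congr 1
          push_cast [hi']
          ring
        rw [mul_assoc, e]
        refine mul_le_mul_of_nonneg_left ?_ (Nat.cast_nonneg _)
        calc _ ≤ (C * wt ξ ^ (r - i)) * (D * wt ξ ^ (s - ((j - i : ℕ) : ℤ))) :=
              mul_le_mul (hC p ξ i (by omega)) (hD p ξ (j - i) (by omega)) (norm_nonneg _)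
                (by positivity)
          _ = _ := by ring
    _ = 2 ^ j * (C * D * wt ξ ^ (r + s - j)) := by
        rw [← Finset.sum_mul]
        congr 1
        exact_mod_cast Nat.sum_range_choose j
    _ ≤ 2 ^ n * (C * D) * wt ξ ^ (r + s - j) := by
        rw [← mul_assoc]
        gcongr
        norm_num

lemma IsSym.mul {f g : P → R3 → ℂ} (hf : IsSym n r f) (hg : IsSym n s g) :
    IsSym n (r + s) fun p ξ => f p ξ * g p ξ :=
  hf.smul hg

lemma isSym_const {c : P → F} {C : ℝ} (h : ∀ p, ‖c p‖ ≤ C) : IsSym n 0 fun p (_ : R3) => c p := by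
  refine ⟨fun p => contDiff_const, max C 0, fun p ξ j hj => ?_⟩
  have := wt_pos ξ
  rcases j.eq_zero_or_pos with rfl | hj
  · simpa using Or.inl (h p)
  · rw [iteratedFDeriv_const_of_ne hj.ne']
    simp only [Pi.zero_apply, norm_zero]
    positivity

lemma isSym_clm {L : P → R3 →L[ℝ] F} {C : ℝ} (h : ∀ p, ‖L p‖ ≤ C) :
    IsSym n 1 fun p ξ => L p ξ := by
  have hb : ∀ p ξ, ‖L p ξ‖ ≤ max C 0 * wt ξ ^ (1 : ℤ) := fun p ξ => by
    have := norm_le_wt ξ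
    rw [zpow_one]
    exact ((L p).le_opNorm ξ).trans
      (mul_le_mul ((h p).trans (le_max_left _ _)) this (norm_nonneg _) (le_max_right _ _))
  cases n with
  | zero => exact isSym_of_bound (fun p => (L p).continuous) hb
  | succ n =>
    refine isSym_succ (fun p => (L p).differentiable) hb ?_
    have e : (fun p => fderiv ℝ fun ξ => L p ξ) = fun p (_ : R3) => L p := by
      ext1 p; ext1 ξ; exact (L p).fderiv
    rw [e, sub_self]
    exact isSym_const h

/-- The inverse of an elliptic symbol of order `r` is a symbol of order `-r`: by induction on the
number of derivatives, from `D(q⁻¹) = -q⁻² Dq`. -/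
lemma IsSym.inv {q : P → R3 → ℂ} (hq : IsSym n r q) {c : ℝ} (hc : 0 < c)
    (h : ∀ p ξ, c * wt ξ ^ r ≤ ‖q p ξ‖) : IsSym n (-r) fun p ξ => (q p ξ)⁻¹ := by
  have h0 : ∀ p ξ, q p ξ ≠ 0 := fun p ξ => by
    have : 0 < c * wt ξ ^ r := by have := wt_pos ξ; positivity
    exact norm_pos_iff.1 (this.trans_le (h p ξ))
  have hb : ∀ p ξ, ‖(q p ξ)⁻¹‖ ≤ c⁻¹ * wt ξ ^ (-r) := fun p ξ => by
    have := wt_pos ξ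
    rw [norm_inv, zpow_neg, ← mul_inv]
    gcongr
    exact h p ξ
  induction n with
  | zero => exact isSym_of_bound (fun p => (hq.1 p).continuous.inv₀ (h0 p)) hb
  | succ n ih =>
    have hd : ∀ p, Differentiable ℝ (q p) := fun p =>
      (hq.1 p).differentiable (by simp)
    have hf : ∀ p ξ, HasFDerivAt (fun ξ => (q p ξ)⁻¹)
        ((-1 : ℂ) • (q p ξ)⁻¹ • (q p ξ)⁻¹ • fderiv ℝ (q p) ξ) ξ := fun p ξ => by
      have h1 := (hasDerivAt_inv (h0 p ξ)).comp_hasFDerivAt_of_eq ξ (hd p ξ).hasFDerivAt rfl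
      refine h1.congr_fderiv ?_
      rw [smul_smul, smul_smul]
      congr 1
      have := h0 p ξ
      field_simp
    refine isSym_succ (fun p ξ => (hf p ξ).differentiableAt) hb ?_
    have e : (fun p => fderiv ℝ fun ξ => (q p ξ)⁻¹)
        = fun p ξ => (-1 : ℂ) • (q p ξ)⁻¹ • (q p ξ)⁻¹ • fderiv ℝ (q p) ξ := by
      ext1 p; ext1 ξ; exact (hf p ξ).fderiv
    rw [e]
    have hi := ih hq.of_succ
    have := (isSym_const (P := P) (n := n) (c := fun _ => (-1 : ℂ)) (C := 1) (by simp)).smul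
      (hi.smul (hi.smul hq.differential))
    convert this using 1
    ring

lemma hasFDerivAt_wt (ξ : R3) :
    HasFDerivAt (fun ξ => (wt ξ : ℂ))
      (((wt ξ : ℂ))⁻¹ • ((2 * Real.pi) ^ 2 • Complex.ofRealCLM ∘L innerSL ℝ ξ)) ξ := by
  have h1 : HasFDerivAt (fun ξ : R3 => 1 + ‖(2 * Real.pi) • ξ‖ ^ 2)
      ((2 * (2 * Real.pi) ^ 2) • innerSL ℝ ξ) ξ := by
    have : (fun ξ : R3 => 1 + ‖(2 * Real.pi) • ξ‖ ^ 2)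
        = fun ξ => 1 + (2 * Real.pi) ^ 2 * ‖ξ‖ ^ 2 := by
      ext ξ; rw [norm_smul, mul_pow, Real.norm_eq_abs, sq_abs]
    rw [this]
    have := ((hasStrictFDerivAt_norm_sq ξ).hasFDerivAt.const_mul ((2 * Real.pi) ^ 2)).const_add 1
    refine this.congr_fderiv ?_
    ext d
    simp
    ring
  have h2 := h1.sqrt (by positivity)
  have h3 := Complex.ofRealCLM.hasFDerivAt.comp ξ h2
  refine h3.congr_fderiv ?_
  ext d
  have : (wt ξ : ℂ) ≠ 0 := Complex.ofReal_ne_zero.2 (wt_pos ξ).ne'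
  have e : √(1 + ‖(2 * Real.pi) • ξ‖ ^ 2) = wt ξ := rfl
  rw [e]
  simp
  field_simp

lemma isSym_wt : IsSym n 1 fun (_ : P) ξ => (wt ξ : ℂ) := by
  have hb : ∀ (_ : P) ξ, ‖(wt ξ : ℂ)‖ ≤ 1 * wt ξ ^ (1 : ℤ) := fun p ξ => by
    have := wt_pos ξ
    simp [abs_of_pos this]
  induction n with
  | zero => exact isSym_of_bound (fun p => Complex.continuous_ofReal.comp continuous_wt) hb
  | succ n ih =>
    refine isSym_succ (fun p ξ => (hasFDerivAt_wt ξ).differentiableAt) hb ?_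
    have e : (fun (_ : P) => fderiv ℝ fun ξ => (wt ξ : ℂ)) = fun _ ξ =>
        ((wt ξ : ℂ))⁻¹ • ((2 * Real.pi) ^ 2 • Complex.ofRealCLM ∘L innerSL ℝ ξ) := by
      ext1 p; ext1 ξ; exact (hasFDerivAt_wt ξ).fderiv
    rw [e]
    have h1 : IsSym n (-1) fun (_ : P) ξ => ((wt ξ : ℂ))⁻¹ :=
      ih.inv one_pos fun p ξ => by have := wt_pos ξ; simp [abs_of_pos this]
    let A : R3 →L[ℝ] R3 →L[ℝ] ℂ :=
      (2 * Real.pi) ^ 2 • (ContinuousLinearMap.compL ℝ R3 ℝ ℂ Complex.ofRealCLM) ∘L innerSL ℝ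
    have h2 : IsSym n 1 fun (_ : P) ξ => A ξ := isSym_clm (L := fun _ => A) (C := ‖A‖) (by simp)
    exact h1.smul h2

end Symbols

/-! ### Truncation of symbols -/

section Truncation

variable {P : Type*} {n : ℕ} {r : ℤ}

lemma IsSym.const_mul {m : P → R3 → ℂ} (h : IsSym n r m) {c : P → ℂ} {C : ℝ}
    (hc : ∀ p, ‖c p‖ ≤ C) : IsSym n r fun p ξ => c p * m p ξ := by
  simpa using (isSym_const (n := n) hc).mul h

lemma isSym_wt_inv : IsSym n (-1) fun (_ : P) ξ => (wt ξ : ℂ)⁻¹ :=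
  isSym_wt.inv one_pos fun p ξ => by have := wt_pos ξ; simp [abs_of_pos this]

/-- The truncation `(1 + η⟨k⟩²)⁻¹`, which tends to `1` as `η → 0`. -/
noncomputable def cutoff (η : ℝ) (ξ : R3) : ℂ := (1 + η * (wt ξ : ℂ) ^ 2)⁻¹

lemma cutoff_eq_ofReal (η : ℝ) (ξ : R3) : cutoff η ξ = ((1 + η * wt ξ ^ 2)⁻¹ : ℝ) := by
  simp [cutoff]

lemma norm_cutoff_le_one {η : ℝ} (hη : 0 < η) (ξ : R3) : ‖cutoff η ξ‖ ≤ 1 := by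
  have := wt_pos ξ
  rw [cutoff_eq_ofReal, Complex.norm_real, Real.norm_of_nonneg (by positivity)]
  exact inv_le_one_of_one_le₀ (by nlinarith [mul_pos hη (pow_pos this 2)])

lemma one_add_mul_wt_sq_ne_zero {η : ℝ} (hη : 0 < η) (ξ : R3) :
    (1 + η * (wt ξ : ℂ) ^ 2) ≠ 0 := by
  have := wt_pos ξ
  have h : (1 + η * wt ξ ^ 2 : ℝ) ≠ 0 := by positivity
  exact_mod_cast h

lemma isSym_cutoff_of_pos {η : ℝ} (hη : 0 < η) : IsSym n (-2) fun (_ : P) ξ => cutoff η ξ := by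
  have h1 : IsSym n 2 fun (_ : P) (_ : R3) => (1 : ℂ) :=
    (isSym_const (C := 1) (by simp)).mono_order (by norm_num)
  have h2 : IsSym n 2 fun (_ : P) (ξ : R3) => (η : ℂ) * ((wt ξ : ℂ) * (wt ξ : ℂ)) :=
    (isSym_wt.mul isSym_wt).const_mul (c := fun _ => (η : ℂ)) (C := ‖(η : ℂ)‖) (by simp)
  have h3 := (h1.add h2).inv hη fun p ξ => by
    have := wt_pos ξ
    have e : (1 : ℂ) + (η : ℂ) * ((wt ξ : ℂ) * (wt ξ : ℂ)) = ((1 + η * wt ξ ^ 2 : ℝ) : ℂ) := by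
      push_cast; ring
    rw [e, Complex.norm_real, Real.norm_of_nonneg (by positivity)]
    have e2 : wt ξ ^ (2 : ℤ) = wt ξ ^ 2 := by norm_cast
    rw [e2]
    linarith
  simpa [cutoff, sq] using h3

/-- The truncations are symbols of order `0`, uniformly in `0 < η ≤ 1`: the derivative of
`χ = (1 + η⟨k⟩²)⁻¹` is `-2 χ (1 - χ) ⟨k⟩⁻¹ D⟨k⟩`, in which `η` no longer appears. -/
lemma isSym_cutoff : IsSym n 0 fun (η : Set.Ioc (0 : ℝ) 1) ξ => cutoff η ξ := by
  have hb : ∀ (η : Set.Ioc (0 : ℝ) 1) ξ, ‖cutoff η ξ‖ ≤ 1 * wt ξ ^ (0 : ℤ) := fun η ξ => by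
    simpa using norm_cutoff_le_one η.2.1 ξ
  have hc : ∀ (η : Set.Ioc (0 : ℝ) 1), ContDiff ℝ (1 : ℕ) (cutoff η) := fun η =>
    (isSym_cutoff_of_pos (P := Unit) η.2.1).1 ()
  have hd : ∀ (η : Set.Ioc (0 : ℝ) 1) ξ, HasFDerivAt (cutoff η) (((-2 : ℂ) * (cutoff η ξ *
      (1 + (-1) * cutoff η ξ))) • (wt ξ : ℂ)⁻¹ • fderiv ℝ (fun ξ => (wt ξ : ℂ)) ξ) ξ := by
    intro η ξ
    have h1 := (hasFDerivAt_wt ξ).differentiableAt.hasFDerivAt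
    have h2 : HasDerivAt (fun z : ℂ => (1 + (η : ℝ) * z ^ 2)⁻¹)
        (-((η : ℝ) * (2 * (wt ξ : ℂ))) / (1 + (η : ℝ) * (wt ξ : ℂ) ^ 2) ^ 2) (wt ξ : ℂ) := by
      have := (((hasDerivAt_pow 2 (wt ξ : ℂ)).const_mul ((η : ℝ) : ℂ)).const_add 1).fun_inv
        (one_add_mul_wt_sq_ne_zero η.2.1 ξ)
      simpa using this
    have h3 := h2.comp_hasFDerivAt_of_eq ξ h1 rfl
    refine h3.congr_fderiv ?_
    rw [smul_smul]
    congr 1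
    have e1 := one_add_mul_wt_sq_ne_zero η.2.1 ξ
    have e2 : (wt ξ : ℂ) ≠ 0 := Complex.ofReal_ne_zero.2 (wt_pos ξ).ne'
    simp only [cutoff]
    field_simp
    ring
  induction n with
  | zero => exact isSym_of_bound (fun η => (hc η).continuous) hb
  | succ n ih =>
    refine isSym_succ (fun η ξ => (hd η ξ).differentiableAt) hb ?_
    have e : (fun (η : Set.Ioc (0 : ℝ) 1) => fderiv ℝ fun ξ => cutoff η ξ)
        = fun (η : Set.Ioc (0 : ℝ) 1) ξ =>
        ((-2 : ℂ) * (cutoff η ξ * (1 + (-1) * cutoff η ξ))) • (wt ξ : ℂ)⁻¹ •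
          fderiv ℝ (fun ξ => (wt ξ : ℂ)) ξ := by
      ext1 η; ext1 ξ; exact (hd η ξ).fderiv
    rw [e]
    have h1 : IsSym n 0 fun (η : Set.Ioc (0 : ℝ) 1) ξ => 1 + (-1) * cutoff η ξ :=
      (isSym_const (c := fun _ => (1 : ℂ)) (C := 1) (by simp)).add
        (ih.const_mul (c := fun _ => (-1 : ℂ)) (C := 1) (by simp))
    have h2 := ((ih.mul h1).const_mul (c := fun _ => (-2 : ℂ)) (C := 2) (by simp)).smul
      (isSym_wt_inv.smul (isSym_wt (n := n + 1)).differential)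
    exact h2

end Truncation

/-! ### The symbols of the decomposition -/

section KleinGordonSymbols

variable {n : ℕ}

/-- Parameters `(±, v)` with `|v| ≤ R`. -/
abbrev SignVel (R : ℝ) : Type := ℤˣ × {v : R3 // ‖v‖ ≤ R}

lemma norm_sign (σ : ℤˣ) : ‖((σ : ℤ) : ℂ)‖ = 1 := by
  rcases Int.units_eq_one_or σ with rfl | rfl <;> simp

lemma norm_relVel_lt_one (v : R3) : ‖relVel v‖ < 1 := by
  rw [relVel, norm_smul, norm_inv, Real.norm_of_nonneg (bracket_pos v).le,
    inv_mul_lt_one₀ (bracket_pos v)]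
  exact norm_lt_bracket v

/-- Bounded momenta have velocities bounded away from the speed of light. -/
lemma norm_relVel_le {R : ℝ} {v : R3} (hv : ‖v‖ ≤ R) :
    ‖relVel v‖ ≤ 1 - (2 * (1 + R ^ 2))⁻¹ := by
  have h1 := bracket_sq v
  have h2 := bracket_pos v
  have h3 := norm_lt_bracket v
  have h0 := norm_nonneg v
  rw [relVel, norm_smul, norm_inv, Real.norm_of_nonneg h2.le, inv_mul_le_iff₀ h2]
  have h4 : bracket v * (2 * (1 + R ^ 2))⁻¹ ≤ bracket v - ‖v‖ := by
    have h5 : bracket v ^ 2 ≤ 1 + R ^ 2 := by rw [h1]; gcongr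
    rw [← div_eq_mul_inv, div_le_iff₀ (by positivity)]
    have h6 : (bracket v - ‖v‖) * (bracket v + ‖v‖) = 1 := by nlinarith
    have h7 : 0 < bracket v - ‖v‖ := by linarith
    nlinarith [mul_le_mul_of_nonneg_left h5 h7.le, mul_pos h7 h2]
  linarith

/-- The symbol `λ_±(k) + i k·v̂` at `k = 2πξ`, the rate of change of the phase of a plane wave seen by
a particle of momentum `v`. -/
noncomputable def phase (σ : ℤˣ) (v ξ : R3) : ℂ :=
  lam σ ((2 * Real.pi) • ξ) + Complex.I * ((inner ℝ ((2 * Real.pi) • ξ) (relVel v) : ℝ) : ℂ)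

lemma phase_eq (σ : ℤˣ) (v ξ : R3) :
    phase σ v ξ = Complex.I * (((σ : ℤ) * wt ξ
      + inner ℝ ((2 * Real.pi) • ξ) (relVel v) : ℝ) : ℂ) := by
  simp only [phase, lam, wt]
  push_cast
  ring

/-- There are no resonances: `λ_± + ik·v̂` is elliptic of order one. -/
lemma wt_sub_le_norm_phase (σ : ℤˣ) (v ξ : R3) :
    (1 - ‖relVel v‖) * wt ξ ≤ ‖phase σ v ξ‖ := by
  rw [phase_eq, norm_mul, Complex.norm_I, one_mul, Complex.norm_real, Real.norm_eq_abs]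
  have h1 : |inner ℝ ((2 * Real.pi) • ξ) (relVel v)| ≤ wt ξ * ‖relVel v‖ :=
    (abs_real_inner_le_norm _ _).trans (by gcongr; exact norm_smul_le_wt ξ)
  have h2 : |((σ : ℤ) : ℝ) * wt ξ| = wt ξ := by
    rw [abs_mul, abs_of_pos (wt_pos ξ)]
    rcases Int.units_eq_one_or σ with rfl | rfl <;> simp
  have h3 := abs_sub_abs_le_abs_sub (((σ : ℤ) : ℝ) * wt ξ)
    (-inner ℝ ((2 * Real.pi) • ξ) (relVel v))
  rw [abs_neg, sub_neg_eq_add, h2] at h3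
  linarith

lemma phase_ne_zero (σ : ℤˣ) (v ξ : R3) : phase σ v ξ ≠ 0 := by
  have h := wt_sub_le_norm_phase σ v ξ
  have h1 := mul_pos (sub_pos.2 (norm_relVel_lt_one v)) (wt_pos ξ)
  exact norm_pos_iff.1 (h1.trans_le h)

lemma phiHat_eq (σ : ℤˣ) (j : ℕ) (v ξ : R3) :
    phiHat σ j v ((2 * Real.pi) • ξ) = (phase σ v ξ ^ j)⁻¹ := rfl

lemma isSym_inner {Q : Type*} {f : Q → R3} {C : ℝ} (hf : ∀ q, ‖f q‖ ≤ C) :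
    IsSym n 1 fun q ξ => Complex.I * ((inner ℝ ((2 * Real.pi) • ξ) (f q) : ℝ) : ℂ) := by
  have h := isSym_clm (n := n) (L := fun q => Complex.ofRealCLM ∘L innerSL ℝ (f q)) (C := C)
    fun q => by
      refine (ContinuousLinearMap.opNorm_comp_le _ _).trans ?_
      simpa using hf q
  have h2 := h.const_mul (c := fun _ => Complex.I * (2 * Real.pi : ℝ))
    (C := ‖Complex.I * (2 * Real.pi : ℝ)‖) (by simp)
  refine cast (congrArg _ ?_) h2
  ext q ξ
  simp only [ContinuousLinearMap.comp_apply, innerSL_apply_apply, Complex.ofRealCLM_apply,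
    real_inner_smul_left]
  rw [real_inner_comm]
  push_cast
  ring

lemma isSym_phase (R : ℝ) : IsSym n 1 fun (p : SignVel R) ξ => phase p.1 p.2 ξ := by
  have h1 := (isSym_wt (P := SignVel R) (n := n)).const_mul
    (c := fun p => ((p.1 : ℤ) : ℂ) * Complex.I) (C := 1)
    fun p => by rw [norm_mul, norm_sign, Complex.norm_I, one_mul]
  exact h1.add (isSym_inner (f := fun p : SignVel R => relVel p.2) (C := 1)
    fun p => (norm_relVel_lt_one _).le)

lemma isSym_phase_inv (R : ℝ) : IsSym n (-1) fun (p : SignVel R) ξ => (phase p.1 p.2 ξ)⁻¹ := by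
  refine (isSym_phase R).inv (c := (2 * (1 + R ^ 2))⁻¹) (by positivity) fun p ξ => ?_
  refine le_trans ?_ (wt_sub_le_norm_phase p.1 p.2 ξ)
  rw [zpow_one]
  have := wt_pos ξ
  have := norm_relVel_le p.2.2
  gcongr
  linarith

lemma isSym_phiHat_one (R : ℝ) :
    IsSym n (-1) fun (p : SignVel R) ξ => phiHat p.1 1 p.2 ((2 * Real.pi) • ξ) := by
  simpa only [phiHat_eq, pow_one] using isSym_phase_inv R

lemma isSym_aSym {Q : Type*} (f : Q → ℤˣ) :
    IsSym n (-1) fun q ξ => aSym (f q) ((2 * Real.pi) • ξ) :=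
  isSym_wt_inv.const_mul (c := fun q => -((f q : ℤ) : ℂ) * (Complex.I / 2)) (C := 1 / 2)
    fun q => by rw [norm_mul, norm_neg, norm_sign]; simp

lemma isSym_aSym_mul_phiHat_one (R : ℝ) :
    IsSym n (-1) fun (p : SignVel R) ξ =>
      aSym p.1 ((2 * Real.pi) • ξ) * phiHat p.1 1 p.2 ((2 * Real.pi) • ξ) :=
  ((isSym_aSym fun p : SignVel R => p.1).mul (isSym_phiHat_one R)).mono_order (by norm_num)

lemma isSym_inner_mul_phiHat_two (R : ℝ) :
    IsSym n (-1) fun (p : SignVel R × {d : R3 // ‖d‖ ≤ 1}) ξ =>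
      Complex.I * ((inner ℝ ((2 * Real.pi) • ξ) (p.2 : R3) : ℝ) : ℂ)
        * phiHat p.1.1 2 p.1.2 ((2 * Real.pi) • ξ) := by
  have h1 := (isSym_phase_inv (n := n) R).comp
    (fun p : SignVel R × {d : R3 // ‖d‖ ≤ 1} => p.1)
  have h2 := (isSym_inner (n := n) (f := fun p : SignVel R × {d : R3 // ‖d‖ ≤ 1} => (p.2 : R3))
    (C := 1) fun p => p.2.2).mul (h1.mul h1)
  refine cast (congrArg _ ?_) h2
  ext p ξ
  simp only [phiHat_eq, sq, mul_inv]

end KleinGordonSymbols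

/-! ### Symbols of order `-1` act boundedly on bounded functions -/

lemma memLp_inv_norm_add_sq : MemLp (fun x : R3 => (‖x‖ + ‖x‖ ^ 2)⁻¹) 2 := by
  have hm : Measurable fun x : R3 => (‖x‖ + ‖x‖ ^ 2)⁻¹ := by fun_prop
  rw [memLp_two_iff_integrable_sq hm.aestronglyMeasurable]
  have := (integrable_fun_norm_addHaar (E := R3) (μ := volume)
    (f := fun r : ℝ => ((r + r ^ 2)⁻¹) ^ 2)).1
  refine (integrable_fun_norm_addHaar (E := R3) (μ := volume)
    (f := fun r : ℝ => ((r + r ^ 2)⁻¹) ^ 2)).2 ?_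
  have hi : IntegrableOn (fun y : ℝ => (1 + y ^ 2)⁻¹) (Set.Ioi 0) :=
    integrable_inv_one_add_sq.integrableOn
  refine hi.mono' (by fun_prop) ((ae_restrict_iff' measurableSet_Ioi).2
    (Filter.Eventually.of_forall fun y hy => ?_))
  have hy : 0 < y := hy
  simp only [finrank_euclideanSpace, Fintype.card_fin, smul_eq_mul]
  rw [Real.norm_of_nonneg (by positivity)]
  have e : y ^ (3 - 1) * ((y + y ^ 2)⁻¹) ^ 2 = ((1 + y) ^ 2)⁻¹ := by
    norm_num
    field_simp
  rw [e]
  gcongr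
  nlinarith

lemma fourier_fderiv_apply {h : R3 → ℂ} (h0 : Integrable h) (hd : Differentiable ℝ h)
    (h1 : Integrable (fderiv ℝ h)) (e w : R3) :
    𝓕 (fun ξ => fderiv ℝ h ξ e) w = (2 * Real.pi * Complex.I * inner ℝ w e) * 𝓕 h w := by
  rw [← Real.fourier_continuousLinearMap_apply h1, Real.fourier_fderiv h0 hd h1]
  simp only [VectorFourier.fourierSMulRight_apply, neg_apply]
  rw [← Complex.coe_smul, smul_smul]
  have e' : (innerSL ℝ) w e = inner ℝ w e := rfl
  rw [smul_eq_mul, e']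
  push_cast
  ring

/-- A multiplier whose kernel is integrable is bounded on bounded functions. -/
lemma norm_fourierInv_mul_le {h : R3 → ℂ} (hc : Continuous h) (h0 : Integrable h)
    (hk : Integrable (𝓕 h)) {g : R3 → C3} (hg : Integrable g) {M : ℝ}
    (hM : ∀ x, ‖𝓕⁻ g x‖ ≤ M) (x : R3) :
    ‖𝓕⁻ (fun ξ => h ξ • g ξ) x‖ ≤ (∫ y, ‖𝓕 h y‖) * M := by
  have hkinv : 𝓕⁻ h = fun y => 𝓕 h (-y) := by
    ext y; exact Real.fourierInv_eq_fourier_neg h y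
  have hk' : Integrable (𝓕⁻ h) := by rw [hkinv]; exact hk.comp_neg
  have hinv : 𝓕 (𝓕⁻ h) = h := hc.fourier_fourierInv_eq h0 hk
  have hg' : Integrable fun ξ : R3 => Real.fourierChar (inner ℝ ξ x) • g ξ := by
    have := (Real.fourierIntegral_convergent_iff (f := g) (-x)).2 hg
    simpa using this
  have e : 𝓕⁻ (fun ξ => h ξ • g ξ) x
      = ∫ y, 𝓕⁻ h y • 𝓕 (fun ξ : R3 => Real.fourierChar (inner ℝ ξ x) • g ξ) y := by
    rw [← integral_fourier_smul_eq hk' hg', hinv, Real.fourierInv_eq]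
    congr 1 with ξ
    rw [smul_comm]
  have e2 : ∀ y, 𝓕 (fun ξ : R3 => Real.fourierChar (inner ℝ ξ x) • g ξ) y = 𝓕⁻ g (x - y) := by
    intro y
    rw [Real.fourier_eq, Real.fourierInv_eq]
    congr 1 with ξ
    rw [smul_smul, ← AddChar.map_add_eq_mul, inner_sub_right, neg_add_eq_sub]
  rw [e]
  have hI : ∫ y, ‖𝓕 h y‖ = ∫ y, ‖𝓕⁻ h y‖ := by
    rw [hkinv]; exact (integral_neg_eq_self (fun y => ‖𝓕 h y‖) volume).symm
  rw [hI, ← integral_mul_const]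
  refine norm_integral_le_of_norm_le (hk'.norm.mul_const M)
    (Filter.Eventually.of_forall fun y => ?_)
  rw [norm_smul, e2]
  gcongr
  exact hM _

lemma integrable_of_le_wt {E : Type*} [NormedAddCommGroup E] {h : R3 → E} (hc : Continuous h)
    {C : ℝ} {r : ℤ} (hr : r ≤ -4) (hC : 0 ≤ C) (h' : ∀ ξ, ‖h ξ‖ ≤ C * wt ξ ^ r) :
    Integrable h := by
  refine (integrable_wt_inv_pow_four.const_mul C).mono' hc.aestronglyMeasurable
    (Filter.Eventually.of_forall fun ξ => (h' ξ).trans ?_)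
  gcongr
  rw [← zpow_natCast, ← zpow_neg]
  exact zpow_le_zpow_right₀ (one_le_wt ξ) hr

lemma eLpNorm_two_le_of_le_wt {h : R3 → ℂ} {C : ℝ} {r : ℤ} (hr : r ≤ -2) (hC : 0 ≤ C)
    (h' : ∀ ξ, ‖h ξ‖ ≤ C * wt ξ ^ r) :
    eLpNorm h 2 volume
      ≤ ENNReal.ofReal C * eLpNorm (fun ξ => (((wt ξ ^ 2)⁻¹ : ℝ) : ℂ)) 2 volume := by
  refine eLpNorm_le_mul_eLpNorm_of_ae_le_mul (Filter.Eventually.of_forall fun ξ => ?_) 2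
  refine (h' ξ).trans ?_
  have := wt_pos ξ
  rw [Complex.norm_real, Real.norm_of_nonneg (by positivity)]
  gcongr
  rw [← zpow_natCast, ← zpow_neg]
  exact zpow_le_zpow_right₀ (one_le_wt ξ) hr

/-- The `L¹` norm of the kernel of a symbol `h` is controlled by `L²` bounds on `D h` and `D² h`:
by Plancherel these control `|x| K` and `|x|² K`, and `(|x| + |x|²)⁻¹` is square integrable in three
dimensions. The bound does not involve the constants of the order `-5`, which only serves to make all
integrals converge. -/
lemma kernel_bound {h : R3 → ℂ} (hs : IsSym 2 (-5) fun (_ : Unit) => h) {B : ℝ} (hB : 0 ≤ B)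
    (h1 : ∀ ξ, ‖fderiv ℝ h ξ‖ ≤ B * wt ξ ^ (-2 : ℤ))
    (h2 : ∀ ξ, ‖fderiv ℝ (fderiv ℝ h) ξ‖ ≤ B * wt ξ ^ (-3 : ℤ)) :
    Integrable (𝓕 h) ∧ ∫ y, ‖𝓕 h y‖ ≤ 6 *
      (eLpNorm (fun x : R3 => (‖x‖ + ‖x‖ ^ 2)⁻¹) 2 volume
        * eLpNorm (fun ξ => (((wt ξ ^ 2)⁻¹ : ℝ) : ℂ)) 2 volume).toReal * B := by
  have hC : ContDiff ℝ 2 h := hs.1 ()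
  have hC1 : ContDiff ℝ 1 (fderiv ℝ h) := hC.fderiv_right (by norm_num)
  have hcc : Continuous (fderiv ℝ (fderiv ℝ h)) := hC1.continuous_fderiv (by norm_num)
  obtain ⟨C0, hC0, hb⟩ := hs.exists_nonneg
  have b0 : ∀ ξ, ‖h ξ‖ ≤ C0 * wt ξ ^ (-5 : ℤ) := fun ξ => by simpa using hb () ξ 0 (by norm_num)
  have b1 : ∀ ξ, ‖fderiv ℝ h ξ‖ ≤ C0 * wt ξ ^ (-6 : ℤ) := fun ξ => by
    have := hb () ξ 1 (by norm_num)
    rwa [norm_iteratedFDeriv_one] at this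
  have b2 : ∀ ξ, ‖fderiv ℝ (fderiv ℝ h) ξ‖ ≤ C0 * wt ξ ^ (-7 : ℤ) := fun ξ => by
    have := hb () ξ 2 (by norm_num)
    rwa [← norm_iteratedFDeriv_fderiv, norm_iteratedFDeriv_one] at this
  have i0 := integrable_of_le_wt hC.continuous (by norm_num) hC0 b0
  have i1 := integrable_of_le_wt hC1.continuous (by norm_num) hC0 b1
  have i2 := integrable_of_le_wt (E := R3 →L[ℝ] R3 →L[ℝ] ℂ) (r := -7) hcc (by norm_num) hC0 b2
  let e : Fin 3 → R3 := fun j => EuclideanSpace.single j 1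
  have he : ∀ j, ‖e j‖ = 1 := fun j => by simp [e]
  let D1 : Fin 3 → R3 → ℂ := fun j ξ => fderiv ℝ h ξ (e j)
  let D2 : Fin 3 → R3 → ℂ := fun j ξ => fderiv ℝ (fderiv ℝ h) ξ (e j) (e j)
  have n1 : ∀ j ξ, ‖D1 j ξ‖ ≤ ‖fderiv ℝ h ξ‖ := fun j ξ => by
    simpa [he] using (fderiv ℝ h ξ).le_opNorm (e j)
  have n2 : ∀ j ξ, ‖D2 j ξ‖ ≤ ‖fderiv ℝ (fderiv ℝ h) ξ‖ := fun j ξ => by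
    simpa [he] using (fderiv ℝ (fderiv ℝ h) ξ).le_opNorm₂ (e j) (e j)
  have c1 : ∀ j, ContDiff ℝ 1 (D1 j) := fun j => hC1.clm_apply contDiff_const
  have c2 : ∀ j, Continuous (D2 j) := fun j =>
    (hcc.clm_apply continuous_const).clm_apply continuous_const
  have d12 : ∀ j ξ, fderiv ℝ (D1 j) ξ
      = (fderiv ℝ (fderiv ℝ h) ξ).flip (e j) := fun j ξ => by
    have hd := (hC1.differentiable (by norm_num) ξ).hasFDerivAt
    have := (ContinuousLinearMap.apply ℝ ℂ (e j)).hasFDerivAt.comp ξ hd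
    exact this.fderiv
  have id1 : ∀ j, Integrable (D1 j) := fun j =>
    i1.mono (c1 j).continuous.aestronglyMeasurable (Filter.Eventually.of_forall (n1 j))
  have id2 : ∀ j, Integrable (D2 j) := fun j =>
    i2.mono (c2 j).aestronglyMeasurable (Filter.Eventually.of_forall (n2 j))
  have ifd : ∀ j, Integrable (fderiv ℝ (D1 j)) := fun j => by
    refine i2.mono ((c1 j).continuous_fderiv (by norm_num)).aestronglyMeasurable
      (Filter.Eventually.of_forall fun ξ => ?_)
    rw [d12]
    refine (ContinuousLinearMap.le_opNorm _ _).trans ?_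
    rw [he, mul_one, ContinuousLinearMap.opNorm_flip]
  -- a derivative of `h` is a factor `2πi y` on its Fourier transform
  have f1 : ∀ j y, 𝓕 (D1 j) y = (2 * Real.pi * Complex.I * (y j : ℝ)) * 𝓕 h y := fun j y => by
    have := fourier_fderiv_apply i0 (hC.differentiable (by norm_num)) i1 (e j) y
    simpa [e, EuclideanSpace.inner_single_right] using this
  have f2 : ∀ j y, 𝓕 (D2 j) y = (2 * Real.pi * Complex.I * (y j : ℝ)) * 𝓕 (D1 j) y :=
      fun j y => by
    have := fourier_fderiv_apply (id1 j) ((c1 j).differentiable (by norm_num)) (ifd j) (e j) y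
    simp only [d12] at this
    simpa [e, EuclideanSpace.inner_single_right] using this
  have m1 : ∀ j, MemLp (D1 j) 2 := fun j =>
    ⟨(c1 j).continuous.aestronglyMeasurable, (eLpNorm_two_le_of_le_wt (by norm_num) hB
      fun ξ => (n1 j ξ).trans (h1 ξ)).trans_lt
        (ENNReal.mul_lt_top ENNReal.ofReal_lt_top memLp_wt_inv_sq.eLpNorm_lt_top)⟩
  have m2 : ∀ j, MemLp (D2 j) 2 := fun j =>
    ⟨(c2 j).aestronglyMeasurable, (eLpNorm_two_le_of_le_wt (by norm_num) hB
      fun ξ => (n2 j ξ).trans (h2 ξ)).trans_lt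
        (ENNReal.mul_lt_top ENNReal.ofReal_lt_top memLp_wt_inv_sq.eLpNorm_lt_top)⟩
  set Z := eLpNorm (fun ξ => (((wt ξ ^ 2)⁻¹ : ℝ) : ℂ)) 2 volume with hZ
  set W := eLpNorm (fun x : R3 => (‖x‖ + ‖x‖ ^ 2)⁻¹) 2 volume with hW
  -- `H` dominates `(|y| + |y|²) |K|` and is square integrable by Plancherel
  let H : R3 → ℝ := fun y => ∑ j, (‖𝓕 (D1 j) y‖ + ‖𝓕 (D2 j) y‖)
  have hk : Continuous (𝓕 h) := continuous_fourier i0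
  have kH : ∀ᵐ y : R3, ‖𝓕 h y‖ ≤ ‖(((fun x : R3 => (‖x‖ + ‖x‖ ^ 2)⁻¹) • H) : R3 → ℝ) y‖ := by
    have hne : ∀ᵐ y : R3, y ≠ 0 := Measure.ae_ne volume 0
    filter_upwards [hne] with y hy
    have hy' : 0 < ‖y‖ := norm_pos_iff.2 hy
    have hH0 : 0 ≤ H y := Finset.sum_nonneg fun j _ => by positivity
    simp only [Pi.smul_apply', smul_eq_mul]
    rw [Real.norm_of_nonneg (by positivity), inv_mul_eq_div, le_div_iff₀ (by positivity)]
    have s1 : ‖y‖ ≤ ∑ j, |y j| := by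
      rw [EuclideanSpace.norm_eq]
      refine Real.sqrt_le_iff.2 ⟨Finset.sum_nonneg fun j _ => abs_nonneg _, ?_⟩
      simp only [Real.norm_eq_abs]
      exact Finset.sum_sq_le_sq_sum_of_nonneg fun j _ => abs_nonneg _
    have s2 : ‖y‖ ^ 2 = ∑ j, |y j| ^ 2 := by
      rw [EuclideanSpace.norm_sq_eq]; simp
    calc ‖𝓕 h y‖ * (‖y‖ + ‖y‖ ^ 2) ≤ ‖𝓕 h y‖ * (∑ j, |y j| + ∑ j, |y j| ^ 2) := by
          rw [s2]; gcongr
      _ = ∑ j, (|y j| * ‖𝓕 h y‖ + |y j| ^ 2 * ‖𝓕 h y‖) := by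
          rw [← Finset.sum_add_distrib, Finset.mul_sum]
          exact Finset.sum_congr rfl fun j _ => by ring
      _ ≤ H y := by
          refine Finset.sum_le_sum fun j _ => ?_
          have hp : 1 ≤ 2 * Real.pi := by linarith [Real.pi_gt_three]
          have q1 : ‖𝓕 (D1 j) y‖ = (2 * Real.pi) * (|y j| * ‖𝓕 h y‖) := by
            rw [f1]; simp [abs_of_pos Real.pi_pos]; ring
          have q2 : ‖𝓕 (D2 j) y‖ = (2 * Real.pi) ^ 2 * (|y j| ^ 2 * ‖𝓕 h y‖) := by
            rw [f2, norm_mul, q1]; simp [abs_of_pos Real.pi_pos, -sq_abs]; ring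
          rw [q1, q2]
          have q3 : (1 : ℝ) ≤ (2 * Real.pi) ^ 2 := one_le_pow₀ hp
          exact add_le_add (le_mul_of_one_le_left (by positivity) hp)
            (le_mul_of_one_le_left (by positivity) q3)
  have hHm : Continuous H := continuous_finsetSum _ fun j _ =>
    (continuous_fourier (id1 j)).norm.add (continuous_fourier (id2 j)).norm
  have hH2 : eLpNorm H 2 volume ≤ 6 * (ENNReal.ofReal B * Z) := by
    have t1 : ∀ j, eLpNorm (fun y => ‖𝓕 (D1 j) y‖) 2 volume ≤ ENNReal.ofReal B * Z := fun j => by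
      rw [eLpNorm_norm, eLpNorm_fourier (id1 j) (m1 j)]
      exact eLpNorm_two_le_of_le_wt (by norm_num) hB fun ξ => (n1 j ξ).trans (h1 ξ)
    have t2 : ∀ j, eLpNorm (fun y => ‖𝓕 (D2 j) y‖) 2 volume ≤ ENNReal.ofReal B * Z := fun j => by
      rw [eLpNorm_norm, eLpNorm_fourier (id2 j) (m2 j)]
      exact eLpNorm_two_le_of_le_wt (by norm_num) hB fun ξ => (n2 j ξ).trans (h2 ξ)
    have k1 : ∀ j, Continuous fun y => ‖𝓕 (D1 j) y‖ := fun j => (continuous_fourier (id1 j)).norm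
    have k2 : ∀ j, Continuous fun y => ‖𝓕 (D2 j) y‖ := fun j => (continuous_fourier (id2 j)).norm
    have hHe : H = ∑ j, fun y => (‖𝓕 (D1 j) y‖ + ‖𝓕 (D2 j) y‖) := by
      ext y; simp [H]
    rw [hHe]
    calc _ ≤ ∑ j, eLpNorm (fun y => (‖𝓕 (D1 j) y‖ + ‖𝓕 (D2 j) y‖)) 2 volume :=
          eLpNorm_sum_le (fun j _ => ((k1 j).add (k2 j)).aestronglyMeasurable) one_le_two
      _ ≤ ∑ _j : Fin 3, (ENNReal.ofReal B * Z + ENNReal.ofReal B * Z) :=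
          Finset.sum_le_sum fun j _ => (eLpNorm_add_le (k1 j).aestronglyMeasurable
            (k2 j).aestronglyMeasurable one_le_two).trans (add_le_add (t1 j) (t2 j))
      _ = 6 * (ENNReal.ofReal B * Z) := by
          simp only [Finset.sum_const, Finset.card_univ, Fintype.card_fin, nsmul_eq_mul]
          push_cast
          ring
  have hfin : eLpNorm (𝓕 h) 1 volume ≤ W * (6 * (ENNReal.ofReal B * Z)) :=
    (eLpNorm_mono_ae kH).trans ((eLpNorm_smul_le_mul_eLpNorm (p := 2) (q := 2) (r := 1)
      hHm.aestronglyMeasurable memLp_inv_norm_add_sq.aestronglyMeasurable).trans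
        (by gcongr))
  have hZt : Z ≠ ⊤ := memLp_wt_inv_sq.eLpNorm_ne_top
  have hWt : W ≠ ⊤ := memLp_inv_norm_add_sq.eLpNorm_ne_top
  have htop : W * (6 * (ENNReal.ofReal B * Z)) ≠ ⊤ :=
    ENNReal.mul_ne_top hWt (ENNReal.mul_ne_top (by simp)
      (ENNReal.mul_ne_top ENNReal.ofReal_ne_top hZt))
  have hint : Integrable (𝓕 h) := memLp_one_iff_integrable.1
    ⟨hk.aestronglyMeasurable, hfin.trans_lt htop.lt_top⟩
  refine ⟨hint, ?_⟩
  rw [integral_norm_eq_lintegral_enorm hk.aestronglyMeasurable, ← eLpNorm_one_eq_lintegral_enorm]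
  refine (ENNReal.toReal_mono htop hfin).trans (le_of_eq ?_)
  simp only [ENNReal.toReal_mul, ENNReal.toReal_ofReal hB, ENNReal.toReal_ofNat]
  ring

/-- A symbol of order `-1` with two controlled derivatives is a Fourier multiplier that is bounded
on bounded functions, uniformly in the parameters. -/
theorem exists_sup_bound {P : Type*} {m : P → R3 → ℂ} (hm : IsSym 2 (-1) m) :
    ∃ C : ℝ, 0 ≤ C ∧ ∀ p (g : R3 → C3), Integrable g → ∀ M : ℝ, (∀ x, ‖𝓕⁻ g x‖ ≤ M) →
      ∀ x, ‖𝓕⁻ (fun ξ => m p ξ • g ξ) x‖ ≤ C * M := by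
  -- Two truncations lower the order of the symbol to `-5`, so that its Fourier transform and those
  -- of its derivatives converge absolutely, while its bounds of order `-1` do not depend on the
  -- truncation.
  have hu : IsSym 2 (-1) fun (q : P × Set.Ioc (0 : ℝ) 1) ξ =>
      cutoff q.2 ξ * (cutoff q.2 ξ * m q.1 ξ) :=
    (isSym_cutoff.comp Prod.snd).mul ((isSym_cutoff.comp Prod.snd).mul (hm.comp Prod.fst))
  obtain ⟨B, hB, hb⟩ := hu.exists_nonneg
  refine ⟨6 * (eLpNorm (fun x : R3 => (‖x‖ + ‖x‖ ^ 2)⁻¹) 2 volume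
      * eLpNorm (fun ξ => (((wt ξ ^ 2)⁻¹ : ℝ) : ℂ)) 2 volume).toReal * B, by positivity,
    fun p g hg M hM x => ?_⟩
  have hη : ∀ n : ℕ, ((n : ℝ) + 1)⁻¹ ∈ Set.Ioc (0 : ℝ) 1 := fun n =>
    ⟨by positivity, inv_le_one_of_one_le₀ (by simp)⟩
  have hM0 : 0 ≤ M := (norm_nonneg _).trans (hM 0)
  let h : ℕ → R3 → ℂ := fun n ξ =>
    cutoff ((n : ℝ) + 1)⁻¹ ξ * (cutoff ((n : ℝ) + 1)⁻¹ ξ * m p ξ)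
  have hs : ∀ n, IsSym 2 (-5) fun (_ : Unit) => h n := fun n =>
    (isSym_cutoff_of_pos (hη n).1).mul
      ((isSym_cutoff_of_pos (hη n).1).mul (hm.comp fun _ : Unit => p))
  have key : ∀ n, ‖𝓕⁻ (fun ξ => h n ξ • g ξ) x‖ ≤ 6 *
      (eLpNorm (fun x : R3 => (‖x‖ + ‖x‖ ^ 2)⁻¹) 2 volume
        * eLpNorm (fun ξ => (((wt ξ ^ 2)⁻¹ : ℝ) : ℂ)) 2 volume).toReal * B * M := fun n => by
    have hc : Continuous (h n) := ((hs n).1 ()).continuous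
    obtain ⟨C0, hC0, hb0⟩ := (hs n).exists_nonneg
    have hi : Integrable (h n) := integrable_of_le_wt hc (r := -5) (by norm_num) hC0 fun ξ => by
      simpa using hb0 () ξ 0 (by norm_num)
    have b1 : ∀ ξ, ‖fderiv ℝ (h n) ξ‖ ≤ B * wt ξ ^ (-2 : ℤ) := fun ξ => by
      have := hb (p, ⟨_, hη n⟩) ξ 1 (by norm_num)
      rwa [norm_iteratedFDeriv_one] at this
    have b2 : ∀ ξ, ‖fderiv ℝ (fderiv ℝ (h n)) ξ‖ ≤ B * wt ξ ^ (-3 : ℤ) := fun ξ => by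
      have := hb (p, ⟨_, hη n⟩) ξ 2 (by norm_num)
      rwa [← norm_iteratedFDeriv_fderiv, norm_iteratedFDeriv_one] at this
    obtain ⟨hk, hkb⟩ := kernel_bound (hs n) hB b1 b2
    exact (norm_fourierInv_mul_le hc hi hk hg hM x).trans (by gcongr)
  obtain ⟨C1, hC1⟩ := hm.exists_bound
  have hmb : ∀ ξ, ‖m p ξ‖ ≤ |C1| := fun ξ => by
    refine (hC1 p ξ).trans ((le_abs_self _).trans ?_)
    have h0 := wt_pos ξ
    have h1 := one_le_wt ξ
    rw [abs_mul, zpow_neg_one, abs_of_pos (inv_pos.2 h0)]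
    exact mul_le_of_le_one_right (abs_nonneg _) (inv_le_one_of_one_le₀ h1)
  have hmc : Continuous (m p) := (hm.1 p).continuous
  have lim : Filter.Tendsto (fun n => 𝓕⁻ (fun ξ => h n ξ • g ξ) x) Filter.atTop
      (nhds (𝓕⁻ (fun ξ => m p ξ • g ξ) x)) := by
    simp only [Real.fourierInv_eq]
    refine tendsto_integral_of_dominated_convergence (fun ξ => |C1| * ‖g ξ‖) (fun n => ?_)
      (hg.norm.const_mul _) (fun n => Filter.Eventually.of_forall fun ξ => ?_)
      (Filter.Eventually.of_forall fun ξ => ?_)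
    · have hc : Continuous (h n) := ((hs n).1 ()).continuous
      have : AEStronglyMeasurable (fun ξ => h n ξ • g ξ) volume :=
        hc.aestronglyMeasurable.smul hg.aestronglyMeasurable
      have hch : Continuous fun ξ : R3 => (Real.fourierChar (inner ℝ ξ x) : ℂ) :=
        continuous_subtype_val.comp (Real.continuous_fourierChar.comp (by fun_prop))
      exact hch.aestronglyMeasurable.smul this
    · rw [Circle.norm_smul, norm_smul]
      gcongr
      simp only [h, norm_mul]
      have c1 := norm_cutoff_le_one (hη n).1 ξ
      calc _ ≤ 1 * (1 * ‖m p ξ‖) := by gcongr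
        _ ≤ |C1| := by simpa using hmb ξ
    · refine Filter.Tendsto.const_smul (Filter.Tendsto.smul_const ?_ _) _
      have ht : Filter.Tendsto (fun n : ℕ => cutoff ((n : ℝ) + 1)⁻¹ ξ) Filter.atTop (nhds 1) := by
        have h1 : Filter.Tendsto (fun n : ℕ => (1 + ((n : ℝ) + 1)⁻¹ * wt ξ ^ 2)⁻¹)
            Filter.atTop (nhds (1 + 0 * wt ξ ^ 2)⁻¹) := by
          refine Filter.Tendsto.inv₀ (Filter.Tendsto.const_add _ (Filter.Tendsto.mul_const _ ?_))
            (by simp)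
          simpa using tendsto_one_div_add_atTop_nhds_zero_nat (𝕜 := ℝ)
        have h2 := (Complex.continuous_ofReal.tendsto _).comp h1
        simpa [Function.comp_def, ← cutoff_eq_ofReal, cutoff] using h2
      have := ht.mul (ht.mul (tendsto_const_nhds (x := m p ξ)))
      simpa [h] using this
  exact le_of_tendsto lim.norm (Filter.Eventually.of_forall key)

/-! ### The half fields on the Fourier side -/

section Duhamel

variable {α₀ : ℕ} {ε T : ℝ} {S₀ : ℤˣ → R3 → ℂ} {S : ℝ → R3 → ℝ} {Er : ℝ → R3 → R3}

/-- The Fourier transform of the source density, extended by zero to all times. -/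
noncomputable def srcHat (T : ℝ) (S : ℝ → R3 → ℝ) (s : ℝ) (ξ : R3) : ℂ :=
  open scoped Classical in
  if s ∈ Set.Ico 0 T then 𝓕 (fun y => (S s y : ℂ)) ξ else 0

/-- The contribution `a_± ∇S₀` of the initial density, on the Fourier side. -/
noncomputable def initHat (S₀ : ℤˣ → R3 → ℂ) (σ : ℤˣ) (ξ : R3) : C3 :=
  (aSym σ ((2 * Real.pi) • ξ) * fourierL2 (S₀ σ) ξ) • kC ξ

/-- The forcing `e^{-λ_± s} a_± ∇S(s)` of the profile, on the Fourier side. -/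
noncomputable def forceHat (T : ℝ) (S : ℝ → R3 → ℝ) (σ : ℤˣ) (s : ℝ) (ξ : R3) : C3 :=
  (Complex.exp (-(lam σ ((2 * Real.pi) • ξ) * s)) * aSym σ ((2 * Real.pi) • ξ)
    * srcHat T S s ξ) • kC ξ

/-- The profile `e^{-λ_± t} E^osc_±(t)`, on the Fourier side. -/
noncomputable def profile (T : ℝ) (S₀ : ℤˣ → R3 → ℂ) (S : ℝ → R3 → ℝ) (σ : ℤˣ) (t : ℝ)
    (ξ : R3) : C3 :=
  initHat S₀ σ ξ + ∫ s in (0 : ℝ)..t, forceHat T S σ s ξ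

/-- The Fourier transform of `E^osc_±(t)`. -/
noncomputable def EoscHat (T : ℝ) (S₀ : ℤˣ → R3 → ℂ) (S : ℝ → R3 → ℝ) (σ : ℤˣ) (t : ℝ)
    (ξ : R3) : C3 :=
  Complex.exp (lam σ ((2 * Real.pi) • ξ) * t) • profile T S₀ S σ t ξ

/-- A majorant of the profile, uniform in time. -/
noncomputable def profileMaj (T : ℝ) (S₀ : ℤˣ → R3 → ℂ) (S : ℝ → R3 → ℝ) (σ : ℤˣ)
    (ξ : R3) : ℝ :=
  ‖initHat S₀ σ ξ‖ + ∫ s in Set.Ioc 0 T, ‖forceHat T S σ s ξ‖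

lemma Bootstrap.eLpNorm_S_le (hb : Bootstrap α₀ ε T S₀ S Er) {s : ℝ} (hs : s ∈ Set.Ico 0 T)
    {p : ℝ≥0∞} (hp : 1 ≤ p) : eLpNorm (fun y => (S s y : ℂ)) p volume
      ≤ ENNReal.ofReal (ε * bracket s ^ (-3 * (1 - p⁻¹.toReal))) := by
  have h : eLpNorm (fun y => (S s y : ℂ)) p volume = eLpNorm (S s) p volume :=
    eLpNorm_congr_norm_ae (Filter.Eventually.of_forall fun y => by simp)
  rw [h]
  exact le_self_add.trans (hb.decay_S s hs p hp)

lemma Bootstrap.continuous_S (hb : Bootstrap α₀ ε T S₀ S Er) {s : ℝ} (hs : s ∈ Set.Ico 0 T) :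
    Continuous fun y => (S s y : ℂ) :=
  Complex.continuous_ofReal.comp (hb.S_smooth s hs).continuous

lemma Bootstrap.memLp_S (hb : Bootstrap α₀ ε T S₀ S Er) {s : ℝ} (hs : s ∈ Set.Ico 0 T)
    {p : ℝ≥0∞} (hp : 1 ≤ p) : MemLp (fun y => (S s y : ℂ)) p volume :=
  ⟨(hb.continuous_S hs).aestronglyMeasurable,
    (hb.eLpNorm_S_le hs hp).trans_lt ENNReal.ofReal_lt_top⟩

lemma Bootstrap.integrable_S (hb : Bootstrap α₀ ε T S₀ S Er) {s : ℝ} (hs : s ∈ Set.Ico 0 T) :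
    Integrable fun y => (S s y : ℂ) :=
  memLp_one_iff_integrable.1 (hb.memLp_S hs le_rfl)

lemma Bootstrap.norm_srcHat_le (hb : Bootstrap α₀ ε T S₀ S Er) (hε : 0 ≤ ε) (s : ℝ) (ξ : R3) :
    ‖srcHat T S s ξ‖ ≤ ε := by
  unfold srcHat
  split_ifs with hs
  · refine (VectorFourier.norm_fourierIntegral_le_integral_norm _ _ _ _ _).trans ?_
    have h := hb.eLpNorm_S_le hs (p := 1) le_rfl
    rw [integral_norm_eq_lintegral_enorm (hb.continuous_S hs).aestronglyMeasurable,
      ← eLpNorm_one_eq_lintegral_enorm]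
    refine (ENNReal.toReal_mono ENNReal.ofReal_ne_top h).trans ?_
    rw [ENNReal.toReal_ofReal (by have := bracket_pos s; positivity)]
    simp
  · simpa using hε

lemma Bootstrap.sobolevNorm_S_le (hb : Bootstrap α₀ ε T S₀ S Er) {s : ℝ}
    (hs : s ∈ Set.Ico 0 T) : sobolevNorm α₀ (fun y => (S s y : ℂ))
      ≤ ENNReal.ofReal (ε * bracket s ^ (1 / ((α₀ : ℝ) - 1))) :=
  le_add_self.trans (hb.bound_top 1 s hs)

lemma Bootstrap.srcHat_ae_eq (hb : Bootstrap α₀ ε T S₀ S Er) {s : ℝ} (hs : s ∈ Set.Ico 0 T) :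
    srcHat T S s =ᵐ[volume] fourierL2 (fun y => (S s y : ℂ)) := by
  have h := fourierL2_eq_fourier (hb.integrable_S hs) (hb.memLp_S hs one_le_two)
  have e : srcHat T S s = 𝓕 (fun y => (S s y : ℂ)) := by ext ξ; simp [srcHat, hs]
  rw [e]
  exact h.symm

lemma Bootstrap.sobolevNorm_S_lt_top (hb : Bootstrap α₀ ε T S₀ S Er) {s : ℝ}
    (hs : s ∈ Set.Ico 0 T) : sobolevNorm α₀ (fun y => (S s y : ℂ)) < ⊤ :=
  (hb.sobolevNorm_S_le hs).trans_lt ENNReal.ofReal_lt_top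

/-- The gradient of the source density is given pointwise by its Fourier integral. -/
lemma Bootstrap.sourceF_eq (hb : Bootstrap α₀ ε T S₀ S Er) (hα : 8 ≤ α₀) {s : ℝ}
    (hs : s ∈ Set.Ico 0 T) : sourceF S s = 𝓕⁻ (fun ξ => srcHat T S s ξ • kC ξ) := by
  have h := grad_eq_fourierInv (s := α₀) (by omega) (hb.continuous_S hs)
    (hb.sobolevNorm_S_lt_top hs)
  rw [sourceF, h]
  ext1 x
  refine Real.fourierInv_congr_ae ?_ x
  filter_upwards [hb.srcHat_ae_eq hs] with ξ hξ
  rw [hξ]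

lemma Bootstrap.integrable_srcHat_smul_kC (hb : Bootstrap α₀ ε T S₀ S Er) (hα : 8 ≤ α₀) {s : ℝ}
    (hs : s ∈ Set.Ico 0 T) : Integrable fun ξ => srcHat T S s ξ • kC ξ := by
  refine (integrable_fourierL2_smul_kC (s := α₀) (by omega) (hb.sobolevNorm_S_lt_top hs)).congr ?_
  filter_upwards [hb.srcHat_ae_eq hs] with ξ hξ
  rw [hξ]

lemma Bootstrap.fourierL2_sourceF (hb : Bootstrap α₀ ε T S₀ S Er) (hα : 8 ≤ α₀) {s : ℝ}
    (hs : s ∈ Set.Ico 0 T) :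
    fourierL2 (sourceF S s) =ᵐ[volume] fun ξ => srcHat T S s ξ • kC ξ := by
  refine (fourierL2_grad (s := α₀) (by omega) (hb.continuous_S hs)
    (hb.sobolevNorm_S_lt_top hs)).trans ?_
  filter_upwards [hb.srcHat_ae_eq hs] with ξ hξ
  rw [hξ]

/-- The frequency side of the source density is measurable jointly in time and frequency. -/
lemma Bootstrap.stronglyMeasurable_srcHat (hb : Bootstrap α₀ ε T S₀ S Er) :
    StronglyMeasurable fun p : ℝ × R3 => srcHat T S p.1 p.2 := by
  let ι : Set.Ico 0 T × R3 → ℝ × R3 := Prod.map Subtype.val id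
  have hι : MeasurableEmbedding ι :=
    (MeasurableEmbedding.subtype_coe measurableSet_Ico).prodMap MeasurableEmbedding.id
  let Sx : ℝ × R3 → ℝ := Function.extend ι (fun p => S p.1 p.2) 0
  have hSx : Measurable Sx := hι.measurable_extend hb.S_measurable measurable_const
  have hSx1 : ∀ s ∈ Set.Ico 0 T, ∀ y, Sx (s, y) = S s y := fun s hs y =>
    hι.injective.extend_apply (fun p => S p.1 p.2) 0 (⟨s, hs⟩, y)
  have hSx0 : ∀ s ∉ Set.Ico 0 T, ∀ y, Sx (s, y) = 0 := fun s hs y =>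
    Function.extend_apply' _ _ _ (by
      rintro ⟨p, hp⟩
      have h1 : (p.1 : ℝ) = s := congrArg Prod.fst hp
      exact hs (h1 ▸ p.1.2))
  have hF : StronglyMeasurable fun q : (ℝ × R3) × R3 =>
      Real.fourierChar (-inner ℝ q.2 q.1.2) • ((Sx (q.1.1, q.2) : ℝ) : ℂ) := by
    refine Measurable.stronglyMeasurable ?_
    have h1 : Measurable fun q : (ℝ × R3) × R3 =>
        (Real.fourierChar (-inner ℝ q.2 q.1.2) : ℂ) :=
      (continuous_subtype_val.comp (Real.continuous_fourierChar.comp (by fun_prop))).measurable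
    have h2 : Measurable fun q : (ℝ × R3) × R3 => ((Sx (q.1.1, q.2) : ℝ) : ℂ) :=
      Complex.measurable_ofReal.comp (hSx.comp (by fun_prop))
    exact h1.mul h2
  have h := hF.integral_prod_right' (ν := (volume : Measure R3))
  convert h using 1
  ext ⟨s, ξ⟩
  by_cases hs : s ∈ Set.Ico 0 T
  · simp only [srcHat, hs, if_true, Real.fourier_eq, hSx1 s hs]
  · simp [srcHat, hs, hSx0 s hs]

lemma norm_exp_lam_mul (σ : ℤˣ) (k : R3) (t : ℝ) : ‖Complex.exp (lam σ k * t)‖ = 1 := by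
  have : lam σ k * t = ((((σ : ℤ) : ℝ) * bracket k * t : ℝ) : ℂ) * Complex.I := by
    simp only [lam]; push_cast; ring
  rw [this, Complex.norm_exp_ofReal_mul_I]

lemma norm_exp_neg_lam_mul (σ : ℤˣ) (k : R3) (t : ℝ) :
    ‖Complex.exp (-(lam σ k * t))‖ = 1 := by
  rw [Complex.exp_neg, norm_inv, norm_exp_lam_mul, inv_one]

lemma norm_aSym_mul_le (σ : ℤˣ) (ξ : R3) : ‖aSym σ ((2 * Real.pi) • ξ)‖ * wt ξ ≤ 1 := by
  have h := wt_pos ξ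
  have e : ‖aSym σ ((2 * Real.pi) • ξ)‖ = 1 / 2 * (wt ξ)⁻¹ := by
    rw [aSym, norm_mul, norm_mul, norm_neg, norm_sign, norm_inv, Complex.norm_real,
      Real.norm_of_nonneg (bracket_pos _).le]
    simp [wt]
  rw [e, mul_assoc, inv_mul_cancel₀ h.ne']
  norm_num

lemma norm_forceHat_le (σ : ℤˣ) (s : ℝ) (ξ : R3) :
    ‖forceHat T S σ s ξ‖ ≤ ‖srcHat T S s ξ‖ := by
  rw [forceHat, norm_smul, norm_mul, norm_mul, norm_exp_neg_lam_mul, one_mul]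
  have h1 := norm_aSym_mul_le σ ξ
  have h2 := norm_kC_le ξ
  calc _ ≤ ‖aSym σ ((2 * Real.pi) • ξ)‖ * ‖srcHat T S s ξ‖ * wt ξ := by gcongr
    _ = (‖aSym σ ((2 * Real.pi) • ξ)‖ * wt ξ) * ‖srcHat T S s ξ‖ := by ring
    _ ≤ 1 * ‖srcHat T S s ξ‖ := by gcongr
    _ = _ := one_mul _

lemma norm_initHat_le (σ : ℤˣ) (ξ : R3) : ‖initHat S₀ σ ξ‖ ≤ ‖fourierL2 (S₀ σ) ξ‖ := by
  rw [initHat, norm_smul, norm_mul]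
  have h1 := norm_aSym_mul_le σ ξ
  have h2 := norm_kC_le ξ
  calc _ ≤ ‖aSym σ ((2 * Real.pi) • ξ)‖ * ‖fourierL2 (S₀ σ) ξ‖ * wt ξ := by gcongr
    _ = (‖aSym σ ((2 * Real.pi) • ξ)‖ * wt ξ) * ‖fourierL2 (S₀ σ) ξ‖ := by ring
    _ ≤ 1 * ‖fourierL2 (S₀ σ) ξ‖ := by gcongr
    _ = _ := one_mul _

lemma continuous_aSym (σ : ℤˣ) : Continuous (aSym σ) := by
  unfold aSym
  refine continuous_const.mul (Continuous.inv₀ (Complex.continuous_ofReal.comp continuous_bracket)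
    fun k => Complex.ofReal_ne_zero.2 (bracket_pos k).ne')

lemma continuous_lam (σ : ℤˣ) : Continuous (lam σ) := by
  unfold lam
  exact continuous_const.mul (Complex.continuous_ofReal.comp continuous_bracket)

lemma stronglyMeasurable_fourierL2 {G : Type*} [NormedAddCommGroup G] [InnerProductSpace ℂ G]
    [CompleteSpace G] (f : R3 → G) : StronglyMeasurable (fourierL2 f) := by
  unfold fourierL2
  split_ifs with h
  · exact Lp.stronglyMeasurable _
  · exact stronglyMeasurable_zero

lemma stronglyMeasurable_initHat (σ : ℤˣ) : StronglyMeasurable (initHat S₀ σ) :=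
  (((continuous_aSym σ).comp (continuous_const_smul _)).stronglyMeasurable.mul
    (stronglyMeasurable_fourierL2 _)).smul continuous_kC.stronglyMeasurable

lemma Bootstrap.stronglyMeasurable_forceHat (hb : Bootstrap α₀ ε T S₀ S Er) (σ : ℤˣ) :
    StronglyMeasurable fun p : ℝ × R3 => forceHat T S σ p.1 p.2 := by
  have h1 : Continuous fun p : ℝ × R3 =>
      Complex.exp (-(lam σ ((2 * Real.pi) • p.2) * p.1)) * aSym σ ((2 * Real.pi) • p.2) := by
    refine Continuous.mul (Complex.continuous_exp.comp (Continuous.neg (Continuous.mul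
      ((continuous_lam σ).comp (by fun_prop)) (Complex.continuous_ofReal.comp continuous_fst))))
      ((continuous_aSym σ).comp (by fun_prop))
  exact (h1.stronglyMeasurable.mul hb.stronglyMeasurable_srcHat).smul
    (continuous_kC.comp continuous_snd).stronglyMeasurable

lemma Bootstrap.norm_forceHat_le_const (hb : Bootstrap α₀ ε T S₀ S Er) (hε : 0 ≤ ε) (σ : ℤˣ)
    (s : ℝ) (ξ : R3) : ‖forceHat T S σ s ξ‖ ≤ ε :=
  (norm_forceHat_le σ s ξ).trans (hb.norm_srcHat_le hε s ξ)

/-- Four powers of the weight times the source are integrable in time and frequency, because `S(s)`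
is bounded in `H^{α₀}` on `[0, T)` and `α₀ ≥ 6`. -/
lemma Bootstrap.integrable_wt_pow_forceHat (hb : Bootstrap α₀ ε T S₀ S Er) (hα : 8 ≤ α₀)
    (hε : 0 ≤ ε) (σ : ℤˣ) :
    Integrable (fun p : ℝ × R3 => wt p.2 ^ 4 * ‖forceHat T S σ p.1 p.2‖)
      ((volume.restrict (Set.Ioc 0 T)).prod volume) := by
  obtain ⟨N, rfl⟩ : ∃ N, α₀ = N + 2 := ⟨α₀ - 2, by omega⟩
  set Z := eLpNorm (fun ξ => (((wt ξ ^ 2)⁻¹ : ℝ) : ℂ)) 2 volume with hZ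
  have hm : StronglyMeasurable fun p : ℝ × R3 => wt p.2 ^ 4 * ‖forceHat T S σ p.1 p.2‖ :=
    ((continuous_wt.comp continuous_snd).pow 4).stronglyMeasurable.mul
      (hb.stronglyMeasurable_forceHat σ).norm
  refine ⟨hm.aestronglyMeasurable, ?_⟩
  have hbound : ∀ s, ∫⁻ ξ, ‖wt ξ ^ 4 * ‖forceHat T S σ s ξ‖‖ₑ
      ≤ Z * ENNReal.ofReal (ε * bracket T ^ (1 / (((N + 2 : ℕ) : ℝ) - 1))) := fun s => by
    by_cases hs : s ∈ Set.Ico 0 T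
    · have h2 := hb.memLp_S hs one_le_two
      refine le_trans ?_ ((eLpNorm_one_le_sobolevNorm N h2).trans ?_)
      · rw [eLpNorm_one_eq_lintegral_enorm]
        refine lintegral_mono_ae ?_
        filter_upwards [hb.srcHat_ae_eq hs] with ξ hξ
        have hw := wt_pos ξ
        rw [enorm_le_iff_norm_le, ← hξ, norm_smul, Complex.norm_real,
          Real.norm_of_nonneg (by positivity), Real.norm_of_nonneg (by positivity)]
        gcongr
        · exact one_le_wt ξ
        · omega
        · exact norm_forceHat_le σ s ξ
      · refine mul_le_mul_right ((hb.sobolevNorm_S_le hs).trans ?_) _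
        refine ENNReal.ofReal_le_ofReal ?_
        have h0 := bracket_pos s
        have : bracket s ≤ bracket T := by
          unfold bracket
          have := hs.1
          have := hs.2.le
          rw [Real.norm_of_nonneg hs.1, Real.norm_of_nonneg (hs.1.trans hs.2.le)]
          gcongr
        have h1 : (0 : ℝ) ≤ 1 / (((N + 2 : ℕ) : ℝ) - 1) := by
          push_cast
          have : (0 : ℝ) ≤ N := Nat.cast_nonneg N
          have : (0 : ℝ) ≤ (N : ℝ) + 2 - 1 := by linarith
          positivity
        gcongr
    · have e : ∀ ξ, forceHat T S σ s ξ = 0 := fun ξ => by simp [forceHat, srcHat, hs]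
      simp [e]
  rw [hasFiniteIntegral_iff_enorm, lintegral_prod _ hm.aestronglyMeasurable.enorm]
  refine (lintegral_mono fun s => hbound s).trans_lt ?_
  rw [lintegral_const]
  refine ENNReal.mul_lt_top (ENNReal.mul_lt_top memLp_wt_inv_sq.eLpNorm_lt_top
    ENNReal.ofReal_lt_top) ?_
  simp

lemma Bootstrap.stronglyMeasurable_profile (hb : Bootstrap α₀ ε T S₀ S Er) (σ : ℤˣ) :
    StronglyMeasurable fun p : Set.Ici (0 : ℝ) × R3 => profile T S₀ S σ p.1 p.2 := by
  let A : Set ((Set.Ici (0 : ℝ) × R3) × ℝ) := {q | 0 < q.2 ∧ q.2 ≤ (q.1.1 : ℝ)}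
  have hA : MeasurableSet A :=
    (measurableSet_lt measurable_const measurable_snd).inter
      (measurableSet_le measurable_snd
        (measurable_subtype_coe.comp (measurable_fst.comp measurable_fst)))
  let f : (Set.Ici (0 : ℝ) × R3) × ℝ → C3 := fun q => forceHat T S σ q.2 q.1.2
  have hq : Measurable fun q : (Set.Ici (0 : ℝ) × R3) × ℝ => (q.2, q.1.2) :=
    measurable_snd.prodMk (measurable_snd.comp measurable_fst)
  have hf : StronglyMeasurable f := by
    have := (hb.stronglyMeasurable_forceHat σ).comp_measurable hq
    exact this
  have h2 : StronglyMeasurable fun p : Set.Ici (0 : ℝ) × R3 => ∫ s, A.indicator f (p, s) :=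
    (hf.indicator hA).integral_prod_right' (ν := (volume : Measure ℝ))
  have e : ∀ p : Set.Ici (0 : ℝ) × R3, profile T S₀ S σ p.1 p.2
      = initHat S₀ σ p.2 + ∫ s, A.indicator f (p, s) := fun p => by
    rw [profile, intervalIntegral.integral_of_le p.1.2, ← integral_indicator measurableSet_Ioc]
    rfl
  simp only [e]
  exact ((stronglyMeasurable_initHat σ).comp_measurable measurable_snd).add h2

lemma Bootstrap.integrable_profileMaj (hb : Bootstrap α₀ ε T S₀ S Er) (hα : 8 ≤ α₀)
    (hε : 0 ≤ ε) (σ : ℤˣ) : Integrable fun ξ => wt ξ ^ 4 * profileMaj T S₀ S σ ξ := by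
  have h1 : Integrable fun ξ => wt ξ ^ 4 * ‖initHat S₀ σ ξ‖ := by
    refine (integrable_wt_pow_fourierL2 (m := 4) (by omega) (hb.S₀_sobolev σ)).mono'
      ((continuous_wt.pow 4).stronglyMeasurable.mul
        (stronglyMeasurable_initHat σ).norm).aestronglyMeasurable
      (Filter.Eventually.of_forall fun ξ => ?_)
    have := wt_pos ξ
    rw [Real.norm_of_nonneg (by positivity)]
    gcongr
    exact norm_initHat_le σ ξ
  have h2 := (hb.integrable_wt_pow_forceHat hα hε σ).integral_prod_right
  refine (h1.add h2).congr (Filter.Eventually.of_forall fun ξ => ?_)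
  simp only [Pi.add_apply, profileMaj, mul_add]
  rw [integral_const_mul]

lemma Bootstrap.intervalIntegrable_forceHat (hb : Bootstrap α₀ ε T S₀ S Er) (hε : 0 ≤ ε) (σ : ℤˣ)
    (ξ : R3) (a b : ℝ) : IntervalIntegrable (fun s => forceHat T S σ s ξ) volume a b := by
  have hq : Measurable fun s : ℝ => (s, ξ) := measurable_prodMk_right
  have hm : StronglyMeasurable fun s => forceHat T S σ s ξ := by
    have := (hb.stronglyMeasurable_forceHat σ).comp_measurable hq
    exact this
  exact (intervalIntegrable_const (c := ε)).mono_fun' hm.aestronglyMeasurable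
    (Filter.Eventually.of_forall fun s => hb.norm_forceHat_le_const hε σ s ξ)

lemma Bootstrap.norm_profile_le (hb : Bootstrap α₀ ε T S₀ S Er) (hε : 0 ≤ ε) (σ : ℤˣ) {t : ℝ}
    (ht : t ∈ Set.Icc 0 T) (ξ : R3) : ‖profile T S₀ S σ t ξ‖ ≤ profileMaj T S₀ S σ ξ := by
  refine (norm_add_le _ _).trans (add_le_add le_rfl ?_)
  refine (intervalIntegral.norm_integral_le_integral_norm ht.1).trans ?_
  rw [intervalIntegral.integral_of_le ht.1]
  have h0 : ∀ s, 0 ≤ ‖forceHat T S σ s ξ‖ := fun s => norm_nonneg _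
  refine setIntegral_mono_set ?_ (Filter.Eventually.of_forall h0)
    (Set.Ioc_subset_Ioc_right ht.2).eventuallyLE
  exact ((intervalIntegrable_iff_integrableOn_Ioc_of_le (ht.1.trans ht.2)).1
    (hb.intervalIntegrable_forceHat hε σ ξ 0 T)).norm

lemma norm_EoscHat (σ : ℤˣ) (t : ℝ) (ξ : R3) :
    ‖EoscHat T S₀ S σ t ξ‖ = ‖profile T S₀ S σ t ξ‖ := by
  rw [EoscHat, norm_smul, norm_exp_lam_mul, one_mul]

lemma profileMaj_nonneg (σ : ℤˣ) (ξ : R3) : 0 ≤ profileMaj T S₀ S σ ξ :=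
  add_nonneg (norm_nonneg _) (integral_nonneg fun _ => norm_nonneg _)

lemma Bootstrap.stronglyMeasurable_EoscHat (hb : Bootstrap α₀ ε T S₀ S Er) (σ : ℤˣ) :
    StronglyMeasurable fun p : Set.Ici (0 : ℝ) × R3 => EoscHat T S₀ S σ p.1 p.2 := by
  have h1 : Continuous fun p : Set.Ici (0 : ℝ) × R3 =>
      Complex.exp (lam σ ((2 * Real.pi) • p.2) * ((p.1 : ℝ) : ℂ)) :=
    Complex.continuous_exp.comp (Continuous.mul
      ((continuous_lam σ).comp (by fun_prop)) (Complex.continuous_ofReal.comp (by fun_prop)))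
  exact h1.stronglyMeasurable.smul (hb.stronglyMeasurable_profile σ)

/-- Up to four powers of the weight, `Ê^osc_±(t)` is integrable. -/
lemma Bootstrap.integrable_smul_EoscHat (hb : Bootstrap α₀ ε T S₀ S Er) (hα : 8 ≤ α₀)
    (hε : 0 ≤ ε) (σ : ℤˣ) {t : ℝ} (ht : t ∈ Set.Ico 0 T) {m : R3 → ℂ} (hm : Continuous m) {C : ℝ}
    (hC : ∀ ξ, ‖m ξ‖ ≤ C * wt ξ ^ 4) : Integrable fun ξ => m ξ • EoscHat T S₀ S σ t ξ := by
  have hq : Measurable fun ξ : R3 => ((⟨t, ht.1⟩ : Set.Ici (0 : ℝ)), ξ) := measurable_prodMk_left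
  have hU : StronglyMeasurable fun ξ => EoscHat T S₀ S σ t ξ := by
    have := (hb.stronglyMeasurable_EoscHat σ).comp_measurable hq
    exact this
  refine ((hb.integrable_profileMaj hα hε σ).const_mul C).mono'
    (hm.aestronglyMeasurable.smul hU.aestronglyMeasurable)
    (Filter.Eventually.of_forall fun ξ => ?_)
  rw [norm_smul, norm_EoscHat, ← mul_assoc]
  exact mul_le_mul (hC ξ) (hb.norm_profile_le hε σ ⟨ht.1, ht.2.le⟩ ξ) (norm_nonneg _)
    ((norm_nonneg _).trans (hC ξ))

lemma Bootstrap.integrable_EoscHat (hb : Bootstrap α₀ ε T S₀ S Er) (hα : 8 ≤ α₀)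
    (hε : 0 ≤ ε) (σ : ℤˣ) {t : ℝ} (ht : t ∈ Set.Ico 0 T) : Integrable (EoscHat T S₀ S σ t) := by
  have := hb.integrable_smul_EoscHat hα hε σ ht (m := fun _ => 1) continuous_const (C := 1)
    fun ξ => by simpa using one_le_pow₀ (one_le_wt ξ)
  simpa using this

/-- Duhamel's formula on the Fourier side: `E^osc_±(t)` is the inverse Fourier transform of
`EoscHat`. -/
lemma Bootstrap.Eosc_eq (hb : Bootstrap α₀ ε T S₀ S Er) (hα : 8 ≤ α₀) (hε : 0 ≤ ε) (σ : ℤˣ)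
    {t : ℝ} (ht : t ∈ Set.Ico 0 T) : Eosc S₀ S σ t = 𝓕⁻ (EoscHat T S₀ S σ t) := by
  ext1 x
  have hexp : Continuous fun ξ : R3 => Complex.exp (lam σ ((2 * Real.pi) • ξ) * (t : ℂ)) :=
    Complex.continuous_exp.comp (Continuous.mul
      ((continuous_lam σ).comp (by fun_prop)) continuous_const)
  have h1 : multiplier (GoscHat σ t) (grad (S₀ σ)) x
      = 𝓕⁻ (fun ξ => Complex.exp (lam σ ((2 * Real.pi) • ξ) * t) • initHat S₀ σ ξ) x := by
    refine Real.fourierInv_congr_ae ?_ x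
    filter_upwards [fourierL2_grad (s := α₀ + 1) (by omega) (hb.S₀_smooth σ).continuous
      (hb.S₀_sobolev σ)] with ξ hξ
    rw [hξ, GoscHat, initHat, smul_smul, smul_smul, mul_assoc]
  have h2 : ∀ s ∈ Set.Ioc 0 t, multiplier (GoscHat σ (t - s)) (sourceF S s) x
      = 𝓕⁻ (fun ξ => Complex.exp (lam σ ((2 * Real.pi) • ξ) * t) • forceHat T S σ s ξ) x := by
    intro s hs
    refine Real.fourierInv_congr_ae ?_ x
    filter_upwards [hb.fourierL2_sourceF hα ⟨hs.1.le, hs.2.trans_lt ht.2⟩] with ξ hξ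
    rw [hξ, GoscHat, forceHat, smul_smul, smul_smul]
    congr 1
    rw [← mul_assoc, ← mul_assoc, ← Complex.exp_add]
    push_cast
    ring_nf
  have hF := hb.integrable_wt_pow_forceHat hα hε σ
  have hmono : (volume.restrict (Set.Ioc 0 t)).prod (volume : Measure R3)
      ≤ (volume.restrict (Set.Ioc 0 T)).prod volume :=
    Measure.prod_mono (Measure.restrict_mono_set _ (Set.Ioc_subset_Ioc_right ht.2.le)) le_rfl
  have hch : Continuous fun ξ : R3 => (Real.fourierChar (inner ℝ ξ x) : ℂ) :=
    continuous_subtype_val.comp (Real.continuous_fourierChar.comp (by fun_prop))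
  have hG : Integrable (Function.uncurry fun (s : ℝ) (ξ : R3) =>
      Real.fourierChar (inner ℝ ξ x) •
        (Complex.exp (lam σ ((2 * Real.pi) • ξ) * t) • forceHat T S σ s ξ))
      ((volume.restrict (Set.Ioc 0 t)).prod volume) := by
    refine (hF.mono_measure hmono).mono' ?_ (Filter.Eventually.of_forall fun p => ?_)
    · exact ((hch.comp continuous_snd).stronglyMeasurable.smul
        ((hexp.comp continuous_snd).stronglyMeasurable.smul
          (hb.stronglyMeasurable_forceHat σ))).aestronglyMeasurable
    · simp only [Function.uncurry]
      rw [Circle.norm_smul, norm_smul, norm_exp_lam_mul, one_mul]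
      exact le_mul_of_one_le_left (norm_nonneg _) (one_le_pow₀ (one_le_wt p.2))
  -- Fubini for the time integral and the frequency integral
  have h3 : ∫ s in (0 : ℝ)..t, multiplier (GoscHat σ (t - s)) (sourceF S s) x
      = 𝓕⁻ (fun ξ => Complex.exp (lam σ ((2 * Real.pi) • ξ) * t) •
          ∫ s in (0 : ℝ)..t, forceHat T S σ s ξ) x := by
    rw [intervalIntegral.integral_of_le ht.1, setIntegral_congr_fun measurableSet_Ioc h2]
    simp only [Real.fourierInv_eq]
    rw [integral_integral_swap hG]
    congr 1 with ξ : 1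
    rw [intervalIntegral.integral_of_le ht.1, ← integral_smul]
    simp only [Circle.smul_def]
    rw [← integral_smul]
  have hi1 : Integrable fun ξ : R3 => Real.fourierChar (inner ℝ ξ x) •
      (Complex.exp (lam σ ((2 * Real.pi) • ξ) * t) • initHat S₀ σ ξ) := by
    have h0 : Integrable (fourierL2 (S₀ σ)) := by
      have := integrable_wt_pow_fourierL2 (m := 0) (by omega) (hb.S₀_sobolev σ)
      rw [← integrable_norm_iff (stronglyMeasurable_fourierL2 _).aestronglyMeasurable]
      simpa using this
    refine h0.norm.mono' (hch.stronglyMeasurable.smul (hexp.stronglyMeasurable.smul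
      (stronglyMeasurable_initHat σ))).aestronglyMeasurable
      (Filter.Eventually.of_forall fun ξ => ?_)
    rw [Circle.norm_smul, norm_smul, norm_exp_lam_mul, one_mul]
    exact norm_initHat_le σ ξ
  have hi2 : Integrable fun ξ : R3 => Real.fourierChar (inner ℝ ξ x) •
      (Complex.exp (lam σ ((2 * Real.pi) • ξ) * t) •
        ∫ s in (0 : ℝ)..t, forceHat T S σ s ξ) := by
    refine hG.integral_prod_right.congr (Filter.Eventually.of_forall fun ξ => ?_)
    simp only [Function.uncurry]
    rw [intervalIntegral.integral_of_le ht.1, ← integral_smul]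
    simp only [Circle.smul_def]
    rw [← integral_smul]
  rw [Eosc, h1, h3]
  simp only [Real.fourierInv_eq]
  rw [← integral_add hi1 hi2]
  congr 1 with ξ : 1
  rw [EoscHat, profile, smul_add, smul_add]

lemma Bootstrap.fourierL2_Eosc (hb : Bootstrap α₀ ε T S₀ S Er) (hα : 8 ≤ α₀) (hε : 0 ≤ ε)
    (σ : ℤˣ) {t : ℝ} (ht : t ∈ Set.Ico 0 T) :
    fourierL2 (Eosc S₀ S σ t) =ᵐ[volume] EoscHat T S₀ S σ t := by
  have h := memLp_of_sobolevNorm_lt_top ((hb.bound_Eosc σ t ht).trans_lt ENNReal.ofReal_lt_top)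
  rw [hb.Eosc_eq hα hε σ ht] at h ⊢
  exact fourierL2_fourierInv (hb.integrable_EoscHat hα hε σ ht) h

lemma Bootstrap.EoscJ_eq (hb : Bootstrap α₀ ε T S₀ S Er) (hα : 8 ≤ α₀) (hε : 0 ≤ ε)
    (σ : ℤˣ) (j : ℕ) {t : ℝ} (ht : t ∈ Set.Ico 0 T) (x v : R3) :
    EoscJ S₀ S σ j t x v
      = 𝓕⁻ (fun ξ => phiHat σ j v ((2 * Real.pi) • ξ) • EoscHat T S₀ S σ t ξ) x := by
  refine Real.fourierInv_congr_ae ?_ x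
  filter_upwards [hb.fourierL2_Eosc hα hε σ ht] with ξ hξ
  rw [hξ]

lemma Bootstrap.multiplier_sourceF (hb : Bootstrap α₀ ε T S₀ S Er) (hα : 8 ≤ α₀)
    {t : ℝ} (ht : t ∈ Set.Ico 0 T) (m : R3 → ℂ) (x : R3) :
    multiplier m (sourceF S t) x
      = 𝓕⁻ (fun ξ => m ((2 * Real.pi) • ξ) • srcHat T S t ξ • kC ξ) x := by
  refine Real.fourierInv_congr_ae ?_ x
  filter_upwards [hb.fourierL2_sourceF hα ht] with ξ hξ
  rw [hξ]

end Duhamel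

/-! ### Integration by parts against a Lipschitz profile -/

section IntegrationByParts

variable {F : Type*} [NormedAddCommGroup F] [NormedSpace ℝ F] [CompleteSpace F] {s t : ℝ}

lemma absolutelyContinuous_integral_of_bound {f : ℝ → F} {C : ℝ} (hst : s ≤ t)
    (hf : IntervalIntegrable f volume s t) (hC : ∀ τ ∈ Set.Icc s t, ‖f τ‖ ≤ C) :
    AbsolutelyContinuousOnInterval (fun τ => ∫ r in s..τ, f r) s t := by
  refine LipschitzOnWith.absolutelyContinuousOnInterval (K := C.toNNReal) ?_
  rw [Set.uIcc_of_le hst]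
  refine LipschitzOnWith.of_dist_le_mul fun a ha b hb => ?_
  have hC0 : 0 ≤ C := (norm_nonneg _).trans (hC a ha)
  have hi : ∀ c ∈ Set.Icc s t, IntervalIntegrable f volume s c := fun c hc =>
    hf.mono_set (by rw [Set.uIcc_of_le hc.1, Set.uIcc_of_le hst]; exact Set.Icc_subset_Icc_right hc.2)
  rw [dist_eq_norm, intervalIntegral.integral_interval_sub_left (hi a ha) (hi b hb),
    Real.coe_toNNReal _ hC0, Real.dist_eq]
  refine intervalIntegral.norm_integral_le_of_norm_le_const fun r hr => hC r ?_
  have := Set.uIoc_subset_uIcc hr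
  exact (Set.ordConnected_Icc.uIcc_subset hb ha) this

lemma absolutelyContinuous_of_hasDerivWithinAt {f f' : ℝ → F} {C : ℝ} (hst : s ≤ t)
    (hf : ∀ τ ∈ Set.Icc s t, HasDerivWithinAt f (f' τ) (Set.Icc s t) τ)
    (hC : ∀ τ ∈ Set.Icc s t, ‖f' τ‖ ≤ C) : AbsolutelyContinuousOnInterval f s t := by
  refine LipschitzOnWith.absolutelyContinuousOnInterval (K := C.toNNReal) ?_
  rw [Set.uIcc_of_le hst]
  refine (convex_Icc s t).lipschitzOnWith_of_nnnorm_hasDerivWithin_le hf fun τ hτ => ?_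
  rw [← NNReal.coe_le_coe, coe_nnnorm,
    Real.coe_toNNReal _ ((norm_nonneg _).trans (hC τ hτ))]
  exact hC τ hτ

lemma ae_mem_Icc_imp_mem_Ioo (s t : ℝ) : ∀ᵐ τ : ℝ, τ ∈ Set.Icc s t → τ ∈ Set.Ioo s t := by
  filter_upwards [Measure.ae_ne volume s, Measure.ae_ne volume t] with τ h1 h2 h
  exact ⟨lt_of_le_of_ne h.1 h1.symm, lt_of_le_of_ne h.2 h2⟩

/-- A derivative is measurable, without any assumption on its regularity. -/
lemma aestronglyMeasurable_of_hasDerivWithinAt [SecondCountableTopology F] {f f' : ℝ → F}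
    (hf : ∀ τ ∈ Set.Icc s t, HasDerivWithinAt f (f' τ) (Set.Icc s t) τ) :
    AEStronglyMeasurable f' (volume.restrict (Set.Ioc s t)) := by
  borelize F
  refine (measurable_deriv f).stronglyMeasurable.aestronglyMeasurable.congr ?_
  filter_upwards [ae_restrict_mem measurableSet_Ioc,
    ae_restrict_of_ae (ae_mem_Icc_imp_mem_Ioo s t)] with τ h1 h2
  have h3 := h2 (Set.Ioc_subset_Icc_self h1)
  exact ((hf τ (Set.Ioo_subset_Icc_self h3)).hasDerivAt (Icc_mem_nhds h3.1 h3.2)).deriv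

/-- A bounded derivative is integrable, even if it is not continuous. -/
lemma integrable_deriv_of_bound [SecondCountableTopology F] {f f' : ℝ → F} {C : ℝ} (hst : s ≤ t)
    (hf : ∀ τ ∈ Set.Icc s t, HasDerivWithinAt f (f' τ) (Set.Icc s t) τ)
    (hC : ∀ τ ∈ Set.Icc s t, ‖f' τ‖ ≤ C) : IntervalIntegrable f' volume s t := by
  rw [intervalIntegrable_iff_integrableOn_Ioc_of_le hst]
  exact (integrable_const C).mono' (aestronglyMeasurable_of_hasDerivWithinAt hf)
    ((ae_restrict_iff' measurableSet_Ioc).2 (Filter.Eventually.of_forall fun τ hτ =>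
      hC τ (Set.Ioc_subset_Icc_self hτ)))

variable [NormedSpace ℂ F] [IsScalarTower ℝ ℂ F] [SecondCountableTopology F]

/-- The product rule in integrated form, for the primitive of a function which is only bounded and
measurable. -/
lemma smul_sub_smul_eq_integral {p p' : ℝ → ℂ} {g W : ℝ → F} {A B : ℝ}
    (hst : s ≤ t) (hp : ∀ τ ∈ Set.Icc s t, HasDerivWithinAt p (p' τ) (Set.Icc s t) τ)
    (hA : ∀ τ ∈ Set.Icc s t, ‖p' τ‖ ≤ A) (hg : IntervalIntegrable g volume s t)
    (hB : ∀ τ ∈ Set.Icc s t, ‖g τ‖ ≤ B)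
    (hW : ∀ τ ∈ Set.Icc s t, W τ = W s + ∫ r in s..τ, g r) :
    p t • W t - p s • W s = ∫ τ in s..t, (p' τ • W τ + p τ • g τ) := by
  have hpc : ContinuousOn p (Set.Icc s t) := fun τ hτ => (hp τ hτ).continuousWithinAt
  have hWc : ContinuousOn W (Set.Icc s t) := by
    have := (absolutelyContinuous_integral_of_bound hst hg hB).continuousOn
    rw [Set.uIcc_of_le hst] at this
    exact (continuousOn_const.add this).congr hW
  have hW' : AbsolutelyContinuousOnInterval (fun τ => W s + ∫ r in s..τ, g r) s t :=
    (ContDiffOn.absolutelyContinuousOnInterval (f := fun _ => W s)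
      contDiffOn_const).add (absolutelyContinuous_integral_of_bound hst hg hB)
  obtain ⟨Cp, hCp⟩ := isCompact_Icc.exists_bound_of_continuousOn hpc
  obtain ⟨CW, hCW⟩ := isCompact_Icc.exists_bound_of_continuousOn hWc
  have hf1 : IntervalIntegrable (fun τ => p' τ • W τ) volume s t :=
    (integrable_deriv_of_bound hst hp hA).smul_continuousOn (by rwa [Set.uIcc_of_le hst])
  have hf2 : IntervalIntegrable (fun τ => p τ • g τ) volume s t :=
    hg.continuousOn_smul (by rwa [Set.uIcc_of_le hst])
  set f : ℝ → F := fun τ => p' τ • W τ + p τ • g τ with hf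
  have hfi : IntervalIntegrable f volume s t := hf1.add hf2
  have hfb : ∀ τ ∈ Set.Icc s t, ‖f τ‖ ≤ A * CW + Cp * B := fun τ hτ => by
    refine (norm_add_le _ _).trans ?_
    rw [norm_smul, norm_smul]
    have h1 := hA τ hτ
    have h2 := hCW τ hτ
    have h3 := hCp τ hτ
    have h4 := hB τ hτ
    have h5 := (norm_nonneg _).trans h1
    have h6 := (norm_nonneg _).trans h3
    gcongr
  have hac : AbsolutelyContinuousOnInterval
      (fun τ => p τ • (W s + ∫ r in s..τ, g r) - ∫ r in s..τ, f r) s t :=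
    ((absolutelyContinuous_of_hasDerivWithinAt hst hp hA).smul hW').sub
      (absolutelyContinuous_integral_of_bound hst hfi hfb)
  -- the difference of the two sides is absolutely continuous with vanishing derivative
  obtain ⟨C, hC⟩ := hac.const_of_ae_hasDerivAt_zero (by
    filter_upwards [hg.ae_hasDerivAt_integral, hfi.ae_hasDerivAt_integral,
      ae_mem_Icc_imp_mem_Ioo s t] with τ h1 h2 h3 hτ
    have hs : s ∈ Set.uIcc s t := Set.left_mem_uIcc
    have hτ' := h3 (by rwa [Set.uIcc_of_le hst] at hτ)
    have hτ'' := Set.Ioo_subset_Icc_self hτ'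
    have d1 := (h1 hτ s hs).const_add (W s)
    have d2 := (hp τ hτ'').hasDerivAt (Icc_mem_nhds hτ'.1 hτ'.2)
    have d3 := (d2.smul d1).sub (h2 hτ s hs)
    refine HasDerivAt.congr_deriv d3 ?_
    rw [← hW τ hτ'']
    simp only [hf]
    abel)
  have e1 := hC s Set.left_mem_uIcc
  have e2 := hC t Set.right_mem_uIcc
  simp only [intervalIntegral.integral_same, add_zero, sub_zero] at e1
  rw [← hW t ⟨hst, le_rfl⟩, ← e1] at e2
  rw [← e2]
  abel

end IntegrationByParts

/-! ### The half fields along a characteristic -/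

section Characteristic

variable {α₀ : ℕ} {ε T : ℝ} {S₀ : ℤˣ → R3 → ℂ} {S : ℝ → R3 → ℝ} {Er : ℝ → R3 → R3}

lemma contDiff_relVel : ContDiff ℝ 1 relVel := by
  have h : ContDiff ℝ 1 (bracket : R3 → ℝ) := by
    unfold bracket
    exact ContDiff.sqrt (contDiff_const.add (contDiff_norm_sq ℝ)) fun y => by positivity
  exact (h.inv fun y => (bracket_pos y).ne').smul contDiff_id

lemma continuous_fderiv_relVel_apply :
    Continuous fun q : R3 × R3 => fderiv ℝ relVel q.1 q.2 :=
  ((contDiff_relVel.continuous_fderiv one_ne_zero).comp continuous_fst).clm_apply continuous_snd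

lemma exists_norm_fderiv_relVel_le (R : ℝ) :
    ∃ D : ℝ, 0 < D ∧ ∀ v : R3, ‖v‖ ≤ R → ‖fderiv ℝ relVel v‖ ≤ D := by
  obtain ⟨D, hD⟩ := (isCompact_closedBall (0 : R3) R).exists_bound_of_continuousOn
    (contDiff_relVel.continuous_fderiv one_ne_zero).continuousOn
  exact ⟨max D 1, by positivity, fun v hv => (hD v (by simpa using hv)).trans (le_max_left _ _)⟩

lemma norm_phase_inv_le {R : ℝ} {v : R3} (hv : ‖v‖ ≤ R) (σ : ℤˣ) (ξ : R3) :
    ‖(phase σ v ξ)⁻¹‖ ≤ 2 * (1 + R ^ 2) := by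
  have h1 := wt_sub_le_norm_phase σ v ξ
  have h2 := norm_relVel_le hv
  have h3 := one_le_wt ξ
  have h4 : 0 < (2 * (1 + R ^ 2))⁻¹ := by positivity
  rw [norm_inv]
  refine inv_le_of_inv_le₀ (by positivity) ?_
  nlinarith

lemma continuous_phase (σ : ℤˣ) : Continuous fun q : R3 × R3 => phase σ q.1 q.2 := by
  unfold phase
  refine Continuous.add ((continuous_lam σ).comp (by fun_prop)) (continuous_const.mul
    (Complex.continuous_ofReal.comp (Continuous.inner (by fun_prop)
      (contDiff_relVel.continuous.comp continuous_fst))))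

lemma continuous_phase_inv (σ : ℤˣ) : Continuous fun q : R3 × R3 => (phase σ q.1 q.2)⁻¹ :=
  (continuous_phase σ).inv₀ fun q => phase_ne_zero σ q.1 q.2

lemma continuous_phiHat (σ : ℤˣ) (j : ℕ) (v : R3) :
    Continuous fun ξ => phiHat σ j v ((2 * Real.pi) • ξ) := by
  simp only [phiHat_eq, ← inv_pow]
  exact ((continuous_phase_inv σ).comp (continuous_const.prodMk continuous_id)).pow j

lemma norm_phiHat_le {R : ℝ} {v : R3} (hv : ‖v‖ ≤ R) (σ : ℤˣ) (j : ℕ) (ξ : R3) :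
    ‖phiHat σ j v ((2 * Real.pi) • ξ)‖ ≤ (2 * (1 + R ^ 2)) ^ j := by
  rw [phiHat_eq, ← inv_pow, norm_pow]
  gcongr
  exact norm_phase_inv_le hv σ ξ

/-- The symbol `i k·d` of the derivative in the direction `d`, at `k = 2πξ`. -/
noncomputable def dirSym (d ξ : R3) : ℂ :=
  Complex.I * ((inner ℝ ((2 * Real.pi) • ξ) d : ℝ) : ℂ)

lemma norm_dirSym_le (d ξ : R3) : ‖dirSym d ξ‖ ≤ ‖d‖ * wt ξ := by
  rw [dirSym, norm_mul, Complex.norm_I, one_mul, Complex.norm_real, mul_comm ‖d‖]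
  exact (abs_real_inner_le_norm _ _).trans
    (mul_le_mul_of_nonneg_right (norm_smul_le_wt ξ) (norm_nonneg d))

lemma continuous_dirSym : Continuous fun q : R3 × R3 => dirSym q.1 q.2 := by
  unfold dirSym
  exact continuous_const.mul (Complex.continuous_ofReal.comp
    (Continuous.inner (by fun_prop) continuous_fst))

lemma Bootstrap.integrable_dirSym_smul (hb : Bootstrap α₀ ε T S₀ S Er) (hα : 8 ≤ α₀)
    (hε : 0 ≤ ε) (σ : ℤˣ) (j : ℕ) {t : ℝ} (ht : t ∈ Set.Ico 0 T) (v d : R3) :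
    Integrable fun ξ => dirSym d ξ • phiHat σ j v ((2 * Real.pi) • ξ) • EoscHat T S₀ S σ t ξ := by
  have hc : Continuous fun ξ => dirSym d ξ * phiHat σ j v ((2 * Real.pi) • ξ) :=
    (continuous_dirSym.comp (continuous_const.prodMk continuous_id)).mul (continuous_phiHat σ j v)
  have := hb.integrable_smul_EoscHat hα hε σ ht hc (C := ‖d‖ * (2 * (1 + ‖v‖ ^ 2)) ^ j)
    fun ξ => by
      have h1 := norm_dirSym_le d ξ
      have h2 := norm_phiHat_le le_rfl σ j ξ (v := v)
      have h3 := one_le_wt ξ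
      have h4 := wt_pos ξ
      have h5 : wt ξ ≤ wt ξ ^ 4 := le_self_pow₀ h3 (by norm_num)
      rw [norm_mul]
      calc _ ≤ (‖d‖ * wt ξ) * (2 * (1 + ‖v‖ ^ 2)) ^ j := by gcongr
        _ ≤ (‖d‖ * wt ξ ^ 4) * (2 * (1 + ‖v‖ ^ 2)) ^ j := by gcongr
        _ = _ := by ring
  simpa only [mul_smul] using this

lemma Bootstrap.integrable_phiHat_smul (hb : Bootstrap α₀ ε T S₀ S Er) (hα : 8 ≤ α₀)
    (hε : 0 ≤ ε) (σ : ℤˣ) (j : ℕ) {t : ℝ} (ht : t ∈ Set.Ico 0 T) (v : R3) :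
    Integrable fun ξ => phiHat σ j v ((2 * Real.pi) • ξ) • EoscHat T S₀ S σ t ξ :=
  hb.integrable_smul_EoscHat hα hε σ ht (continuous_phiHat σ j v)
    (C := (2 * (1 + ‖v‖ ^ 2)) ^ j) fun ξ =>
      (norm_phiHat_le le_rfl σ j ξ).trans
        (le_mul_of_one_le_right (by positivity) (one_le_pow₀ (one_le_wt ξ)))

/-- Derivatives of `E^{osc,j}_±` in `x` are Fourier integrals. -/
lemma Bootstrap.fderiv_EoscJ (hb : Bootstrap α₀ ε T S₀ S Er) (hα : 8 ≤ α₀) (hε : 0 ≤ ε)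
    (σ : ℤˣ) (j : ℕ) {t : ℝ} (ht : t ∈ Set.Ico 0 T) (x v d : R3) :
    fderiv ℝ (fun y => EoscJ S₀ S σ j t y v) x d
      = 𝓕⁻ (fun ξ => dirSym d ξ • phiHat σ j v ((2 * Real.pi) • ξ) • EoscHat T S₀ S σ t ξ) x := by
  have e : (fun y => EoscJ S₀ S σ j t y v)
      = 𝓕⁻ (fun ξ => phiHat σ j v ((2 * Real.pi) • ξ) • EoscHat T S₀ S σ t ξ) := by
    ext1 y; exact hb.EoscJ_eq hα hε σ j ht y v
  have h0 := hb.integrable_phiHat_smul hα hε σ j ht v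
  have h1 : Integrable fun ξ => ‖ξ‖ *
      ‖phiHat σ j v ((2 * Real.pi) • ξ) • EoscHat T S₀ S σ t ξ‖ := by
    have hc : Continuous fun ξ : R3 => ((‖ξ‖ : ℝ) : ℂ) * phiHat σ j v ((2 * Real.pi) • ξ) :=
      (Complex.continuous_ofReal.comp continuous_norm).mul (continuous_phiHat σ j v)
    have := (hb.integrable_smul_EoscHat hα hε σ ht hc (C := (2 * (1 + ‖v‖ ^ 2)) ^ j)
      fun ξ => by
        have h1 := norm_le_wt ξ
        have h2 := norm_phiHat_le le_rfl σ j ξ (v := v)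
        have h3 := one_le_wt ξ
        have h4 := wt_pos ξ
        have h5 : wt ξ ≤ wt ξ ^ 4 := le_self_pow₀ h3 (by norm_num)
        rw [norm_mul, Complex.norm_real, norm_norm, mul_comm]
        gcongr
        exact h1.trans h5).norm
    refine this.congr (Filter.Eventually.of_forall fun ξ => ?_)
    simp only [norm_smul, norm_mul, Complex.norm_real, norm_norm, mul_assoc]
  obtain ⟨L, hL, hLd⟩ := hasFDerivAt_fourierInv h0 h1 x
  rw [e, hL.fderiv, hLd]
  rfl

lemma integrable_fourierChar_smul {u : R3 → C3} (hu : Integrable u) (x : R3) :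
    Integrable fun ξ : R3 => Real.fourierChar (inner ℝ ξ x) • u ξ := by
  have := (Real.fourierIntegral_convergent_iff (-x)).2 hu
  simpa using this

/-- The unimodular factor `e^{ik·x + λ_± τ}` at `k = 2πξ`. -/
noncomputable def wave (σ : ℤˣ) (x : R3) (τ : ℝ) (ξ : R3) : ℂ :=
  Complex.exp (Complex.I * ((inner ℝ ((2 * Real.pi) • ξ) x : ℝ) : ℂ)
    + lam σ ((2 * Real.pi) • ξ) * τ)

lemma fourierChar_mul_exp (σ : ℤˣ) (x : R3) (τ : ℝ) (ξ : R3) :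
    (Real.fourierChar (inner ℝ ξ x) : ℂ) * Complex.exp (lam σ ((2 * Real.pi) • ξ) * τ)
      = wave σ x τ ξ := by
  rw [Real.fourierChar_apply, ← Complex.exp_add, wave, real_inner_smul_left]
  push_cast
  ring_nf

lemma norm_wave (σ : ℤˣ) (x : R3) (τ : ℝ) (ξ : R3) : ‖wave σ x τ ξ‖ = 1 := by
  rw [← fourierChar_mul_exp, norm_mul, norm_exp_lam_mul, Circle.norm_coe, one_mul]

lemma continuous_wave (σ : ℤˣ) : Continuous fun q : R3 × ℝ × R3 => wave σ q.1 q.2.1 q.2.2 := by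
  unfold wave
  refine Complex.continuous_exp.comp (Continuous.add (continuous_const.mul
    (Complex.continuous_ofReal.comp (Continuous.inner (by fun_prop) continuous_fst)))
    (Continuous.mul ((continuous_lam σ).comp (by fun_prop))
      (Complex.continuous_ofReal.comp (by fun_prop))))

/-- Along a characteristic the factor `(λ + ik·v̂)⁻¹ e^{ik·x + λτ}` has derivative
`e^{ik·x + λτ}`, up to the contribution of the force `a`. -/
lemma hasDerivWithinAt_phase_inv_mul_wave (σ : ℤˣ) (ξ : R3) {X V : ℝ → R3} {a : R3} {τ : ℝ}
    {I : Set ℝ} (hX : HasDerivWithinAt X (relVel (V τ)) I τ) (hV : HasDerivWithinAt V a I τ) :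
    HasDerivWithinAt (fun r => (phase σ (V r) ξ)⁻¹ * wave σ (X r) r ξ)
      (wave σ (X τ) τ ξ - (phase σ (V τ) ξ)⁻¹ * (phase σ (V τ) ξ)⁻¹
        * dirSym (fderiv ℝ relVel (V τ) a) ξ * wave σ (X τ) τ ξ) I τ := by
  have hU : HasDerivWithinAt (fun r => relVel (V r)) (fderiv ℝ relVel (V τ) a) I τ :=
    (contDiff_relVel.differentiable one_ne_zero (V τ)).hasFDerivAt.comp_hasDerivWithinAt τ hV
  have hin : ∀ {Y : ℝ → R3} {y : R3}, HasDerivWithinAt Y y I τ →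
      HasDerivWithinAt (fun r => Complex.I * ((inner ℝ ((2 * Real.pi) • ξ) (Y r) : ℝ) : ℂ))
        (dirSym y ξ) I τ := fun {Y y} hY => by
    have h := (Complex.ofRealCLM ∘L innerSL ℝ ((2 * Real.pi) • ξ)).hasFDerivAt.comp_hasDerivWithinAt
      τ hY
    exact h.const_mul Complex.I
  have hph : HasDerivWithinAt (fun r => phase σ (V r) ξ) (dirSym (fderiv ℝ relVel (V τ) a) ξ) I τ :=
    (hin hU).const_add _
  have hτ : HasDerivWithinAt (fun r : ℝ => lam σ ((2 * Real.pi) • ξ) * (r : ℂ))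
      (lam σ ((2 * Real.pi) • ξ) * 1) I τ :=
    (Complex.ofRealCLM.hasDerivAt.hasDerivWithinAt).const_mul _
  have hw : HasDerivWithinAt (fun r => wave σ (X r) r ξ)
      (wave σ (X τ) τ ξ * phase σ (V τ) ξ) I τ := by
    have := ((hin hX).add hτ).cexp
    refine this.congr_deriv ?_
    simp only [wave, phase, dirSym, Pi.add_apply, mul_one]
    ring
  have hne := phase_ne_zero σ (V τ) ξ
  refine ((hph.fun_inv hne).mul hw).congr_deriv ?_
  field_simp
  ring

/-- The derivative of `E^{osc,1}_±` along a characteristic with force `a`. -/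
noncomputable def charDeriv (S₀ : ℤˣ → R3 → ℂ) (S : ℝ → R3 → ℝ) (σ : ℤˣ) (τ : ℝ)
    (x v a : R3) : C3 :=
  Eosc S₀ S σ τ x - fderiv ℝ (fun y => EoscJ S₀ S σ 2 τ y v) x (fderiv ℝ relVel v a)
    + multiplier (fun k => aSym σ k * phiHat σ 1 v k) (sourceF S τ) x

/-- The symbol of `φ_{±,1}` times a plane wave. -/
noncomputable def oscKernel (σ : ℤˣ) (x v : R3) (τ : ℝ) (ξ : R3) : ℂ :=
  (phase σ v ξ)⁻¹ * wave σ x τ ξ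

/-- The derivative of `oscKernel` along a characteristic, if `w` is the derivative of `v̂`. -/
noncomputable def oscKernelDeriv (σ : ℤˣ) (x v w : R3) (τ : ℝ) (ξ : R3) : ℂ :=
  wave σ x τ ξ - (phase σ v ξ)⁻¹ * (phase σ v ξ)⁻¹ * dirSym w ξ * wave σ x τ ξ

lemma norm_oscKernel_le {R : ℝ} {v : R3} (hv : ‖v‖ ≤ R) (σ : ℤˣ) (x : R3) (τ : ℝ) (ξ : R3) :
    ‖oscKernel σ x v τ ξ‖ ≤ 2 * (1 + R ^ 2) := by
  rw [oscKernel, norm_mul, norm_wave, mul_one]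
  exact norm_phase_inv_le hv σ ξ

lemma norm_oscKernelDeriv_le {R A : ℝ} {v w : R3} (hv : ‖v‖ ≤ R) (hw : ‖w‖ ≤ A) (σ : ℤˣ)
    (x : R3) (τ : ℝ) (ξ : R3) :
    ‖oscKernelDeriv σ x v w τ ξ‖ ≤ 1 + 2 * (1 + R ^ 2) * (2 * (1 + R ^ 2)) * (A * wt ξ) := by
  refine (norm_sub_le _ _).trans ?_
  rw [norm_mul, norm_mul, norm_mul, norm_wave, mul_one]
  have h1 := norm_phase_inv_le hv σ ξ
  have h2 := norm_dirSym_le w ξ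
  have h4 := wt_pos ξ
  have h5 : ‖dirSym w ξ‖ ≤ A * wt ξ := h2.trans (by gcongr)
  gcongr

lemma Bootstrap.integrable_oscKernel (hb : Bootstrap α₀ ε T S₀ S Er) (hα : 8 ≤ α₀) (hε : 0 ≤ ε)
    (σ : ℤˣ) {τ : ℝ} (hτ : τ ∈ Set.Ico 0 T) (x v : R3) :
    Integrable fun ξ => oscKernel σ x v τ ξ • profile T S₀ S σ τ ξ := by
  refine (integrable_fourierChar_smul (hb.integrable_phiHat_smul hα hε σ 1 hτ v)
    x).congr (Filter.Eventually.of_forall fun ξ => ?_)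
  simp only [phiHat_eq, pow_one, EoscHat, Circle.smul_def, smul_smul]
  simp only [oscKernel, ← fourierChar_mul_exp]
  congr 1
  ring

lemma Bootstrap.EoscJ_one_eq (hb : Bootstrap α₀ ε T S₀ S Er) (hα : 8 ≤ α₀) (hε : 0 ≤ ε)
    (σ : ℤˣ) {τ : ℝ} (hτ : τ ∈ Set.Ico 0 T) (x v : R3) :
    EoscJ S₀ S σ 1 τ x v = ∫ ξ, oscKernel σ x v τ ξ • profile T S₀ S σ τ ξ := by
  rw [hb.EoscJ_eq hα hε σ 1 hτ, Real.fourierInv_eq]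
  congr 1 with ξ : 1
  rw [phiHat_eq, pow_one, EoscHat, Circle.smul_def, smul_smul, smul_smul]
  simp only [oscKernel, ← fourierChar_mul_exp]
  congr 1
  ring

/-- The increment of `oscKernel • profile` along a characteristic, at a fixed frequency. -/
lemma Bootstrap.oscKernel_smul_sub (hb : Bootstrap α₀ ε T S₀ S Er) (hε : 0 ≤ ε) (σ : ℤˣ)
    {s t R A : ℝ} (hst : s ≤ t) {X V a : ℝ → R3}
    (hX : ∀ τ ∈ Set.Icc s t, HasDerivWithinAt X (relVel (V τ)) (Set.Icc s t) τ)
    (hV : ∀ τ ∈ Set.Icc s t, HasDerivWithinAt V (a τ) (Set.Icc s t) τ)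
    (hR : ∀ τ ∈ Set.Icc s t, ‖V τ‖ ≤ R)
    (hA : ∀ τ ∈ Set.Icc s t, ‖fderiv ℝ relVel (V τ) (a τ)‖ ≤ A) (ξ : R3) :
    oscKernel σ (X t) (V t) t ξ • profile T S₀ S σ t ξ
        - oscKernel σ (X s) (V s) s ξ • profile T S₀ S σ s ξ
      = ∫ τ in s..t, (oscKernelDeriv σ (X τ) (V τ) (fderiv ℝ relVel (V τ) (a τ)) τ ξ
            • profile T S₀ S σ τ ξ
          + oscKernel σ (X τ) (V τ) τ ξ • forceHat T S σ τ ξ) := by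
  have hgi := hb.intervalIntegrable_forceHat hε σ
  exact smul_sub_smul_eq_integral
    (p := fun τ => oscKernel σ (X τ) (V τ) τ ξ)
    (p' := fun τ => oscKernelDeriv σ (X τ) (V τ) (fderiv ℝ relVel (V τ) (a τ)) τ ξ)
    (W := fun τ => profile T S₀ S σ τ ξ) (g := fun τ => forceHat T S σ τ ξ) hst
    (fun τ hτ => hasDerivWithinAt_phase_inv_mul_wave σ ξ (hX τ hτ) (hV τ hτ))
    (fun τ hτ => norm_oscKernelDeriv_le (hR τ hτ) (hA τ hτ) σ (X τ) τ ξ) (hgi ξ s t)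
    (fun τ _ => hb.norm_forceHat_le_const hε σ τ ξ) (fun τ _ => by
      change initHat S₀ σ ξ + _ = initHat S₀ σ ξ + _ + _
      rw [add_assoc, intervalIntegral.integral_add_adjacent_intervals (hgi ξ 0 s) (hgi ξ s τ)])

lemma aestronglyMeasurable_oscKernel {μ : Measure (ℝ × R3)} {X V : ℝ → R3}
    (mX : AEStronglyMeasurable (fun q : ℝ × R3 => X q.1) μ)
    (mV : AEStronglyMeasurable (fun q : ℝ × R3 => V q.1) μ) (σ : ℤˣ) :
    AEStronglyMeasurable (fun q : ℝ × R3 => oscKernel σ (X q.1) (V q.1) q.1 q.2) μ := by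
  have m1 : AEStronglyMeasurable (fun q : ℝ × R3 => q.1) μ := measurable_fst.aestronglyMeasurable
  have m2 : AEStronglyMeasurable (fun q : ℝ × R3 => q.2) μ := measurable_snd.aestronglyMeasurable
  have mwave := (continuous_wave σ).comp_aestronglyMeasurable (mX.prodMk (m1.prodMk m2))
  have mph := (continuous_phase_inv σ).comp_aestronglyMeasurable (mV.prodMk m2)
  exact mph.mul mwave

lemma aestronglyMeasurable_oscKernelDeriv {μ : Measure (ℝ × R3)} {X V w : ℝ → R3}
    (mX : AEStronglyMeasurable (fun q : ℝ × R3 => X q.1) μ)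
    (mV : AEStronglyMeasurable (fun q : ℝ × R3 => V q.1) μ)
    (mw : AEStronglyMeasurable (fun q : ℝ × R3 => w q.1) μ) (σ : ℤˣ) :
    AEStronglyMeasurable (fun q : ℝ × R3 => oscKernelDeriv σ (X q.1) (V q.1) (w q.1) q.1 q.2) μ := by
  have m1 : AEStronglyMeasurable (fun q : ℝ × R3 => q.1) μ := measurable_fst.aestronglyMeasurable
  have m2 : AEStronglyMeasurable (fun q : ℝ × R3 => q.2) μ := measurable_snd.aestronglyMeasurable
  have mwave := (continuous_wave σ).comp_aestronglyMeasurable (mX.prodMk (m1.prodMk m2))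
  have mph := (continuous_phase_inv σ).comp_aestronglyMeasurable (mV.prodMk m2)
  have mdir := continuous_dirSym.comp_aestronglyMeasurable (mw.prodMk m2)
  exact mwave.sub (((mph.mul mph).mul mdir).mul mwave)

lemma Bootstrap.aestronglyMeasurable_profile (hb : Bootstrap α₀ ε T S₀ S Er) (σ : ℤˣ)
    {μ : Measure (ℝ × R3)} (hμ : ∀ᵐ q ∂μ, 0 ≤ q.1) :
    AEStronglyMeasurable (fun q : ℝ × R3 => profile T S₀ S σ q.1 q.2) μ := by
  have hq : Measurable fun q : ℝ × R3 =>
      ((⟨max q.1 0, Set.mem_Ici.2 (le_max_right q.1 0)⟩ : Set.Ici (0 : ℝ)), q.2) :=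
    Measurable.prodMk (Measurable.subtype_mk (by fun_prop)) measurable_snd
  have h1 := (hb.stronglyMeasurable_profile σ).comp_measurable hq
  refine h1.aestronglyMeasurable.congr ?_
  filter_upwards [hμ] with q hq
  simp [max_eq_left hq]

/-- Joint integrability in time and frequency of the derivative of `oscKernel • profile`. -/
lemma Bootstrap.integrable_oscKernelDeriv (hb : Bootstrap α₀ ε T S₀ S Er) (hα : 8 ≤ α₀)
    (hε : 0 ≤ ε) (σ : ℤˣ) {s t R A : ℝ} (hs : 0 ≤ s) (htT : t < T) {X V a : ℝ → R3}
    (hX : ∀ τ ∈ Set.Icc s t, HasDerivWithinAt X (relVel (V τ)) (Set.Icc s t) τ)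
    (hV : ∀ τ ∈ Set.Icc s t, HasDerivWithinAt V (a τ) (Set.Icc s t) τ)
    (hR : ∀ τ ∈ Set.Icc s t, ‖V τ‖ ≤ R)
    (hA : ∀ τ ∈ Set.Icc s t, ‖fderiv ℝ relVel (V τ) (a τ)‖ ≤ A) :
    Integrable (Function.uncurry fun (τ : ℝ) (ξ : R3) =>
      oscKernelDeriv σ (X τ) (V τ) (fderiv ℝ relVel (V τ) (a τ)) τ ξ • profile T S₀ S σ τ ξ
        + oscKernel σ (X τ) (V τ) τ ξ • forceHat T S σ τ ξ)
      ((volume.restrict (Set.Ioc s t)).prod volume) := by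
  have hXc : ContinuousOn X (Set.Icc s t) := fun τ hτ => (hX τ hτ).continuousWithinAt
  have hVc : ContinuousOn V (Set.Icc s t) := fun τ hτ => (hV τ hτ).continuousWithinAt
  set μ := (volume.restrict (Set.Ioc s t)).prod (volume : Measure R3) with hμ
  have hmem : ∀ᵐ q ∂μ, q.1 ∈ Set.Ioc s t := by
    have : ∀ᵐ τ ∂(volume.restrict (Set.Ioc s t)), τ ∈ Set.Ioc s t :=
      ae_restrict_mem measurableSet_Ioc
    exact Measure.quasiMeasurePreserving_fst.ae this
  have mX : AEStronglyMeasurable (fun q : ℝ × R3 => X q.1) μ :=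
    ((hXc.mono Set.Ioc_subset_Icc_self).aestronglyMeasurable measurableSet_Ioc).comp_fst
  have mV0 : AEStronglyMeasurable V (volume.restrict (Set.Ioc s t)) :=
    (hVc.mono Set.Ioc_subset_Icc_self).aestronglyMeasurable measurableSet_Ioc
  have mV : AEStronglyMeasurable (fun q : ℝ × R3 => V q.1) μ := mV0.comp_fst
  -- the force is not assumed to be measurable in time, but it is the derivative of `V`
  have mw0 := continuous_fderiv_relVel_apply.comp_aestronglyMeasurable
      (mV0.prodMk (aestronglyMeasurable_of_hasDerivWithinAt hV))
  have mw : AEStronglyMeasurable (fun q : ℝ × R3 => fderiv ℝ relVel (V q.1) (a q.1)) μ :=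
    mw0.comp_fst
  have mp := aestronglyMeasurable_oscKernel mX mV σ
  have mp' := aestronglyMeasurable_oscKernelDeriv
    (w := fun τ => fderiv ℝ relVel (V τ) (a τ)) mX mV mw σ
  have mW := hb.aestronglyMeasurable_profile σ (μ := μ) (hmem.mono fun q hq => hs.trans hq.1.le)
  have mg : AEStronglyMeasurable (fun q : ℝ × R3 => forceHat T S σ q.1 q.2) μ :=
    (hb.stronglyMeasurable_forceHat σ).aestronglyMeasurable
  have b1 : Integrable (fun q : ℝ × R3 => wt q.2 ^ 4 * profileMaj T S₀ S σ q.2) μ :=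
    (hb.integrable_profileMaj hα hε σ).comp_snd _
  have b2 : Integrable (fun q : ℝ × R3 => wt q.2 ^ 4 * ‖forceHat T S σ q.1 q.2‖) μ :=
    (hb.integrable_wt_pow_forceHat hα hε σ).mono_measure
      (Measure.prod_mono (Measure.restrict_mono_set _ (Set.Ioc_subset_Ioc hs htT.le)) le_rfl)
  set c : ℝ := 2 * (1 + R ^ 2) with hc
  have hc0 : 0 < c := by positivity
  refine ((b1.const_mul (1 + c * c * |A|)).add (b2.const_mul c)).mono'
    ((mp'.smul mW).add (mp.smul mg)) ?_
  filter_upwards [hmem] with q hq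
  have hq' := Set.Ioc_subset_Icc_self hq
  have hw1 := one_le_wt q.2
  have hw0 := wt_pos q.2
  have hM0 := profileMaj_nonneg (T := T) (S₀ := S₀) (S := S) σ q.2
  have hW := hb.norm_profile_le hε σ (t := q.1) ⟨hs.trans hq'.1, hq'.2.trans htT.le⟩ q.2
  refine (norm_add_le _ _).trans (add_le_add ?_ ?_)
  · rw [norm_smul]
    refine (mul_le_mul (c := ‖profile T S₀ S σ q.1 q.2‖)
      ((norm_oscKernelDeriv_le (hR q.1 hq') (hA q.1 hq') σ _ _ _).trans ?_) hW
      (norm_nonneg _) ?_).trans (mul_assoc (1 + c * c * |A|) _ _).le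
    swap
    · positivity
    have h4 : wt q.2 ≤ wt q.2 ^ 4 := le_self_pow₀ hw1 (by norm_num)
    have h5 : 1 ≤ wt q.2 ^ 4 := one_le_pow₀ hw1
    calc 1 + c * c * (A * wt q.2) ≤ wt q.2 ^ 4 + c * c * (|A| * wt q.2 ^ 4) := by
          gcongr
          exact le_abs_self A
      _ = _ := by ring
  · rw [norm_smul]
    refine mul_le_mul (norm_oscKernel_le (hR q.1 hq') σ _ _ _) ?_ (norm_nonneg _) hc0.le
    exact le_mul_of_one_le_left (norm_nonneg _) (one_le_pow₀ hw1)

lemma Bootstrap.integrable_aSym_mul_phiHat_smul (hb : Bootstrap α₀ ε T S₀ S Er) (hα : 8 ≤ α₀)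
    (σ : ℤˣ) {τ : ℝ} (hτ : τ ∈ Set.Ico 0 T) (v : R3) :
    Integrable fun ξ => (aSym σ ((2 * Real.pi) • ξ) * phiHat σ 1 v ((2 * Real.pi) • ξ))
      • srcHat T S τ ξ • kC ξ := by
  have hcont : Continuous fun ξ => aSym σ ((2 * Real.pi) • ξ)
      * phiHat σ 1 v ((2 * Real.pi) • ξ) :=
    ((continuous_aSym σ).comp (continuous_const_smul _)).mul (continuous_phiHat σ 1 _)
  refine ((hb.integrable_srcHat_smul_kC hα hτ).norm.const_mul (1 * (2 * (1 + ‖v‖ ^ 2)))).mono'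
    (hcont.aestronglyMeasurable.smul
      (hb.integrable_srcHat_smul_kC hα hτ).aestronglyMeasurable)
    (Filter.Eventually.of_forall fun ξ => ?_)
  rw [norm_smul, norm_mul]
  have h1 := norm_aSym_mul_le σ ξ
  have h2 := norm_phiHat_le (le_refl ‖v‖) σ 1 ξ
  rw [pow_one] at h2
  have h3 : ‖aSym σ ((2 * Real.pi) • ξ)‖ ≤ 1 :=
    (le_mul_of_one_le_right (norm_nonneg _) (one_le_wt ξ)).trans h1
  gcongr

/-- At a fixed time, the frequency integral of the derivative of `oscKernel • profile` is the derivative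
of `E^{osc,1}_±` along the characteristic. -/
lemma Bootstrap.integral_oscKernelDeriv (hb : Bootstrap α₀ ε T S₀ S Er) (hα : 8 ≤ α₀)
    (hε : 0 ≤ ε) (σ : ℤˣ) {τ : ℝ} (hτT : τ ∈ Set.Ico 0 T) (x v a : R3) :
    ∫ ξ, (oscKernelDeriv σ x v (fderiv ℝ relVel v a) τ ξ • profile T S₀ S σ τ ξ
        + oscKernel σ x v τ ξ • forceHat T S σ τ ξ) = charDeriv S₀ S σ τ x v a := by
  set w := fderiv ℝ relVel v a with hw
  have i1 := integrable_fourierChar_smul (hb.integrable_EoscHat hα hε σ hτT) x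
  have i2 := integrable_fourierChar_smul (hb.integrable_dirSym_smul hα hε σ 2 hτT v w) x
  have i3 := integrable_fourierChar_smul (hb.integrable_aSym_mul_phiHat_smul hα σ hτT v) x
  rw [charDeriv, hb.Eosc_eq hα hε σ hτT, hb.fderiv_EoscJ hα hε σ 2 hτT,
    hb.multiplier_sourceF hα hτT]
  simp only [Real.fourierInv_eq]
  have i12 := i1.sub i2
  rw [← integral_sub i1 i2]
  have e := integral_add i12 i3
  simp only [Pi.sub_apply] at e
  rw [← e]
  congr 1 with ξ : 1
  simp only [EoscHat, phiHat_eq, pow_one, Circle.smul_def, smul_smul, forceHat, oscKernel,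
    oscKernelDeriv, ← fourierChar_mul_exp, ← sub_smul]
  have hexp : Complex.exp (-(lam σ ((2 * Real.pi) • ξ) * τ))
      = (Complex.exp (lam σ ((2 * Real.pi) • ξ) * τ))⁻¹ := Complex.exp_neg _
  have hne := Complex.exp_ne_zero (lam σ ((2 * Real.pi) • ξ) * τ)
  rw [hexp]
  congr 2
  · ring
  · field_simp

/-- Normal form: along a characteristic, the increment of `E^{osc,1}_±` is the integral of `E^osc_±`
and of terms of better decay. -/
theorem Bootstrap.EoscJ_sub_eq_integral (hb : Bootstrap α₀ ε T S₀ S Er) (hα : 8 ≤ α₀)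
    (hε : 0 ≤ ε) (σ : ℤˣ) {s t : ℝ} (hs : 0 ≤ s) (hst : s ≤ t) (htT : t < T) {X V a : ℝ → R3}
    (hX : ∀ τ ∈ Set.Icc s t, HasDerivWithinAt X (relVel (V τ)) (Set.Icc s t) τ)
    (hV : ∀ τ ∈ Set.Icc s t, HasDerivWithinAt V (a τ) (Set.Icc s t) τ)
    {B : ℝ} (hB : ∀ τ ∈ Set.Icc s t, ‖a τ‖ ≤ B) :
    IntervalIntegrable (fun τ => charDeriv S₀ S σ τ (X τ) (V τ) (a τ)) volume s t ∧
      EoscJ S₀ S σ 1 t (X t) (V t) - EoscJ S₀ S σ 1 s (X s) (V s)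
        = ∫ τ in s..t, charDeriv S₀ S σ τ (X τ) (V τ) (a τ) := by
  have hVc : ContinuousOn V (Set.Icc s t) := fun τ hτ => (hV τ hτ).continuousWithinAt
  obtain ⟨R, hR⟩ := isCompact_Icc.exists_bound_of_continuousOn hVc
  obtain ⟨D, hD0, hD⟩ := exists_norm_fderiv_relVel_le R
  have hT : ∀ τ ∈ Set.Icc s t, τ ∈ Set.Ico 0 T := fun τ hτ => ⟨hs.trans hτ.1, hτ.2.trans_lt htT⟩
  have hA : ∀ τ ∈ Set.Icc s t, ‖fderiv ℝ relVel (V τ) (a τ)‖ ≤ D * B := fun τ hτ =>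
    (ContinuousLinearMap.le_opNorm _ _).trans
      (mul_le_mul (hD _ (hR τ hτ)) (hB τ hτ) (norm_nonneg _) hD0.le)
  have step1 := hb.oscKernel_smul_sub hε σ hst hX hV hR hA
  have step3 := hb.integrable_oscKernelDeriv hα hε σ hs htT hX hV hR hA
  have step4 := fun (τ : ℝ) (hτ : τ ∈ Set.Icc s t) =>
    hb.integral_oscKernelDeriv hα hε σ (hT τ hτ) (X τ) (V τ) (a τ)
  have hs' := hT s ⟨le_rfl, hst⟩
  have ht' := hT t ⟨hst, le_rfl⟩
  have key := step3.integral_prod_left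
  simp only [Function.uncurry] at key
  constructor
  · rw [intervalIntegrable_iff_integrableOn_Ioc_of_le hst]
    refine Integrable.congr key ?_
    filter_upwards [ae_restrict_mem measurableSet_Ioc] with τ hτ
    exact step4 τ (Set.Ioc_subset_Icc_self hτ)
  · rw [hb.EoscJ_one_eq hα hε σ ht', hb.EoscJ_one_eq hα hε σ hs',
      ← integral_sub (hb.integrable_oscKernel hα hε σ ht' _ _)
        (hb.integrable_oscKernel hα hε σ hs' _ _)]
    simp only [step1, intervalIntegral.integral_of_le hst]
    rw [← integral_integral_swap step3]
    exact setIntegral_congr_fun measurableSet_Ioc fun τ hτ => step4 τ (Set.Ioc_subset_Icc_self hτ)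

end Characteristic

/-! ### Pointwise decay of the fields -/

section Decay

lemma toC3_add (v w : R3) : toC3 (v + w) = toC3 v + toC3 w := by
  ext j; simp [toC3]

lemma toC3_smul (c : ℝ) (v : R3) : toC3 (c • v) = c • toC3 v := by
  ext j; simp [toC3]

lemma norm_toC3 (v : R3) : ‖toC3 v‖ = ‖v‖ := by
  simp [EuclideanSpace.norm_eq, toC3]

/-- The inclusion of real vectors into complex vectors as a linear isometry. -/
def toC3Isometry : R3 →ₗᵢ[ℝ] C3 where
  toFun := toC3
  map_add' := toC3_add
  map_smul' := toC3_smul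
  norm_map' := norm_toC3

/-- For a continuous function an essential bound holds everywhere. -/
lemma norm_le_of_eLpNorm_top_le {G : Type*} [NormedAddCommGroup G] {f : R3 → G}
    (hf : Continuous f) {C : ℝ} (hC : 0 ≤ C) (h : eLpNorm f ⊤ volume ≤ ENNReal.ofReal C)
    (x : R3) : ‖f x‖ ≤ C := by
  have hae : ∀ᵐ y, ‖f y‖ ≤ C := by
    filter_upwards [enorm_ae_le_eLpNormEssSup f volume] with y hy
    rw [eLpNorm_exponent_top] at h
    have := hy.trans h
    rwa [← ofReal_norm, ENNReal.ofReal_le_ofReal_iff hC] at this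
  have hm : (fun y => max ‖f y‖ C) = fun _ => C :=
    Continuous.ae_eq_iff_eq volume (by fun_prop) continuous_const |>.1
      (hae.mono fun y hy => max_eq_right hy)
  exact max_eq_right_iff.1 (congrFun hm x)

variable {α₀ : ℕ} {ε T : ℝ} {S₀ : ℤˣ → R3 → ℂ} {S : ℝ → R3 → ℝ} {Er E : ℝ → R3 → R3}

lemma Bootstrap.norm_Eosc_le (hb : Bootstrap α₀ ε T S₀ S Er) (hα : 8 ≤ α₀) (hε : 0 ≤ ε) (σ : ℤˣ)
    {t : ℝ} (ht : t ∈ Set.Ico 0 T) (x : R3) :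
    ‖Eosc S₀ S σ t x‖ ≤ ε * bracket t ^ (-(3 / 2) : ℝ) := by
  have hc : Continuous (Eosc S₀ S σ t) := by
    rw [hb.Eosc_eq hα hε σ ht]
    exact continuous_fourierInv (hb.integrable_EoscHat hα hε σ ht)
  refine norm_le_of_eLpNorm_top_le hc
    (mul_nonneg hε (Real.rpow_nonneg (bracket_pos _).le _)) ?_ x
  convert hb.decay_Eosc σ t ht ⊤ le_top using 4
  norm_num

lemma Bootstrap.norm_Er_le (hb : Bootstrap α₀ ε T S₀ S Er) (hε : 0 ≤ ε)
    {t : ℝ} (ht : t ∈ Set.Ico 0 T) (x : R3) :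
    ‖Er t x‖ ≤ ε * bracket t ^ (-3 : ℝ) := by
  refine norm_le_of_eLpNorm_top_le (hb.Er_continuous t ht)
    (mul_nonneg hε (Real.rpow_nonneg (bracket_pos _).le _)) ?_ x
  convert hb.decay_Er t ht ⊤ le_top using 4
  norm_num

lemma Bootstrap.norm_sourceF_le (hb : Bootstrap α₀ ε T S₀ S Er) (hα : 8 ≤ α₀) (hε : 0 ≤ ε)
    {t : ℝ} (ht : t ∈ Set.Ico 0 T) (x : R3) :
    ‖sourceF S t x‖ ≤ ε * bracket t ^ (-3 : ℝ) := by
  have hc : Continuous (sourceF S t) := by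
    rw [hb.sourceF_eq hα ht]
    exact continuous_fourierInv (hb.integrable_srcHat_smul_kC hα ht)
  refine norm_le_of_eLpNorm_top_le hc
    (mul_nonneg hε (Real.rpow_nonneg (bracket_pos _).le _)) ?_ x
  refine (le_add_self.trans (hb.decay_S t ht ⊤ le_top)).trans_eq ?_
  congr 3
  norm_num

lemma norm_sum_units_le {G : Type*} [NormedAddCommGroup G] {f : ℤˣ → G} {C : ℝ}
    (h : ∀ σ, ‖f σ‖ ≤ C) : ‖∑ σ, f σ‖ ≤ 2 * C := by
  refine (norm_sum_le_of_le _ fun σ _ => h σ).trans ?_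
  simp

lemma bracket_rpow_neg_three_le (t : ℝ) :
    bracket t ^ (-3 : ℝ) ≤ bracket t ^ (-(3 / 2) : ℝ) :=
  Real.rpow_le_rpow_of_exponent_le (one_le_bracket t) (by norm_num)

lemma Bootstrap.norm_field_le (hb : Bootstrap α₀ ε T S₀ S Er) (hα : 8 ≤ α₀) (hε : 0 ≤ ε)
    (hE : IsField T S₀ S Er E) {t : ℝ} (ht : t ∈ Set.Ico 0 T) (x : R3) :
    ‖E t x‖ ≤ 3 * (ε * bracket t ^ (-(3 / 2) : ℝ)) := by
  rw [← norm_toC3, hE t ht x]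
  refine (norm_add_le _ _).trans ?_
  have h1 := norm_sum_units_le fun σ => hb.norm_Eosc_le hα hε σ ht x
  have h2 := hb.norm_Er_le hε ht x
  have h3 := mul_le_mul_of_nonneg_left (bracket_rpow_neg_three_le t) hε
  rw [norm_toC3]
  linarith

/-- The fields `E^{osc,1}_±` decay like `E^osc_±`, uniformly for bounded velocities. -/
lemma exists_norm_EoscJ_one_le (R : ℝ) : ∃ C : ℝ, 0 ≤ C ∧ ∀ {α₀ : ℕ} {ε T : ℝ}
    {S₀ : ℤˣ → R3 → ℂ} {S : ℝ → R3 → ℝ} {Er : ℝ → R3 → R3}, Bootstrap α₀ ε T S₀ S Er → 8 ≤ α₀ →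
      0 ≤ ε → ∀ (σ : ℤˣ), ∀ t ∈ Set.Ico 0 T, ∀ (x v : R3), ‖v‖ ≤ R →
      ‖EoscJ S₀ S σ 1 t x v‖ ≤ C * (ε * bracket t ^ (-(3 / 2) : ℝ)) := by
  obtain ⟨C, hC, h⟩ := exists_sup_bound (isSym_phiHat_one R)
  refine ⟨C, hC, fun {α₀ ε T S₀ S Er} hb hα hε σ t ht x v hv => ?_⟩
  rw [hb.EoscJ_eq hα hε σ 1 ht]
  refine h (σ, ⟨v, hv⟩) _ (hb.integrable_EoscHat hα hε σ ht) _ (fun y => ?_) x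
  rw [← hb.Eosc_eq hα hε σ ht]
  exact hb.norm_Eosc_le hα hε σ ht y

lemma exists_norm_multiplier_sourceF_le (R : ℝ) : ∃ C : ℝ, 0 ≤ C ∧ ∀ {α₀ : ℕ} {ε T : ℝ}
    {S₀ : ℤˣ → R3 → ℂ} {S : ℝ → R3 → ℝ} {Er : ℝ → R3 → R3}, Bootstrap α₀ ε T S₀ S Er → 8 ≤ α₀ →
      0 ≤ ε → ∀ (σ : ℤˣ), ∀ t ∈ Set.Ico 0 T, ∀ (x v : R3), ‖v‖ ≤ R →
      ‖multiplier (fun k => aSym σ k * phiHat σ 1 v k) (sourceF S t) x‖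
        ≤ C * (ε * bracket t ^ (-3 : ℝ)) := by
  obtain ⟨C, hC, h⟩ := exists_sup_bound (isSym_aSym_mul_phiHat_one R)
  refine ⟨C, hC, fun {α₀ ε T S₀ S Er} hb hα hε σ t ht x v hv => ?_⟩
  rw [hb.multiplier_sourceF hα ht]
  refine h (σ, ⟨v, hv⟩) _ (hb.integrable_srcHat_smul_kC hα ht) _ (fun y => ?_) x
  rw [← hb.sourceF_eq hα ht]
  exact hb.norm_sourceF_le hα hε ht y

/-- The derivative of `E^{osc,2}_±` in the direction `d` decays like `E^osc_±`; the symbol `ik·d φ_{±,2}`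
has order `-1` again. -/
lemma exists_norm_fderiv_EoscJ_two_le (R : ℝ) : ∃ C : ℝ, 0 ≤ C ∧ ∀ {α₀ : ℕ} {ε T : ℝ}
    {S₀ : ℤˣ → R3 → ℂ} {S : ℝ → R3 → ℝ} {Er : ℝ → R3 → R3}, Bootstrap α₀ ε T S₀ S Er → 8 ≤ α₀ →
      0 ≤ ε → ∀ (σ : ℤˣ), ∀ t ∈ Set.Ico 0 T, ∀ (x v d : R3), ‖v‖ ≤ R →
      ‖fderiv ℝ (fun y => EoscJ S₀ S σ 2 t y v) x d‖
        ≤ ‖d‖ * (C * (ε * bracket t ^ (-(3 / 2) : ℝ))) := by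
  obtain ⟨C, hC, h⟩ := exists_sup_bound (isSym_inner_mul_phiHat_two R)
  refine ⟨C, hC, fun {α₀ ε T S₀ S Er} hb hα hε σ t ht x v d hv => ?_⟩
  have hunit : ∀ e : R3, ‖e‖ ≤ 1 → ‖fderiv ℝ (fun y => EoscJ S₀ S σ 2 t y v) x e‖
      ≤ C * (ε * bracket t ^ (-(3 / 2) : ℝ)) := fun e he => by
    rw [hb.fderiv_EoscJ hα hε σ 2 ht]
    simp only [smul_smul]
    refine h ((σ, ⟨v, hv⟩), ⟨e, he⟩) _ (hb.integrable_EoscHat hα hε σ ht) _ (fun y => ?_) x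
    rw [← hb.Eosc_eq hα hε σ ht]
    exact hb.norm_Eosc_le hα hε σ ht y
  rcases eq_or_ne d 0 with rfl | hd
  · simp
  · have hd' : ‖d‖ ≠ 0 := norm_ne_zero_iff.2 hd
    have e : d = ‖d‖ • ‖d‖⁻¹ • d := by rw [smul_smul, mul_inv_cancel₀ hd', one_smul]
    have h1 := hunit (‖d‖⁻¹ • d) (by rw [norm_smul, norm_inv, norm_norm, inv_mul_cancel₀ hd'])
    conv_lhs => rw [e, map_smul, norm_smul, norm_norm]
    gcongr

/-- The source `Q^tr` decays at the rate `⟨t⟩⁻³`, uniformly for bounded velocities: its first and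
last terms are linear in the source density and in `E^r`, the other one is quadratic in the field. -/
lemma exists_norm_Qtr_le (R : ℝ) : ∃ C : ℝ, 0 ≤ C ∧ ∀ {α₀ : ℕ} {ε T : ℝ}
    {S₀ : ℤˣ → R3 → ℂ} {S : ℝ → R3 → ℝ} {Er E : ℝ → R3 → R3}, Bootstrap α₀ ε T S₀ S Er →
      IsField T S₀ S Er E → 8 ≤ α₀ → 0 ≤ ε → ε ≤ 1 →
      ∀ t ∈ Set.Ico 0 T, ∀ (x v : R3), ‖v‖ ≤ R →
      ‖Qtr S₀ S Er E t x v‖ ≤ C * (ε * bracket t ^ (-3 : ℝ)) := by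
  obtain ⟨C₁, hC₁, h₁⟩ := exists_norm_multiplier_sourceF_le R
  obtain ⟨C₂, hC₂, h₂⟩ := exists_norm_fderiv_EoscJ_two_le R
  obtain ⟨D, hD, hD'⟩ := exists_norm_fderiv_relVel_le R
  refine ⟨2 * C₁ + 6 * D * C₂ + 1, by positivity,
    fun {α₀ ε T S₀ S Er E} hb hE hα hε hε1 t ht x v hv => ?_⟩
  have k1 := norm_sum_units_le fun σ => h₁ hb hα hε σ t ht x v hv
  have hd : ‖fderiv ℝ relVel v (E t x)‖ ≤ D * (3 * (ε * bracket t ^ (-(3 / 2) : ℝ))) :=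
    (ContinuousLinearMap.le_opNorm _ _).trans
      (mul_le_mul (hD' v hv) (hb.norm_field_le hα hε hE ht x) (norm_nonneg _) hD.le)
  have hb0 : 0 ≤ bracket t ^ (-(3 / 2) : ℝ) := Real.rpow_nonneg (bracket_pos _).le _
  have hb1 : 0 ≤ bracket t ^ (-3 : ℝ) := Real.rpow_nonneg (bracket_pos _).le _
  have hsq : bracket t ^ (-(3 / 2) : ℝ) * bracket t ^ (-(3 / 2) : ℝ) = bracket t ^ (-3 : ℝ) := by
    rw [← Real.rpow_add (bracket_pos t)]; norm_num
  have k2 := norm_sum_units_le fun σ => (h₂ hb hα hε σ t ht x v (fderiv ℝ relVel v (E t x)) hv).trans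
    ((mul_le_mul_of_nonneg_right hd (by positivity)).trans_eq
      (show _ = 3 * D * C₂ * (ε * (ε * bracket t ^ (-3 : ℝ))) by rw [← hsq]; ring))
  have k3 := hb.norm_Er_le hε ht x
  have k4 : 3 * D * C₂ * (ε * (ε * bracket t ^ (-3 : ℝ)))
      ≤ 3 * D * C₂ * (ε * bracket t ^ (-3 : ℝ)) := by
    gcongr
    exact mul_le_of_le_one_left (by positivity) hε1
  refine (norm_add_le _ _).trans ((add_le_add_left (norm_add_le _ _) _).trans ?_)
  rw [norm_neg, norm_toC3]
  linarith

end Decay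

/-! ### Time integrals -/

section TimeIntegrals

lemma integrable_bracket_rpow : Integrable fun t : ℝ => bracket t ^ (-(3 / 2) : ℝ) := by
  have h := integrable_rpow_neg_one_add_norm_sq (E := ℝ) (μ := volume) (r := 3 / 2) (by norm_num)
  refine h.congr (Filter.Eventually.of_forall fun t => ?_)
  simp only [bracket, Real.sqrt_eq_rpow]
  rw [← Real.rpow_mul (by positivity)]
  norm_num

/-- `⟨t⟩⁻³` has the primitive `t / ⟨t⟩`. -/
lemma hasDerivAt_div_bracket (t : ℝ) :
    HasDerivAt (fun τ : ℝ => τ / bracket τ) (bracket t ^ (-3 : ℝ)) t := by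
  have hb := bracket_pos t
  have hsq := bracket_sq t
  have h1 : HasDerivAt (bracket : ℝ → ℝ) (t / bracket t) t := by
    have h2 : HasDerivAt (fun τ : ℝ => 1 + ‖τ‖ ^ 2) (2 * t) t := by
      simp only [Real.norm_eq_abs, sq_abs]
      simpa using (hasDerivAt_pow 2 t).const_add 1
    have h3 := h2.sqrt (by positivity)
    refine h3.congr_deriv ?_
    change _ = t / Real.sqrt _
    field_simp
  refine ((hasDerivAt_id t).div h1 hb.ne').congr_deriv ?_
  rw [Real.rpow_neg hb.le, show (3 : ℝ) = (3 : ℕ) by norm_num, Real.rpow_natCast]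
  rw [Real.norm_eq_abs, sq_abs] at hsq
  simp only [id]
  field_simp
  linarith

lemma continuous_bracket_rpow (r : ℝ) : Continuous fun τ : ℝ => bracket τ ^ r :=
  continuous_bracket.rpow_const fun τ => Or.inl (bracket_pos τ).ne'

lemma integral_bracket_rpow_le {s t : ℝ} (hs : 0 ≤ s) :
    ∫ τ in s..t, bracket τ ^ (-3 : ℝ) ≤ bracket s ^ (-2 : ℝ) := by
  rw [intervalIntegral.integral_eq_sub_of_hasDerivAt (fun τ _ => hasDerivAt_div_bracket τ)
    ((continuous_bracket_rpow _).intervalIntegrable _ _)]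
  have hs0 := bracket_pos s
  have ht0 := bracket_pos t
  have hsq := bracket_sq s
  have hlt := norm_lt_bracket s
  have h1 : t / bracket t ≤ 1 := by
    rw [div_le_one ht0]
    exact (le_abs_self t).trans (norm_lt_bracket t).le
  rw [Real.norm_eq_abs, abs_of_nonneg hs] at hsq hlt
  rw [Real.rpow_neg hs0.le, show (2 : ℝ) = (2 : ℕ) by norm_num, Real.rpow_natCast]
  have h2 : 1 - s / bracket s ≤ (bracket s ^ 2)⁻¹ := by
    rw [← one_div, le_div_iff₀ (by positivity)]
    have : (1 - s / bracket s) * bracket s ^ 2 = bracket s ^ 2 - s * bracket s := by field_simp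
    rw [this]
    nlinarith
  linarith

end TimeIntegrals

/-! ### The velocity characteristics -/

section Velocity

variable {α₀ : ℕ} {ε T : ℝ} {S₀ : ℤˣ → R3 → ℂ} {S : ℝ → R3 → ℝ} {Er E : ℝ → R3 → R3}
  {X V : ℝ → ℝ → R3 → R3 → R3}

lemma IsCharacteristic.hasDerivWithinAt_X (hc : IsCharacteristic T E X V) {s t : ℝ} (hs : 0 ≤ s)
    (hst : s ≤ t) (htT : t < T) (x v : R3) : ∀ τ ∈ Set.Icc s t,
    HasDerivWithinAt (fun r => X r t x v) (relVel (V τ t x v)) (Set.Icc s t) τ := fun τ hτ =>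
  (hc.hasDeriv_X t ⟨hs.trans hst, htT⟩ x v τ ⟨hs.trans hτ.1, hτ.2⟩).mono (Set.Icc_subset_Icc_left hs)

lemma IsCharacteristic.hasDerivWithinAt_V (hc : IsCharacteristic T E X V) {s t : ℝ} (hs : 0 ≤ s)
    (hst : s ≤ t) (htT : t < T) (x v : R3) : ∀ τ ∈ Set.Icc s t,
    HasDerivWithinAt (fun r => V r t x v) (E τ (X τ t x v)) (Set.Icc s t) τ := fun τ hτ =>
  (hc.hasDeriv_V t ⟨hs.trans hst, htT⟩ x v τ ⟨hs.trans hτ.1, hτ.2⟩).mono (Set.Icc_subset_Icc_left hs)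

lemma sub_eq_integral_of_hasDerivWithinAt {F : Type*} [NormedAddCommGroup F] [NormedSpace ℝ F]
    [CompleteSpace F] {f f' : ℝ → F} {s t : ℝ} (hst : s ≤ t)
    (hf : ∀ τ ∈ Set.Icc s t, HasDerivWithinAt f (f' τ) (Set.Icc s t) τ)
    (hi : IntervalIntegrable f' volume s t) : f t - f s = ∫ τ in s..t, f' τ :=
  (intervalIntegral.integral_eq_sub_of_hasDerivAt_of_le hst
    (fun τ hτ => (hf τ hτ).continuousWithinAt)
    (fun τ hτ => (hf τ (Set.Ioo_subset_Icc_self hτ)).hasDerivAt (Icc_mem_nhds hτ.1 hτ.2)) hi).symm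

lemma Bootstrap.norm_field_le_const (hb : Bootstrap α₀ ε T S₀ S Er) (hα : 8 ≤ α₀) (hε : 0 ≤ ε)
    (hE : IsField T S₀ S Er E) {t : ℝ} (ht : t ∈ Set.Ico 0 T) (x : R3) : ‖E t x‖ ≤ 3 * ε := by
  refine (hb.norm_field_le hα hε hE ht x).trans ?_
  have : bracket t ^ (-(3 / 2) : ℝ) ≤ 1 :=
    Real.rpow_le_one_of_one_le_of_nonpos (one_le_bracket t) (by norm_num)
  have := mul_le_of_le_one_right hε this
  linarith

/-- The field is integrable in time, hence the velocity stays at a bounded distance from its final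
value. -/
lemma Bootstrap.norm_sub_velocity_le (hb : Bootstrap α₀ ε T S₀ S Er) (hα : 8 ≤ α₀) (hε : 0 ≤ ε)
    (hε1 : ε ≤ 1) (hE : IsField T S₀ S Er E) (hc : IsCharacteristic T E X V) {s t : ℝ} (hs : 0 ≤ s)
    (hst : s ≤ t) (htT : t < T) (x v : R3) :
    ‖v - V s t x v‖ ≤ 3 * ∫ τ : ℝ, bracket τ ^ (-(3 / 2) : ℝ) := by
  have hT : ∀ τ ∈ Set.Icc s t, τ ∈ Set.Ico 0 T := fun τ hτ => ⟨hs.trans hτ.1, hτ.2.trans_lt htT⟩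
  have hV := hc.hasDerivWithinAt_V hs hst htT x v
  have hi := integrable_deriv_of_bound hst hV
    fun τ hτ => hb.norm_field_le_const hα hε hE (hT τ hτ) _
  have h := sub_eq_integral_of_hasDerivWithinAt hst hV hi
  simp only [hc.V_self t (hT t ⟨hst, le_rfl⟩)] at h
  rw [h]
  have hn : ∀ τ, 0 ≤ bracket τ ^ (-(3 / 2) : ℝ) := fun τ : ℝ =>
    Real.rpow_nonneg (bracket_pos τ).le _
  calc _ ≤ ∫ τ in s..t, 3 * bracket τ ^ (-(3 / 2) : ℝ) := by
        refine intervalIntegral.norm_integral_le_of_norm_le hst ?_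
          ((integrable_bracket_rpow.const_mul 3).intervalIntegrable)
        refine Filter.Eventually.of_forall fun τ hτ => ?_
        refine (hb.norm_field_le hα hε hE (hT τ (Set.Ioc_subset_Icc_self hτ)) _).trans ?_
        gcongr
        exact mul_le_of_le_one_left (hn τ) hε1
    _ = 3 * ∫ τ in s..t, bracket τ ^ (-(3 / 2) : ℝ) := intervalIntegral.integral_const_mul _ _
    _ ≤ _ := by
        rw [intervalIntegral.integral_of_le hst]
        exact mul_le_mul_of_nonneg_left
          (setIntegral_le_integral integrable_bracket_rpow (Filter.Eventually.of_forall hn))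
          (by norm_num)

/-- Along a characteristic the normal forms of `E^osc_±` and `Q^tr` add up to the field. -/
lemma IsField.sum_charDeriv (hE : IsField T S₀ S Er E) {t : ℝ} (ht : t ∈ Set.Ico 0 T) (x v : R3) :
    ∑ σ, charDeriv S₀ S σ t x v (E t x) = toC3 (E t x) - Qtr S₀ S Er E t x v := by
  simp only [charDeriv, Finset.sum_add_distrib, Finset.sum_sub_distrib]
  rw [hE t ht x, Qtr]
  abel

/-- The decomposition of the velocity. The source `Q^tr` is integrable along the characteristic because
it is the difference of the integrable functions `E` and `∑_± charDeriv`. -/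
lemma Bootstrap.velocity_eq (hb : Bootstrap α₀ ε T S₀ S Er) (hα : 8 ≤ α₀) (hε : 0 ≤ ε)
    (hE : IsField T S₀ S Er E) (hc : IsCharacteristic T E X V) {s t : ℝ} (hs : 0 ≤ s)
    (hst : s ≤ t) (htT : t < T) (x v : R3) :
    IntervalIntegrable (fun τ => Qtr S₀ S Er E τ (X τ t x v) (V τ t x v)) volume s t ∧
      toC3 (V s t x v) = toC3 v - Vosc S₀ S X V t t x v
        + Vosc S₀ S X V s t x v + Vtr S₀ S Er E X V s t x v := by
  have hT : ∀ τ ∈ Set.Icc s t, τ ∈ Set.Ico 0 T := fun τ hτ => ⟨hs.trans hτ.1, hτ.2.trans_lt htT⟩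
  have hX := hc.hasDerivWithinAt_X hs hst htT x v
  have hV := hc.hasDerivWithinAt_V hs hst htT x v
  have hB : ∀ τ ∈ Set.Icc s t, ‖E τ (X τ t x v)‖ ≤ 3 * ε :=
    fun τ hτ => hb.norm_field_le_const hα hε hE (hT τ hτ) _
  have hosc := fun σ => hb.EoscJ_sub_eq_integral hα hε σ hs hst htT hX hV hB
  have hVC : ∀ τ ∈ Set.Icc s t, HasDerivWithinAt (fun r => toC3 (V r t x v))
      (toC3 (E τ (X τ t x v))) (Set.Icc s t) τ := fun τ hτ =>
    toC3Isometry.toContinuousLinearMap.hasFDerivAt.comp_hasDerivWithinAt τ (hV τ hτ)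
  have hi : IntervalIntegrable (fun τ => toC3 (E τ (X τ t x v))) volume s t :=
    integrable_deriv_of_bound hst hVC fun τ hτ => (norm_toC3 _).trans_le (hB τ hτ)
  have hVel := sub_eq_integral_of_hasDerivWithinAt hst hVC hi
  have hsum : IntervalIntegrable (fun τ => ∑ σ, charDeriv S₀ S σ τ (X τ t x v) (V τ t x v)
      (E τ (X τ t x v))) volume s t := by
    have := IntervalIntegrable.sum Finset.univ fun σ _ => (hosc σ).1
    simpa only [Finset.sum_fn] using this
  have hQ : Set.EqOn (fun τ => toC3 (E τ (X τ t x v)) - ∑ σ, charDeriv S₀ S σ τ (X τ t x v)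
      (V τ t x v) (E τ (X τ t x v))) (fun τ => Qtr S₀ S Er E τ (X τ t x v) (V τ t x v))
      (Set.uIcc s t) := fun τ hτ => by
    rw [Set.uIcc_of_le hst] at hτ
    simp only [hE.sum_charDeriv (hT τ hτ)]
    abel
  refine ⟨(hi.sub hsum).congr fun τ hτ => hQ (Set.uIoc_subset_uIcc hτ), ?_⟩
  have hVosc : Vosc S₀ S X V t t x v - Vosc S₀ S X V s t x v
      = ∫ τ in s..t, ∑ σ, charDeriv S₀ S σ τ (X τ t x v) (V τ t x v) (E τ (X τ t x v)) := by
    rw [intervalIntegral.integral_finsetSum fun σ _ => (hosc σ).1, Vosc, Vosc,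
      ← Finset.sum_sub_distrib]
    exact Finset.sum_congr rfl fun σ _ => (hosc σ).2
  rw [Vtr, ← intervalIntegral.integral_congr hQ, intervalIntegral.integral_sub hi hsum, ← hVosc,
    ← hVel, hc.V_self t (hT t ⟨hst, le_rfl⟩)]
  abel

end Velocity

end VKG

theorem proposition3p3 (α₀ : ℕ) (hα₀ : 8 ≤ α₀) :
    ∃ ε₀ : ℝ, 0 < ε₀ ∧ ∀ K : Set VKG.R3, IsCompact K → ∃ C : ℝ, 0 < C ∧
      ∀ (ε T : ℝ), 0 < ε → ε ≤ ε₀ → 0 < T →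
      ∀ (S₀ : ℤˣ → VKG.R3 → ℂ) (S : ℝ → VKG.R3 → ℝ) (Er E : ℝ → VKG.R3 → VKG.R3)
        (X V : ℝ → ℝ → VKG.R3 → VKG.R3 → VKG.R3),
      VKG.Bootstrap α₀ ε T S₀ S Er → VKG.IsField T S₀ S Er E → VKG.IsCharacteristic T E X V →
      ∀ s t : ℝ, 0 ≤ s → s ≤ t → t < T →
        (∀ x v : VKG.R3,
          IntervalIntegrable (fun τ => VKG.Qtr S₀ S Er E τ (X τ t x v) (V τ t x v)) volume s t ∧
          VKG.toC3 (V s t x v) = VKG.toC3 v - VKG.Vosc S₀ S X V t t x v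
            + VKG.Vosc S₀ S X V s t x v + VKG.Vtr S₀ S Er E X V s t x v) ∧
        (∀ x : VKG.R3, ∀ v ∈ K,
          ‖VKG.Vosc S₀ S X V s t x v‖ ≤ C * ε * VKG.bracket s ^ (-(3 / 2) : ℝ) ∧
          ‖VKG.Vtr S₀ S Er E X V s t x v‖ ≤ C * ε * VKG.bracket s ^ (-2 : ℝ) ∧
          ‖VKG.toC3 (V s t x v) - VKG.toC3 v + VKG.Vosc S₀ S X V t t x v‖
            ≤ C * ε * VKG.bracket s ^ (-(3 / 2) : ℝ)) := by
  -- `ε ≤ 1` confines the velocities to a fixed ball and bounds the quadratic term of `Q^tr`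
  refine ⟨1, one_pos, fun K hK => ?_⟩
  obtain ⟨r, hr⟩ := hK.isBounded.exists_norm_le
  set R : ℝ := r + 3 * ∫ τ : ℝ, VKG.bracket τ ^ (-(3 / 2) : ℝ) with hR
  obtain ⟨C₁, hC₁, h₁⟩ := VKG.exists_norm_EoscJ_one_le R
  obtain ⟨C₂, hC₂, h₂⟩ := VKG.exists_norm_Qtr_le R
  refine ⟨2 * C₁ + C₂ + 1, by positivity, fun ε T hε hε1 _ S₀ S Er E X V hb hE hc s t hs hst htT => ?_⟩
  have hid := fun x v => hb.velocity_eq hα₀ hε.le hE hc hs hst htT x v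
  refine ⟨hid, fun x v hv => ?_⟩
  have hT : ∀ τ ∈ Set.Icc s t, τ ∈ Set.Ico 0 T := fun τ hτ => ⟨hs.trans hτ.1, hτ.2.trans_lt htT⟩
  -- the velocities stay in the ball of radius `R`
  have hVR : ∀ τ ∈ Set.Icc s t, ‖V τ t x v‖ ≤ R := fun τ hτ => by
    have h1 := hb.norm_sub_velocity_le hα₀ hε.le hε1 hE hc (hs.trans hτ.1) hτ.2 htT x v
    have h2 := norm_sub_norm_le (V τ t x v) v
    rw [norm_sub_rev] at h2
    linarith [hr v hv]
  have hs' : s ∈ Set.Icc s t := ⟨le_rfl, hst⟩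
  have b1 : 0 ≤ ε * VKG.bracket s ^ (-(3 / 2) : ℝ) :=
    mul_nonneg hε.le (Real.rpow_nonneg (VKG.bracket_pos s).le _)
  have b2 : 0 ≤ ε * VKG.bracket s ^ (-2 : ℝ) :=
    mul_nonneg hε.le (Real.rpow_nonneg (VKG.bracket_pos s).le _)
  have b3 : ε * VKG.bracket s ^ (-2 : ℝ) ≤ ε * VKG.bracket s ^ (-(3 / 2) : ℝ) :=
    mul_le_mul_of_nonneg_left
      (Real.rpow_le_rpow_of_exponent_le (VKG.one_le_bracket s) (by norm_num)) hε.le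
  have hosc : ‖VKG.Vosc S₀ S X V s t x v‖ ≤ 2 * (C₁ * (ε * VKG.bracket s ^ (-(3 / 2) : ℝ))) :=
    VKG.norm_sum_units_le fun σ => h₁ hb hα₀ hε.le σ s (hT s hs') _ _ (hVR s hs')
  have htr : ‖VKG.Vtr S₀ S Er E X V s t x v‖ ≤ C₂ * (ε * VKG.bracket s ^ (-2 : ℝ)) := by
    rw [VKG.Vtr, norm_neg]
    calc _ ≤ ∫ τ in s..t, C₂ * ε * VKG.bracket τ ^ (-3 : ℝ) := by
          refine intervalIntegral.norm_integral_le_of_norm_le hst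
            (Filter.Eventually.of_forall fun τ hτ => ?_)
            ((continuous_const.mul (VKG.continuous_bracket_rpow _)).intervalIntegrable _ _)
          have hτ' := Set.Ioc_subset_Icc_self hτ
          rw [mul_assoc]
          exact h₂ hb hE hα₀ hε.le hε1 τ (hT τ hτ') _ _ (hVR τ hτ')
      _ = C₂ * ε * ∫ τ in s..t, VKG.bracket τ ^ (-3 : ℝ) :=
          intervalIntegral.integral_const_mul _ _
      _ ≤ C₂ * ε * VKG.bracket s ^ (-2 : ℝ) :=
          mul_le_mul_of_nonneg_left (VKG.integral_bracket_rpow_le hs) (mul_nonneg hC₂ hε.le)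
      _ = _ := mul_assoc _ _ _
  have c1 := mul_nonneg hC₁ b1
  have c2 := mul_nonneg hC₂ b1
  have c3 := mul_nonneg hC₁ b2
  have c4 := mul_le_mul_of_nonneg_left b3 hC₂
  refine ⟨by linarith, by linarith, ?_⟩
  have e : VKG.toC3 (V s t x v) - VKG.toC3 v + VKG.Vosc S₀ S X V t t x v
      = VKG.Vosc S₀ S X V s t x v + VKG.Vtr S₀ S Er E X V s t x v := by
    rw [(hid x v).2]; abel
  rw [e]
  refine (norm_add_le _ _).trans ?_
  linarith
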